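/- **Theorem 7.1.** Let $\ell\ge 5$ be an integer. All graphs are finite and simple, and $|G|$ is the number of vertices of $G$. The *length* of a path or cycle is its number of edges, and its *parity* is the parity of its length; the *interior* of a path is the set of its vertices other than its ends. A *hole* of $G$ is an induced subgraph that is a cycle of length at least $4$. A *long odd hole* is a hole of odd length at least $\ell$; a *shortest* long odd hole of $G$ is one of minimum length. A *long jewel of order* $\max(|V(Q_1)|,|V(Q_2)|)$ is formed by induced paths $Q_1,Q_2,P$ of $G$ with the same two ends $u,v$, where $Q_1,Q_2$ have different parity, $P$ has length at least $\ell$, and no vertex of the interior of $P$ equals or is adjacent to a vertex of the interior of $Q_1$ or of $Q_2$. A *long pyramid* is formed by induced paths $P_1,P_2,P_3$ of $G$, where $P_i$ has ends $v_0$ and $v_i\neq v_0$, which are pairwise vertex-disjoint except for $v_0$, such that at least two of them have length at least $\ell$, the vertices $v_1,v_2,v_3$ are pairwise adjacent, and for $i<j$ the only edge between $V(P_i)\setminus\{v_0\}$ and $V(P_j)\setminus\{v_0\}$ is $v_iv_j$. The graph $G$ is a *candidate* if it contains no long pyramid, no long jewel of order at most $\ell+2$, and no long odd hole of length at most $2\ell+2$.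 Let $C$ be a shortest long odd hole of $G$. A vertex $v\notin V(C)$ is *$C$-major* if no three-vertex path of $C$ contains all the neighbours of $v$ in $V(C)$. A *base* for $C$ is a pair $(x,D)$ where $D$ is a path of $C$ that is maximal under inclusion among the paths of $C$ such that some $C$-major vertex is adjacent to both ends and to no interior vertex of the path, and $x$ is such a $C$-major vertex for $D$. Let $d_1,d_2$ be the ends of $D$, and let $d_C$ denote distance in $C$. The base $(x,D)$ is *remote* if $D$ has length at least $2\ell$ and no $C$-major vertex different from $x$ has a neighbour $w\in V(C)$ with $d_C(w,d_i)<\ell$ for some $i\in\{1,2\}$. Then there is an algorithm (depending on $\ell$) that takes as input a candidate $G$, has running time $O(|G|^9)$, and either decides that $G$ has a long odd hole, or decides that $G$ does not have a shortest long odd hole $C$ with a remote base $(x,D)$ such that every $C$-major vertex is equal or adjacent to $x$. (Each answer given is correct. The algorithm is a program for a random-access machine with unit-cost operations on words of $O(\log |G|)$ bits; the input is the adjacency matrix of $G$.) -/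

import Mathlib

open Filter Asymptotics

/-! ### Word random-access machine -/

namespace WordRAM

/-- A machine configuration: registers and main memory, both holding natural numbers. -/
structure State where
  reg : ℕ → ℕ
  mem : ℕ → ℕ

/-- Binary machine operations. -/
inductive BinOp where
  | add
  | sub
  | mul
  | div
  | mod
  | lt
  | eq

/-- Meaning of the operations; `sub` is truncated and the two tests return `1` or `0`. -/
def BinOp.eval : BinOp → ℕ → ℕ → ℕ
  | .add, a, b => a + b
  | .sub, a, b => a - b
  | .mul, a, b => a * b
  | .div, a, b => a / b
  | .mod, a, b => a % b
  | .lt, a, b => if a < b then 1 else 0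
  | .eq, a, b => if a = b then 1 else 0

/-- Expressions: constants, registers, memory reads (indirect addressing) and operations. -/
inductive Expr where
  | const (k : ℕ)
  | reg (r : ℕ)
  | load (address : Expr)
  | op (o : BinOp) (e₁ e₂ : Expr)

/-- The value of an expression. -/
def Expr.eval (s : State) : Expr → ℕ
  | .const k => k
  | .reg r => s.reg r
  | .load a => s.mem (a.eval s)
  | .op o e₁ e₂ => o.eval (e₁.eval s) (e₂.eval s)

/-- The number of machine operations used to evaluate an expression: one for each node. -/
def Expr.cost : Expr → ℕ
  | .const _ => 1
  | .reg _ => 1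
  | .load a => a.cost + 1
  | .op _ e₁ e₂ => e₁.cost + e₂.cost + 1

/-- All values that occur during the evaluation of an expression (in particular all addresses)
fit into a machine word, that is, are smaller than `W`. -/
def Expr.Fits (W : ℕ) (s : State) : Expr → Prop
  | .const k => k < W
  | .reg r => s.reg r < W
  | .load a => a.Fits W s ∧ s.mem (a.eval s) < W
  | .op o e₁ e₂ => e₁.Fits W s ∧ e₂.Fits W s ∧ o.eval (e₁.eval s) (e₂.eval s) < W

/-- Programs: structured sequential code. A condition holds if its value is not `0`. -/
inductive Program where
  | skip
  | assign (r : ℕ) (e : Expr)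
  | store (address e : Expr)
  | seq (p q : Program)
  | branch (cond : Expr) (p q : Program)
  | loop (cond : Expr) (body : Program)

/-- Write a register. -/
def State.setReg (s : State) (r v : ℕ) : State :=
  ⟨Function.update s.reg r v, s.mem⟩

/-- Write a memory cell. -/
def State.setMem (s : State) (a v : ℕ) : State :=
  ⟨s.reg, Function.update s.mem a v⟩

/-- `Runs W p s t s'`: with machine words that hold the numbers smaller than `W`, the program `p`
started in the configuration `s` halts in the configuration `s'` after exactly `t` unit-cost steps,
without overflow. Execution is deterministic; a program that loops forever, or in which a
value does not fit into a word, has no run. -/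
inductive Runs (W : ℕ) : Program → State → ℕ → State → Prop where
  | skip (s : State) : Runs W .skip s 1 s
  | assign (s : State) (r : ℕ) (e : Expr) (he : e.Fits W s) :
      Runs W (.assign r e) s (e.cost + 1) (s.setReg r (e.eval s))
  | store (s : State) (a e : Expr) (ha : a.Fits W s) (he : e.Fits W s) :
      Runs W (.store a e) s (a.cost + e.cost + 1) (s.setMem (a.eval s) (e.eval s))
  | seq {p q : Program} {s s' s'' : State} {t t' : ℕ}
      (hp : Runs W p s t s') (hq : Runs W q s' t' s'') :
      Runs W (.seq p q) s (t + t') s''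
  | branch_true {p q : Program} {s s' : State} {t : ℕ} (c : Expr) (hc : c.Fits W s)
      (h : c.eval s ≠ 0) (hp : Runs W p s t s') :
      Runs W (.branch c p q) s (c.cost + 1 + t) s'
  | branch_false {p q : Program} {s s' : State} {t : ℕ} (c : Expr) (hc : c.Fits W s)
      (h : c.eval s = 0) (hq : Runs W q s t s') :
      Runs W (.branch c p q) s (c.cost + 1 + t) s'
  | loop_true {p : Program} {s s' s'' : State} {t t' : ℕ} (c : Expr) (hc : c.Fits W s)
      (h : c.eval s ≠ 0) (hp : Runs W p s t s') (hl : Runs W (.loop c p) s' t' s'') :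
      Runs W (.loop c p) s (c.cost + 1 + t + t') s''
  | loop_false {p : Program} {s : State} (c : Expr) (hc : c.Fits W s) (h : c.eval s = 0) :
      Runs W (.loop c p) s (c.cost + 1) s

open Classical in
/-- The input encoding of a graph with vertex set `{0, …, n - 1}`: register `0` holds `n`, the
first `n * n` memory cells hold the adjacency matrix row by row, everything else is `0`. -/
noncomputable def graphInput {n : ℕ} (G : SimpleGraph (Fin n)) : State where
  reg r := if r = 0 then n else 0
  mem a := if ∃ i j : Fin n, a = (i : ℕ) * n + (j : ℕ) ∧ G.Adj i j then 1 else 0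

end WordRAM

/-! ### Long odd holes -/

namespace LongOddHole

variable {V : Type*} (G : SimpleGraph V)

/-- `C` is (the vertex set of) a hole: the subgraph induced on `C` is a cycle of length at
least four. Its length is `C.ncard`. -/
def IsHole (C : Set V) : Prop :=
  ∃ k : ℕ, 4 ≤ k ∧ Nonempty (SimpleGraph.cycleGraph k ≃g G.induce C)

/-- A hole of odd length at least `ℓ`. -/
def IsLongOddHole (ℓ : ℕ) (C : Set V) : Prop :=
  IsHole G C ∧ ℓ ≤ C.ncard ∧ Odd C.ncard

/-- A long odd hole of minimum length. -/
def IsShortestLongOddHole (ℓ : ℕ) (C : Set V) : Prop :=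
  IsLongOddHole G ℓ C ∧ ∀ C' : Set V, IsLongOddHole G ℓ C' → C.ncard ≤ C'.ncard

variable {G}

/-- An induced path. -/
def IsInducedPath {a b : V} (p : G.Walk a b) : Prop :=
  p.IsPath ∧ p.IsChordless

/-- The vertices of a path that are not its ends. -/
def interior {a b : V} (p : G.Walk a b) : Set V :=
  {w | w ∈ p.support ∧ w ≠ a ∧ w ≠ b}

/-- A path of the hole `C` (which is an induced subgraph, so only the vertices matter). -/
def IsPathOf (C : Set V) {a b : V} (p : G.Walk a b) : Prop :=
  p.IsPath ∧ ∀ w ∈ p.support, w ∈ C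

variable (G)

/-- There is a long jewel of order at most `k`. The number of vertices of a path is the
length of its `support`. -/
def HasLongJewel (ℓ k : ℕ) : Prop :=
  ∃ (u v : V) (Q₁ Q₂ P : G.Walk u v),
    IsInducedPath Q₁ ∧ IsInducedPath Q₂ ∧ IsInducedPath P ∧
    Q₁.length % 2 ≠ Q₂.length % 2 ∧ ℓ ≤ P.length ∧
    (∀ x ∈ interior P, ∀ y ∈ interior Q₁ ∪ interior Q₂, x ≠ y ∧ ¬ G.Adj x y) ∧
    max Q₁.support.length Q₂.support.length ≤ k

/-- There is a long pyramid, with apex `a` and base `{v 0, v 1, v 2}`. -/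
def HasLongPyramid (ℓ : ℕ) : Prop :=
  ∃ (a : V) (v : Fin 3 → V) (P : ∀ i, G.Walk a (v i)),
    (∀ i, IsInducedPath (P i)) ∧
    (∀ i, v i ≠ a) ∧
    (∃ i j, i ≠ j ∧ ℓ ≤ (P i).length ∧ ℓ ≤ (P j).length) ∧
    (∀ i j, i ≠ j → G.Adj (v i) (v j)) ∧
    (∀ i j, i ≠ j → ∀ x, x ∈ (P i).support → x ∈ (P j).support → x = a) ∧
    (∀ i j, i ≠ j → ∀ x ∈ (P i).support, ∀ y ∈ (P j).support,
      x ≠ a → y ≠ a → G.Adj x y → x = v i ∧ y = v j)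

/-- Candidates: no long pyramid, no long jewel of order at most `ℓ + 2`, no long odd hole of
length at most `2ℓ + 2`. -/
def IsCandidate (ℓ : ℕ) : Prop :=
  ¬ HasLongPyramid G ℓ ∧ ¬ HasLongJewel G ℓ (ℓ + 2) ∧
    ¬ ∃ C : Set V, IsLongOddHole G ℓ C ∧ C.ncard ≤ 2 * ℓ + 2

/-- The vertex `v` is `C`-major: it is not in `C`, and no three-vertex path of `C` contains all
its neighbours in `C`. -/
def IsMajor (C : Set V) (v : V) : Prop :=
  v ∉ C ∧ ¬ ∃ (a b : V) (p : G.Walk a b), IsPathOf C p ∧ p.length = 2 ∧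
    ∀ w ∈ C, G.Adj v w → w ∈ p.support

variable {G}

/-- `p` is a path of `C`, and the `C`-major vertex `x` is adjacent to the ends of `p` and to none
of its internal vertices. -/
def IsGapOf (C : Set V) (x : V) {a b : V} (p : G.Walk a b) : Prop :=
  IsMajor G C x ∧ IsPathOf C p ∧ G.Adj x a ∧ G.Adj x b ∧ ∀ w ∈ interior p, ¬ G.Adj x w

/-- `(x, D)` is a base for `C`: `D` is a maximal path (with respect to inclusion of paths, over
all choices of the `C`-major vertex) such that some `C`-major vertex, namely `x`, is adjacent to
its ends and to none of its internal vertices. -/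
def IsBase (C : Set V) (x : V) {d₁ d₂ : V} (D : G.Walk d₁ d₂) : Prop :=
  IsGapOf C x D ∧
    ∀ (y a b : V) (p : G.Walk a b), IsGapOf C y p →
      D.toSubgraph ≤ p.toSubgraph → p.toSubgraph = D.toSubgraph

/-- A base `(x, D)` is remote if `D` has length at least `2ℓ`, and every neighbour in `C` of a
`C`-major vertex other than `x` has distance at least `ℓ` in `C` from both ends of `D`. -/
def IsRemoteBase (ℓ : ℕ) (C : Set V) (x : V) {d₁ d₂ : V} (D : G.Walk d₁ d₂) : Prop :=
  IsBase C x D ∧ 2 * ℓ ≤ D.length ∧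
    ∀ y, IsMajor G C y → y ≠ x → ∀ w d : C, G.Adj y w → ((d : V) = d₁ ∨ (d : V) = d₂) →
      ℓ ≤ (G.induce C).dist w d

end LongOddHole

/-! The algorithm guesses `x`, the ends `d₁`, `d₂` of `D`, a middle vertex `m` of `D` and a middle
vertex `m'` of the other path of `C` between `d₁` and `d₂`. It then builds, instead of `C` itself,
some hole of the same length out of four shortest paths, from `d₁` through `m`, `d₂` and `m'` back
to `d₁`. The list of vertices so obtained is tested directly, so a positive answer is always right;
what needs proof is that the right guess succeeds.

The main fact is `IsShortestSeq.near_of_conn`: a walk of non-major vertices between two vertices of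
`C`, of length `m` with `2m + 3 ≤ |C|`, is no shorter than the distance in `C`. In a minimal
counterexample the walk is an induced path with interior disjoint from `C`. Together with one side
of `C` it forms a hole, which is shorter than `C` and still long, hence even. Part of the other side
of `C` is then an ear of this even hole, and parity makes it close up badly: it yields a shorter
long odd hole, a long pyramid, or, if the ear is short, a long jewel of small order
(`HoleSeq.hasLongJewel`, `IsEar.false_of_parity`). As a consequence, a shortest path that replaces a
short arc of `C` has no interior vertex on, or adjacent to, the rest of `C`
(`IsShortestSeq.avoids_of_conn`).

To use this, major vertices must be kept away without knowing `C`. On the side of `D` it is enough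
to delete `x` and its neighbours other than `d₁`, `d₂`, since every major vertex equals or is
adjacent to `x`. Maximality of `D` and remoteness show that every major vertex other than `x` has a
neighbour in the interior of `D` (`IsRemoteBase.exists_config`). On the other side one therefore
deletes `x` and everything equal or adjacent to a vertex, other than `d₁` and `d₂`, on a shortest
path for either half of `D`. These vertices include the interior of `D`, so all major vertices
disappear; by the consequence above, the other side of `C` survives. The same deletion guarantees
that the two sides found have no unwanted edges between them (`RemoteConfig.closed`). The middle
vertices are needed because `D` or its complement may be longer than half of `C`, while each of the
four arcs is short enough for the main fact.

For the running time the algorithm is written in a small language of loops over `0, …, n - 1`, whose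
translation to the machine takes time `O((n + 1) ^ depth)` (`Cmd.exists_runs`). Five loops make the
guesses, and breadth-first search adds depth three, so the depth is eight. Stored values stay below
`n + 2`, so every expression fits into a word of size `(n + 2) ^ b` with `b` constant. -/

namespace LongOddHole

/-! ### Holes as periodic sequences indexed by the integers, and induced paths as sequences. -/

variable {V : Type*} {G : SimpleGraph V}

/-- `y` runs periodically around an induced cycle of length `N`. -/
structure HoleSeq (G : SimpleGraph V) (N : ℕ) (y : ℤ → V) : Prop where
  four_le : 4 ≤ N
  eq_iff : ∀ i j, y i = y j ↔ (N : ℤ) ∣ j - i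
  adj_iff : ∀ i j, G.Adj (y i) (y j) ↔ (N : ℤ) ∣ j - i - 1 ∨ (N : ℤ) ∣ j - i + 1

theorem dvd_iff_of_small {N : ℕ} {k : ℤ} (h₁ : -(N : ℤ) < k) (h₂ : k < N) :
    (N : ℤ) ∣ k ↔ k = 0 := by
  constructor
  · intro h
    exact Int.eq_zero_of_abs_lt_dvd h (abs_lt.2 ⟨h₁, h₂⟩)
  · rintro rfl
    exact dvd_zero _

theorem dvd_iff_of_lt_two_mul {N : ℕ} {k : ℤ} (h₁ : -(2 * N : ℤ) < k) (h₂ : k < 2 * N) :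
    (N : ℤ) ∣ k ↔ k = 0 ∨ k = N ∨ k = -N := by
  constructor
  · rintro ⟨m, rfl⟩
    have hN : (0 : ℤ) < N := by
      by_contra h
      have : (N : ℤ) = 0 := by omega
      simp [this] at h₁
    have h3 : -2 < m := by nlinarith
    have h4 : m < 2 := by nlinarith
    have : m = -1 ∨ m = 0 ∨ m = 1 := by omega
    rcases this with rfl | rfl | rfl <;> simp
  · rintro (rfl | rfl | rfl) <;> simp

namespace HoleSeq

variable {N : ℕ} {y : ℤ → V}

theorem eq_iff_of_window (h : HoleSeq G N y) {i j : ℤ} (h₁ : -(N : ℤ) < j - i) (h₂ : j - i < N) :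
    y i = y j ↔ i = j := by
  rw [h.eq_iff, dvd_iff_of_small h₁ h₂]
  omega

theorem adj_iff_of_window (h : HoleSeq G N y) {i j : ℤ} (h₁ : -(N : ℤ) < j - i)
    (h₂ : j - i < N) :
    G.Adj (y i) (y j) ↔ j = i + 1 ∨ i = j + 1 ∨ j = i + N - 1 ∨ i = j + N - 1 := by
  have := h.four_le
  rw [h.adj_iff, dvd_iff_of_lt_two_mul (by omega) (by omega),
    dvd_iff_of_lt_two_mul (by omega) (by omega)]
  omega

theorem add_period (h : HoleSeq G N y) (i : ℤ) : y (i + N) = y i := by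
  rw [h.eq_iff]
  exact ⟨-1, by ring⟩

theorem sub_period (h : HoleSeq G N y) (i : ℤ) : y (i - N) = y i := by
  rw [h.eq_iff]
  exact ⟨1, by ring⟩

theorem adj_succ (h : HoleSeq G N y) (i : ℤ) : G.Adj (y i) (y (i + 1)) := by
  rw [h.adj_iff]
  left
  simp

theorem shift (h : HoleSeq G N y) (s : ℤ) : HoleSeq G N (fun i => y (i + s)) where
  four_le := h.four_le
  eq_iff i j := by rw [h.eq_iff]; ring_nf
  adj_iff i j := by rw [h.adj_iff]; ring_nf

theorem reflect (h : HoleSeq G N y) : HoleSeq G N (fun i => y (-i)) where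
  four_le := h.four_le
  eq_iff i j := by
    rw [h.eq_iff, ← dvd_neg]
    ring_nf
  adj_iff i j := by
    rw [h.adj_iff, or_comm, ← dvd_neg, ← dvd_neg (b := -j - -i - 1)]
    ring_nf

theorem exists_mem_window (h : HoleSeq G N y) (a i : ℤ) : ∃ j, a ≤ j ∧ j < a + N ∧ y j = y i := by
  have := h.four_le
  refine ⟨a + (i - a) % N, ?_, ?_, ?_⟩
  · have := Int.emod_nonneg (i - a) (b := (N : ℤ)) (by omega)
    omega
  · have := Int.emod_lt_of_pos (i - a) (b := (N : ℤ)) (by omega)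
    omega
  · rw [h.eq_iff]
    refine ⟨(i - a) / N, ?_⟩
    have := Int.emod_add_mul_ediv (i - a) N
    linarith

theorem _root_.LongOddHole.cycleGraph_adj_iff_of_lt {N : ℕ} {a b : Fin N} (hab : a.1 < b.1) :
    (SimpleGraph.cycleGraph N).Adj a b ↔ b.1 = a.1 + 1 ∨ (a.1 = 0 ∧ b.1 + 1 = N) := by
  rw [SimpleGraph.cycleGraph_adj', Fin.coe_sub_iff_lt.2 hab, Fin.sub_val_of_le hab.le]
  omega

/-- This is how all new holes are produced: a single period, compared over pairs `i < j` only,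
determines the periodic sequence. -/
theorem ofWindow {N : ℕ} (hN : 4 ≤ N) (f : ℕ → V)
    (hinj : ∀ i j, i < j → j < N → f i ≠ f j)
    (hadj : ∀ i j, i < j → j < N → (G.Adj (f i) (f j) ↔ j = i + 1 ∨ (i = 0 ∧ j + 1 = N))) :
    HoleSeq G N (fun i => f (i % N).toNat) := by
  have hpos : (0 : ℤ) < N := by omega
  have key : ∀ i : ℤ, ∃ a : ℕ, a < N ∧ (i % N).toNat = a ∧ (N : ℤ) ∣ i - a := by
    intro i
    have h1 := Int.emod_nonneg i hpos.ne'
    have h2 := Int.emod_lt_of_pos i hpos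
    refine ⟨(i % N).toNat, by omega, rfl, ?_⟩
    rw [Int.toNat_of_nonneg h1]
    exact Int.dvd_self_sub_emod
  refine ⟨hN, ?_, ?_⟩
  · intro i j
    obtain ⟨a, ha, hia, hda⟩ := key i
    obtain ⟨b, hb, hjb, hdb⟩ := key j
    simp only [hia, hjb]
    have e : (N : ℤ) ∣ j - i ↔ (N : ℤ) ∣ (b : ℤ) - a := by
      have : j - i = ((b : ℤ) - a) + ((j - b) - (i - a)) := by ring
      rw [this]
      exact dvd_add_left (dvd_sub hdb hda)
    rw [e, dvd_iff_of_small (by omega) (by omega)]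
    constructor
    · intro h
      rcases lt_trichotomy a b with hab | hab | hab
      · exact absurd h (hinj _ _ hab hb)
      · omega
      · exact absurd h.symm (hinj _ _ hab ha)
    · intro h
      have : a = b := by omega
      rw [this]
  · intro i j
    obtain ⟨a, ha, hia, hda⟩ := key i
    obtain ⟨b, hb, hjb, hdb⟩ := key j
    simp only [hia, hjb]
    have e : ∀ t : ℤ, (N : ℤ) ∣ j - i + t ↔ (N : ℤ) ∣ (b : ℤ) - a + t := by
      intro t
      have : j - i + t = ((b : ℤ) - a + t) + ((j - b) - (i - a)) := by ring
      rw [this]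
      exact dvd_add_left (dvd_sub hdb hda)
    have e1 := e (-1)
    rw [← sub_eq_add_neg, ← sub_eq_add_neg] at e1
    rw [e1, e 1, dvd_iff_of_lt_two_mul (by omega) (by omega),
      dvd_iff_of_lt_two_mul (by omega) (by omega)]
    rcases lt_trichotomy a b with hab | hab | hab
    · rw [hadj _ _ hab hb]
      omega
    · subst hab
      constructor
      · intro h
        exact absurd h (G.loopless.irrefl _)
      · omega
    · rw [G.adj_comm, hadj _ _ hab ha]
      omega

theorem isHole (h : HoleSeq G N y) : IsHole G (Set.range y) ∧ (Set.range y).ncard = N := by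
  have hN := h.four_le
  let e : Fin N ≃ Set.range y := Equiv.ofBijective (fun i => ⟨y i.1, ⟨_, rfl⟩⟩) (by
    constructor
    · intro i j hij
      have := (h.eq_iff_of_window (i := (i.1 : ℤ)) (j := j.1) (by omega) (by omega)).1
        (congrArg Subtype.val hij)
      ext
      omega
    · rintro ⟨_, i, rfl⟩
      obtain ⟨j, h1, h2, h3⟩ := h.exists_mem_window 0 i
      refine ⟨⟨j.toNat, by omega⟩, ?_⟩
      ext
      simp only
      rw [← h3]
      congr 1
      omega)
  refine ⟨⟨N, hN, ⟨⟨e, ?_⟩⟩⟩, ?_⟩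
  · intro i j
    rw [SimpleGraph.cycleGraph_adj']
    change G.Adj (y i.1) (y j.1) ↔ _
    rw [h.adj_iff_of_window (by omega) (by omega)]
    rcases lt_trichotomy i.1 j.1 with hij | hij | hij
    · rw [← SimpleGraph.cycleGraph_adj', cycleGraph_adj_iff_of_lt hij]
      omega
    · have : i = j := Fin.ext hij
      subst this
      rw [← SimpleGraph.cycleGraph_adj']
      simp
      omega
    · rw [← SimpleGraph.cycleGraph_adj', SimpleGraph.adj_comm, cycleGraph_adj_iff_of_lt hij]
      omega
  · rw [← Nat.card_coe_set_eq, ← Nat.card_congr e, Nat.card_fin]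

end HoleSeq

theorem IsHole.exists_holeSeq {C : Set V} (h : IsHole G C) :
    ∃ (N : ℕ) (y : ℤ → V), HoleSeq G N y ∧ C = Set.range y := by
  obtain ⟨N, hN, ⟨e⟩⟩ := h
  have : NeZero N := ⟨by omega⟩
  let f : ℕ → V := fun i => (e (Fin.ofNat N i) : V)
  have hf : ∀ i, ∀ h : i < N, f i = (e ⟨i, h⟩ : V) := by
    intro i h
    simp only [f]
    congr 2
    ext
    simp [Nat.mod_eq_of_lt h]
  refine ⟨N, _, HoleSeq.ofWindow hN f ?_ ?_, ?_⟩
  · intro i j hij hj h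
    rw [hf i (by omega), hf j hj] at h
    have := e.injective (Subtype.ext h)
    simp at this
    omega
  · intro i j hij hj
    rw [hf i (by omega), hf j hj]
    exact (e.map_rel_iff (a := ⟨i, by omega⟩) (b := ⟨j, hj⟩)).trans
      (cycleGraph_adj_iff_of_lt hij)
  · ext v
    constructor
    · intro hv
      obtain ⟨i, hi⟩ := e.surjective ⟨v, hv⟩
      refine ⟨i.1, ?_⟩
      have : (((i.1 : ℕ) : ℤ) % (N : ℤ)).toNat = i.1 := by
        have := i.2
        rw [Int.emod_eq_of_lt (by positivity) (by exact_mod_cast this)]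
        simp
      simp only [this]
      rw [hf _ i.2, hi]
    · rintro ⟨i, rfl⟩
      exact (e _).2

theorem exists_walk_of_seq (f : ℕ → V) (L : ℕ) (h : ∀ i < L, G.Adj (f i) (f (i + 1))) :
    ∃ p : G.Walk (f 0) (f L), p.length = L ∧ ∀ i ≤ L, p.getVert i = f i := by
  induction L with
  | zero => exact ⟨.nil, rfl, by simp⟩
  | succ L ih =>
    obtain ⟨p, hl, hp⟩ := ih (fun i hi => h i (by omega))
    refine ⟨p.concat (h L (by omega)), by simp [hl], ?_⟩
    intro i hi
    rw [SimpleGraph.Walk.concat_eq_append, SimpleGraph.Walk.getVert_append]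
    split_ifs with h1
    · exact hp i (by omega)
    · have : i = L ∨ i = L + 1 := by omega
      rcases this with rfl | rfl <;> simp [hl]

theorem exists_inducedPath_of_seq (f : ℕ → V) (L : ℕ)
    (hadj : ∀ i < L, G.Adj (f i) (f (i + 1)))
    (hne : ∀ i j, i < j → j ≤ L → f i ≠ f j)
    (hchord : ∀ i j, i < j → j ≤ L → G.Adj (f i) (f j) → j = i + 1) :
    ∃ p : G.Walk (f 0) (f L), IsInducedPath p ∧ p.length = L ∧
      (∀ i ≤ L, p.getVert i = f i) ∧
      (∀ v, v ∈ p.support ↔ ∃ i ≤ L, v = f i) ∧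
      (∀ v, v ∈ interior p ↔ ∃ i, 0 < i ∧ i < L ∧ v = f i) := by
  obtain ⟨p, hl, hp⟩ := exists_walk_of_seq f L hadj
  have hsupp : ∀ v, v ∈ p.support ↔ ∃ i ≤ L, v = f i := by
    intro v
    rw [SimpleGraph.Walk.mem_support_iff_exists_getVert]
    constructor
    · rintro ⟨i, rfl, hi⟩
      exact ⟨i, by omega, hp i (by omega)⟩
    · rintro ⟨i, hi, rfl⟩
      exact ⟨i, hp i hi, by omega⟩
  have hne' : ∀ i j, i ≤ L → j ≤ L → f i = f j → i = j := by
    intro i j hi hj h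
    rcases lt_trichotomy i j with hij | hij | hij
    · exact absurd h (hne _ _ hij hj)
    · exact hij
    · exact absurd h.symm (hne _ _ hij hi)
  refine ⟨p, ⟨?_, ?_⟩, hl, hp, hsupp, ?_⟩
  · rw [← SimpleGraph.Walk.IsPath.getVert_injOn_iff]
    intro i hi j hj hij
    simp only [Set.mem_ofPred_eq, hl] at hi hj
    rw [hp i hi, hp j hj] at hij
    exact hne' i j hi hj hij
  · rw [SimpleGraph.Walk.isChordless_iff_forall_mem_edges]
    have hedge : ∀ i < L, s(f i, f (i + 1)) ∈ p.edges := by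
      intro i hi
      rw [SimpleGraph.Walk.mk_mem_edges_iff_exists]
      exact ⟨i, by omega, by rw [hp i (by omega), hp (i + 1) (by omega)]⟩
    intro u v hu hv huv
    obtain ⟨i, hi, rfl⟩ := (hsupp _).1 hu
    obtain ⟨j, hj, rfl⟩ := (hsupp _).1 hv
    rcases lt_trichotomy i j with hij | hij | hij
    · rw [hchord _ _ hij hj huv]
      exact hedge i (by omega)
    · subst hij
      exact absurd huv (G.loopless.irrefl _)
    · rw [Sym2.eq_swap, hchord _ _ hij hi huv.symm]
      exact hedge j (by omega)
  · intro v
    simp only [interior, Set.mem_ofPred_eq, hsupp]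
    constructor
    · rintro ⟨⟨i, hi, rfl⟩, h1, h2⟩
      refine ⟨i, ?_, ?_, rfl⟩
      · rcases Nat.eq_zero_or_pos i with rfl | h
        · exact absurd rfl h1
        · exact h
      · rcases Nat.lt_or_ge i L with h | h
        · exact h
        · have : i = L := by omega
          subst this
          exact absurd rfl h2
    · rintro ⟨i, h1, h2, rfl⟩
      exact ⟨⟨i, by omega, rfl⟩, fun h => by have := hne' _ _ (by omega) (by omega) h; omega,
        fun h => by have := hne' _ _ (by omega) (by omega) h; omega⟩

end LongOddHole

/-! ### Long jewels, long pyramids and ears, built from sequences. -/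

namespace LongOddHole

variable {V : Type*} {G : SimpleGraph V}

/-- The vertices `f 0, …, f L` form an induced path, in this order. -/
def IsInducedSeq (G : SimpleGraph V) (f : ℕ → V) (L : ℕ) : Prop :=
  ∀ i j, i < j → j ≤ L → f i ≠ f j ∧ (G.Adj (f i) (f j) ↔ j = i + 1)

theorem IsInducedSeq.exists_path {f : ℕ → V} {L : ℕ} (h : IsInducedSeq G f L) {u v : V}
    (hu : f 0 = u) (hv : f L = v) :
    ∃ p : G.Walk u v, IsInducedPath p ∧ p.length = L ∧
      (∀ w, w ∈ p.support ↔ ∃ i ≤ L, w = f i) ∧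
      (∀ w, w ∈ interior p ↔ ∃ i, 0 < i ∧ i < L ∧ w = f i) := by
  subst hu hv
  obtain ⟨p, h1, h2, -, h3, h4⟩ := exists_inducedPath_of_seq f L
    (fun i hi => (h i (i + 1) (by omega) (by omega)).2.2 rfl)
    (fun i j hij hj => (h i j hij hj).1) (fun i j hij hj => (h i j hij hj).2.1)
  exact ⟨p, h1, h2, h3, h4⟩

theorem hasLongJewel_of_seq {ℓ k : ℕ} {u v : V} {f₁ f₂ f₃ : ℕ → V} {L₁ L₂ L₃ : ℕ}
    (h₁ : IsInducedSeq G f₁ L₁) (h₂ : IsInducedSeq G f₂ L₂) (h₃ : IsInducedSeq G f₃ L₃)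
    (hu₁ : f₁ 0 = u) (hu₂ : f₂ 0 = u) (hu₃ : f₃ 0 = u)
    (hv₁ : f₁ L₁ = v) (hv₂ : f₂ L₂ = v) (hv₃ : f₃ L₃ = v)
    (hpar : L₁ % 2 ≠ L₂ % 2) (hlong : ℓ ≤ L₃) (hk₁ : L₁ + 1 ≤ k) (hk₂ : L₂ + 1 ≤ k)
    (h31 : ∀ t i, 0 < t → t < L₃ → 0 < i → i < L₁ → f₃ t ≠ f₁ i ∧ ¬ G.Adj (f₃ t) (f₁ i))
    (h32 : ∀ t i, 0 < t → t < L₃ → 0 < i → i < L₂ → f₃ t ≠ f₂ i ∧ ¬ G.Adj (f₃ t) (f₂ i)) :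
    HasLongJewel G ℓ k := by
  obtain ⟨p₁, hp₁, hl₁, -, hi₁⟩ := h₁.exists_path hu₁ hv₁
  obtain ⟨p₂, hp₂, hl₂, -, hi₂⟩ := h₂.exists_path hu₂ hv₂
  obtain ⟨p₃, hp₃, hl₃, -, hi₃⟩ := h₃.exists_path hu₃ hv₃
  refine ⟨u, v, p₁, p₂, p₃, hp₁, hp₂, hp₃, by rw [hl₁, hl₂]; exact hpar, by omega, ?_, ?_⟩
  · intro x hx y hy
    obtain ⟨t, ht1, ht2, rfl⟩ := (hi₃ x).1 hx
    rcases hy with hy | hy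
    · obtain ⟨i, hi1, hi2, rfl⟩ := (hi₁ y).1 hy
      exact h31 t i ht1 ht2 hi1 hi2
    · obtain ⟨i, hi1, hi2, rfl⟩ := (hi₂ y).1 hy
      exact h32 t i ht1 ht2 hi1 hi2
  · simp only [SimpleGraph.Walk.length_support, hl₁, hl₂]
    omega

theorem hasLongPyramid_of_seq {ℓ : ℕ} {a : V} {f₁ f₂ f₃ : ℕ → V} {L₁ L₂ L₃ : ℕ}
    (h₁ : IsInducedSeq G f₁ L₁) (h₂ : IsInducedSeq G f₂ L₂) (h₃ : IsInducedSeq G f₃ L₃)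
    (ha₁ : f₁ 0 = a) (ha₂ : f₂ 0 = a) (ha₃ : f₃ 0 = a)
    (hL₁ : 0 < L₁) (hL₂ : 0 < L₂) (hL₃ : 0 < L₃)
    (hlong : ℓ ≤ L₃ ∧ (ℓ ≤ L₁ ∨ ℓ ≤ L₂))
    (h12 : ∀ i j, 0 < i → i ≤ L₁ → 0 < j → j ≤ L₂ →
      f₁ i ≠ f₂ j ∧ (G.Adj (f₁ i) (f₂ j) ↔ i = L₁ ∧ j = L₂))
    (h13 : ∀ i j, 0 < i → i ≤ L₁ → 0 < j → j ≤ L₃ →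
      f₁ i ≠ f₃ j ∧ (G.Adj (f₁ i) (f₃ j) ↔ i = L₁ ∧ j = L₃))
    (h23 : ∀ i j, 0 < i → i ≤ L₂ → 0 < j → j ≤ L₃ →
      f₂ i ≠ f₃ j ∧ (G.Adj (f₂ i) (f₃ j) ↔ i = L₂ ∧ j = L₃)) :
    HasLongPyramid G ℓ := by
  let f : Fin 3 → ℕ → V := ![f₁, f₂, f₃]
  let L : Fin 3 → ℕ := ![L₁, L₂, L₃]
  have hf : ∀ k, IsInducedSeq G (f k) (L k) := by
    intro k; fin_cases k <;> assumption
  have ha : ∀ k, f k 0 = a := by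
    intro k; fin_cases k <;> assumption
  have hL : ∀ k, 0 < L k := by
    intro k; fin_cases k <;> assumption
  have hx : ∀ k l, k ≠ l → ∀ i j, 0 < i → i ≤ L k → 0 < j → j ≤ L l →
      f k i ≠ f l j ∧ (G.Adj (f k i) (f l j) ↔ i = L k ∧ j = L l) := by
    have sym : ∀ {g h : ℕ → V} {M K : ℕ}, (∀ i j, 0 < i → i ≤ M → 0 < j → j ≤ K →
        g i ≠ h j ∧ (G.Adj (g i) (h j) ↔ i = M ∧ j = K)) →
        (∀ i j, 0 < i → i ≤ K → 0 < j → j ≤ M →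
        h i ≠ g j ∧ (G.Adj (h i) (g j) ↔ i = K ∧ j = M)) := by
      intro g h M K H i j h1 h2 h3 h4
      obtain ⟨h5, h6⟩ := H j i h3 h4 h1 h2
      exact ⟨h5.symm, by rw [G.adj_comm, h6, and_comm]⟩
    intro k l hkl
    fin_cases k <;> fin_cases l
    · exact absurd rfl hkl
    · exact h12
    · exact h13
    · exact sym h12
    · exact absurd rfl hkl
    · exact h23
    · exact sym h13
    · exact sym h23
    · exact absurd rfl hkl
  choose P hP hlen hsupp _ using fun k => (hf k).exists_path (ha k) (v := f k (L k)) rfl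
  have hpos : ∀ k x, x ∈ (P k).support → x ≠ a → ∃ i, 0 < i ∧ i ≤ L k ∧ x = f k i := by
    intro k x hx hxa
    obtain ⟨i, hi, rfl⟩ := (hsupp k x).1 hx
    refine ⟨i, ?_, hi, rfl⟩
    rcases Nat.eq_zero_or_pos i with rfl | h
    · exact absurd (ha k) hxa
    · exact h
  refine ⟨a, fun k => f k (L k), P, hP, ?_, ?_, ?_, ?_, ?_⟩
  · intro k h
    exact (hf k 0 (L k) (hL k) le_rfl).1 ((ha k).trans h.symm)
  · simp only [hlen]
    rcases hlong with ⟨h3, h1 | h2⟩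
    · exact ⟨0, 2, by decide, h1, h3⟩
    · exact ⟨1, 2, by decide, h2, h3⟩
  · intro k l hkl
    exact (hx k l hkl _ _ (hL k) le_rfl (hL l) le_rfl).2.2 ⟨rfl, rfl⟩
  · intro k l hkl x hxk hxl
    by_contra hxa
    obtain ⟨i, hi1, hi2, hi⟩ := hpos k x hxk hxa
    obtain ⟨j, hj1, hj2, hj⟩ := hpos l x hxl hxa
    exact (hx k l hkl i j hi1 hi2 hj1 hj2).1 (hi.symm.trans hj)
  · intro k l hkl x hxk y hyl hxa hya hxy
    obtain ⟨i, hi1, hi2, rfl⟩ := hpos k x hxk hxa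
    obtain ⟨j, hj1, hj2, rfl⟩ := hpos l y hyl hya
    obtain ⟨rfl, rfl⟩ := (hx k l hkl i j hi1 hi2 hj1 hj2).2.1 hxy
    exact ⟨rfl, rfl⟩

/-- A short detour of a hole with the wrong parity gives a long jewel. -/
theorem HoleSeq.hasLongJewel {N m r ℓ : ℕ} {y : ℤ → V} (hy : HoleSeq G N y) (q : ℕ → V)
    (hm : 2 ≤ m) (hr : 1 ≤ r) (hmN : m + ℓ ≤ N) (hℓ : 2 ≤ ℓ)
    (hq : ∀ i j, 1 ≤ i → i < j → j ≤ r → q i ≠ q j ∧ (G.Adj (q i) (q j) ↔ j = i + 1))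
    (hq0 : ∀ i, 1 ≤ i → i ≤ r → (G.Adj (q i) (y 0) ↔ i = 1))
    (hqm : ∀ i, 1 ≤ i → i ≤ r → (G.Adj (q i) (y m) ↔ i = r))
    (hne : ∀ i, 1 ≤ i → i ≤ r → ∀ t : ℤ, m ≤ t → t ≤ N → q i ≠ y t)
    (hout : ∀ i, 1 ≤ i → i ≤ r → ∀ t : ℤ, m < t → t < N → ¬ G.Adj (q i) (y t))
    (hpar : (m + r) % 2 = 0) (hmℓ : m ≤ ℓ + 1) (hrℓ : r ≤ ℓ) :
    HasLongJewel G ℓ (ℓ + 2) := by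
  have hN : y N = y 0 := by simpa using hy.add_period 0
  -- The paths of different parity are the inner side, of length `m`, and the detour, of length `r +
  -- 1`; the long path is the outer side, traversed backwards from `y N = y 0` to `y m`.
  refine hasLongJewel_of_seq (f₁ := fun i => y i) (L₁ := m)
    (f₂ := fun i => if i = 0 then y 0 else if i ≤ r then q i else y m) (L₂ := r + 1)
    (f₃ := fun i => y (N - i)) (L₃ := N - m) (u := y 0) (v := y m)
    ?_ ?_ ?_ rfl rfl ?_ rfl ?_ ?_ (by omega) (by omega) (by omega) (by omega) ?_ ?_
  · intro i j hij hj
    simp only [ne_eq]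
    rw [hy.eq_iff_of_window (by omega) (by omega), hy.adj_iff_of_window (by omega) (by omega)]
    omega
  · intro i j hij hj
    rcases Nat.eq_zero_or_pos i with rfl | hi
    · rcases Nat.lt_or_ge r j with hjr | hjr
      · have : j = r + 1 := by omega
        subst this
        simp only [ne_eq, if_true, Nat.succ_ne_zero, if_false,
          show ¬ (r + 1 ≤ r) by omega]
        rw [hy.eq_iff_of_window (by omega) (by omega), hy.adj_iff_of_window (by omega) (by omega)]
        omega
      · simp only [ne_eq, if_true, show j ≠ 0 by omega, if_false, hjr]
        rw [← hN, G.adj_comm, hN, hq0 j (by omega) hjr, ← hN]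
        exact ⟨fun h => hne j (by omega) hjr N (by omega) le_rfl h.symm, by omega⟩
    · rcases Nat.lt_or_ge r j with hjr | hjr
      · have : j = r + 1 := by omega
        subst this
        simp only [ne_eq, show i ≠ 0 by omega, if_false, show i ≤ r by omega, if_true,
          Nat.succ_ne_zero, show ¬ (r + 1 ≤ r) by omega]
        rw [hqm i (by omega) (by omega)]
        exact ⟨fun h => hne i (by omega) (by omega) m le_rfl (by omega) h, by omega⟩
      · simp only [ne_eq, show i ≠ 0 by omega, if_false, show i ≤ r by omega, if_true,
          show j ≠ 0 by omega, hjr]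
        exact hq i j (by omega) hij hjr
  · intro i j hij hj
    simp only [ne_eq]
    rw [hy.eq_iff_of_window (by omega) (by omega), hy.adj_iff_of_window (by omega) (by omega)]
    omega
  · simpa using hN
  · simp
  · congr 1
    omega
  · intro t i h1 h2 h3 h4
    simp only [ne_eq]
    rw [hy.eq_iff_of_window (by omega) (by omega), hy.adj_iff_of_window (by omega) (by omega)]
    omega
  · intro t i h1 h2 h3 h4
    simp only [ne_eq, show i ≠ 0 by omega, if_false, show i ≤ r by omega, if_true]
    exact ⟨fun h => hne i (by omega) (by omega) _ (by omega) (by omega) h.symm,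
      fun h => hout i (by omega) (by omega) _ (by omega) (by omega) h.symm⟩

/-- The path `q 1, …, q r` is attached to the hole `y` at `y 0` and `y m`, and possibly, as the
two flags tell, to the inner neighbours `y 1` and `y (m - 1)` of these. -/
structure IsEar (G : SimpleGraph V) (N : ℕ) (y : ℤ → V) (q : ℕ → V) (m r : ℕ) (α β : Prop) :
    Prop where
  path : ∀ i j, 1 ≤ i → i < j → j ≤ r → q i ≠ q j ∧ (G.Adj (q i) (q j) ↔ j = i + 1)
  ne : ∀ i, 1 ≤ i → i ≤ r → ∀ t : ℤ, q i ≠ y t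
  adj : ∀ i, 1 ≤ i → i ≤ r → ∀ t : ℤ, 0 ≤ t → t < N → (G.Adj (q i) (y t) ↔
    (i = 1 ∧ t = 0) ∨ (i = r ∧ t = m) ∨ (i = 1 ∧ t = 1 ∧ α) ∨ (i = r ∧ t = m - 1 ∧ β))

/-- Reading hole and ear from the other end exchanges the flags, so only one of the two pyramid
cases has to be treated. -/
theorem IsEar.reverse {N m r : ℕ} {y : ℤ → V} (hy : HoleSeq G N y) {q : ℕ → V} {α β : Prop}
    (h : IsEar G N y q m r α β) (hm : 1 ≤ m) (hmN : m < N) :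
    IsEar G N (fun t => y (m - t)) (fun i => q (r + 1 - i)) m r β α where
  path i j hi hij hj := by
    obtain ⟨h1, h2⟩ := h.path (r + 1 - j) (r + 1 - i) (by omega) (by omega) (by omega)
    refine ⟨h1.symm, ?_⟩
    rw [G.adj_comm, h2]
    omega
  ne i hi hir t := h.ne _ (by omega) (by omega) _
  adj i hi hir t ht htN := by
    rcases le_or_gt t m with htm | htm
    · rw [h.adj _ (by omega) (by omega) _ (by omega) (by omega)]
      constructor
      · rintro (⟨h1, h2⟩ | ⟨h1, h2⟩ | ⟨h1, h2, h3⟩ | ⟨h1, h2, h3⟩)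
        · exact Or.inr (Or.inl ⟨by omega, by omega⟩)
        · exact Or.inl ⟨by omega, by omega⟩
        · exact Or.inr (Or.inr (Or.inr ⟨by omega, by omega, h3⟩))
        · exact Or.inr (Or.inr (Or.inl ⟨by omega, by omega, h3⟩))
      · rintro (⟨h1, h2⟩ | ⟨h1, h2⟩ | ⟨h1, h2, h3⟩ | ⟨h1, h2, h3⟩)
        · exact Or.inr (Or.inl ⟨by omega, by omega⟩)
        · exact Or.inl ⟨by omega, by omega⟩
        · exact Or.inr (Or.inr (Or.inr ⟨by omega, by omega, h3⟩))
        · exact Or.inr (Or.inr (Or.inl ⟨by omega, by omega, h3⟩))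
    · rw [← hy.add_period, h.adj _ (by omega) (by omega) _ (by omega) (by omega)]
      constructor
      · rintro (⟨h1, h2⟩ | ⟨h1, h2⟩ | ⟨h1, h2, h3⟩ | ⟨h1, h2, h3⟩) <;> omega
      · rintro (⟨h1, h2⟩ | ⟨h1, h2⟩ | ⟨h1, h2, h3⟩ | ⟨h1, h2, h3⟩) <;> omega

/-- The triangle is `y (m - 1)`, `y m`, `q r` and the apex is `y 0`. The three paths are the inner
side, the ear and the outer side; the last two are long. -/
theorem IsEar.hasLongPyramid {N m r ℓ : ℕ} {y : ℤ → V} (hy : HoleSeq G N y) {q : ℕ → V}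
    {α β : Prop} (h : IsEar G N y q m r α β) (hα : ¬ α) (hβ : β) (hm : 2 ≤ m) (hr : 1 ≤ r)
    (hmN : m + 2 ≤ N) (h1 : m + ℓ ≤ N) (h2 : ℓ ≤ r) : HasLongPyramid G ℓ := by
  have hN : y N = y 0 := by simpa using hy.add_period 0
  refine hasLongPyramid_of_seq (a := y 0) (f₁ := fun i => y i) (L₁ := m - 1)
    (f₂ := fun i => if i = 0 then y 0 else q i) (L₂ := r)
    (f₃ := fun i => y (N - i)) (L₃ := N - m) ?_ ?_ ?_ rfl rfl (by simpa using hN)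
    (by omega) (by omega) (by omega) (by omega) ?_ ?_ ?_
  · intro i j hij hj
    simp only [ne_eq]
    rw [hy.eq_iff_of_window (by omega) (by omega), hy.adj_iff_of_window (by omega) (by omega)]
    omega
  · intro i j hij hj
    rcases Nat.eq_zero_or_pos i with rfl | hi
    · simp only [ne_eq, if_true, show j ≠ 0 by omega, if_false]
      refine ⟨fun e => h.ne j (by omega) hj 0 e.symm, ?_⟩
      rw [G.adj_comm, h.adj j (by omega) hj 0 le_rfl (by omega)]
      omega
    · simp only [ne_eq, show i ≠ 0 by omega, show j ≠ 0 by omega, if_false]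
      exact h.path i j hi hij hj
  · intro i j hij hj
    simp only [ne_eq]
    rw [hy.eq_iff_of_window (by omega) (by omega), hy.adj_iff_of_window (by omega) (by omega)]
    omega
  · intro i j hi1 hi2 hj1 hj2
    simp only [ne_eq, show j ≠ 0 by omega, if_false]
    refine ⟨fun e => h.ne j (by omega) hj2 _ e.symm, ?_⟩
    rw [G.adj_comm, h.adj j (by omega) hj2 _ (by omega) (by omega)]
    simp only [hα, hβ, and_false, and_true, false_or]
    omega
  · intro i j hi1 hi2 hj1 hj2
    simp only [ne_eq]
    rw [hy.eq_iff_of_window (by omega) (by omega), hy.adj_iff_of_window (by omega) (by omega)]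
    omega
  · intro i j hi1 hi2 hj1 hj2
    simp only [ne_eq, show i ≠ 0 by omega, if_false]
    refine ⟨fun e => h.ne i (by omega) hi2 _ e, ?_⟩
    rw [h.adj i (by omega) hi2 _ (by omega) (by omega)]
    simp only [hα, hβ, and_false, and_true, false_or]
    omega

/-- An ear whose two sides have different parities contradicts the minimality of a long odd
hole in a candidate. -/
theorem IsEar.false_of_parity {N m r ℓ c : ℕ} {y : ℤ → V} (hy : HoleSeq G N y) {q : ℕ → V}
    {α β : Prop} (h : IsEar G N y q m r α β) (hℓ : 5 ≤ ℓ)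
    (hmin : ∀ (M : ℕ) (w : ℤ → V), HoleSeq G M w → ℓ ≤ M → M < c → M % 2 = 0)
    (hpyr : ¬ HasLongPyramid G ℓ)
    (hm : 1 ≤ m) (hmN : m + 2 ≤ N) (hpar : (m + r) % 2 = 0) (hr : ℓ ≤ r + 1)
    (hflag : α ∨ β → 2 ≤ m ∧ ℓ ≤ r) (hone : (α ↔ ¬ β) → m + ℓ ≤ N)
    (hnone : ¬ α → ¬ β → m + r + 1 < c) (hboth : α → β → m + r < c + 1) : False := by
  by_cases hα : α <;> by_cases hβ : β
  -- With both flags `y 0` and `y m` are cut off: `y 1, …, y (m - 1)` and the ear form a hole of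
  -- length `m - 1 + r`, which is odd.
  · obtain ⟨hm2, -⟩ := hflag (Or.inl hα)
    have hb := hboth hα hβ
    have := hmin (m - 1 + r) _ (HoleSeq.ofWindow (by omega)
      (fun i => if i < m - 1 then y (i + 1) else q (r - (i - (m - 1)))) ?_ ?_)
      (by omega) (by omega)
    · omega
    · intro i j hij hj
      split_ifs with h1 h2 h2
      · rw [ne_eq, hy.eq_iff_of_window (by omega) (by omega)]
        omega
      · exact fun e => h.ne _ (by omega) (by omega) _ e.symm
      · omega
      · exact (h.path _ _ (by omega) (by omega) (by omega)).1.symm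
    · intro i j hij hj
      split_ifs with h1 h2 h2
      · rw [hy.adj_iff_of_window (by omega) (by omega)]
        omega
      · rw [G.adj_comm, h.adj _ (by omega) (by omega) _ (by omega) (by omega)]
        simp only [hα, hβ, and_true]
        omega
      · omega
      · rw [G.adj_comm, (h.path _ _ (by omega) (by omega) (by omega)).2]
        omega
  -- With exactly one flag there is one triangle, hence a pyramid; here the flag sits at the first
  -- end, so the ear is reversed.
  · obtain ⟨hm2, hrl⟩ := hflag (Or.inl hα)
    have := hone (by simp [hα, hβ])
    refine hpyr ((h.reverse hy hm (by omega)).hasLongPyramid ?_ hβ hα hm2 (by omega) (by omega)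
      this hrl)
    have := (hy.reflect.shift (-m : ℤ))
    convert this using 2
    ring_nf
  · obtain ⟨hm2, hrl⟩ := hflag (Or.inr hβ)
    have := hone (by simp [hα, hβ])
    exact hpyr (h.hasLongPyramid hy hα hβ hm2 (by omega) (by omega) this hrl)
  -- Without flags the inner side with both ends and the ear form a hole of length `m + 1 + r`,
  -- again odd.
  · have hb := hnone hα hβ
    have := hmin (m + 1 + r) _ (HoleSeq.ofWindow (by omega)
      (fun i => if i < m + 1 then y i else q (r - (i - (m + 1)))) ?_ ?_) (by omega) (by omega)
    · omega
    · intro i j hij hj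
      split_ifs with h1 h2 h2
      · rw [ne_eq, hy.eq_iff_of_window (by omega) (by omega)]
        omega
      · exact fun e => h.ne _ (by omega) (by omega) _ e.symm
      · omega
      · exact (h.path _ _ (by omega) (by omega) (by omega)).1.symm
    · intro i j hij hj
      split_ifs with h1 h2 h2
      · rw [hy.adj_iff_of_window (by omega) (by omega)]
        omega
      · rw [G.adj_comm, h.adj _ (by omega) (by omega) _ (by omega) (by omega)]
        simp only [hα, hβ, and_false, or_false]
        omega
      · omega
      · rw [G.adj_comm, (h.path _ _ (by omega) (by omega) (by omega)).2]
        omega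

end LongOddHole

/-! ### Walks of given length, cyclic distance, and neighbours of non-major vertices in the hole. -/

namespace LongOddHole

variable {V : Type*} {G : SimpleGraph V}

/-! ### Bounded connections -/

/-- There is a walk of length `k` from `u` to `v` all of whose vertices satisfy `S`. -/
def Conn (G : SimpleGraph V) (S : V → Prop) (k : ℕ) (u v : V) : Prop :=
  ∃ P : ℕ → V, P 0 = u ∧ P k = v ∧ (∀ i < k, G.Adj (P i) (P (i + 1))) ∧ ∀ i ≤ k, S (P i)

namespace Conn

variable {S : V → Prop} {k l : ℕ} {u v w : V}

theorem refl (h : S u) : Conn G S 0 u u :=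
  ⟨fun _ => u, rfl, rfl, by simp, fun _ _ => h⟩

theorem symm (h : Conn G S k u v) : Conn G S k v u := by
  obtain ⟨P, rfl, rfl, h1, h2⟩ := h
  refine ⟨fun i => P (k - i), by simp, by simp, ?_, fun i _ => h2 _ (by omega)⟩
  intro i hi
  have := h1 (k - (i + 1)) (by omega)
  rw [show k - (i + 1) + 1 = k - i by omega] at this
  exact this.symm

theorem append (h₁ : Conn G S k u v) (h₂ : Conn G S l v w) : Conn G S (k + l) u w := by
  obtain ⟨P, rfl, hv, h1, h2⟩ := h₁
  obtain ⟨Q, hv', rfl, h3, h4⟩ := h₂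
  refine ⟨fun i => if i ≤ k then P i else Q (i - k), by simp, ?_, ?_, ?_⟩
  · rcases Nat.eq_zero_or_pos l with rfl | h
    · simp [hv, hv']
    · simp [show ¬ (k + l ≤ k) by omega]
  · intro i hi
    rcases lt_trichotomy i k with h | h | h
    · simp only [show i ≤ k by omega, show i + 1 ≤ k by omega, if_true]
      exact h1 i h
    · subst h
      simp only [le_refl, if_true, show ¬ (i + 1 ≤ i) by omega, if_false]
      rw [hv, ← hv', show i + 1 - i = 0 + 1 by omega]
      exact h3 0 (by omega)
    · simp only [show ¬ (i ≤ k) by omega, show ¬ (i + 1 ≤ k) by omega, if_false]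
      rw [show i + 1 - k = i - k + 1 by omega]
      exact h3 _ (by omega)
  · intro i hi
    dsimp only
    split_ifs with h
    · exact h2 i h
    · exact h4 _ (by omega)

theorem single (hu : S u) (hv : S v) (h : G.Adj u v) : Conn G S 1 u v := by
  refine ⟨fun i => if i = 0 then u else v, rfl, rfl, ?_, ?_⟩
  · intro i hi
    have : i = 0 := by omega
    subst this
    simpa using h
  · intro i _
    dsimp only
    split_ifs
    exacts [hu, hv]

theorem of_seq {P : ℕ → V} {m i j : ℕ} (hadj : ∀ i < m, G.Adj (P i) (P (i + 1)))
    (hS : ∀ i ≤ m, S (P i)) (hij : i ≤ j) (hj : j ≤ m) : Conn G S (j - i) (P i) (P j) :=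
  ⟨fun t => P (i + t), rfl, by simp [Nat.add_sub_cancel' hij],
    fun t ht => hadj (i + t) (by omega), fun t ht => hS _ (by omega)⟩

theorem detour {P : ℕ → V} {m i j : ℕ} (hadj : ∀ i < m, G.Adj (P i) (P (i + 1)))
    (hS : ∀ i ≤ m, S (P i)) (hij : i ≤ j) (hj : j ≤ m) (hu : S u) (hv : S v)
    (hui : G.Adj (P i) u) (hvj : G.Adj (P j) v) : Conn G S (j - i + 2) u v := by
  have := ((single hu (hS i (by omega)) hui.symm).append (of_seq hadj hS hij hj)).append
    (single (hS j hj) hv hvj)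
  rwa [show 1 + (j - i) + 1 = j - i + 2 by omega] at this

theorem mono {S' : V → Prop} (h : Conn G S k u v) (hS : ∀ v, S v → S' v) : Conn G S' k u v := by
  obtain ⟨P, h0, hk, h1, h2⟩ := h
  exact ⟨P, h0, hk, h1, fun i hi => hS _ (h2 i hi)⟩

end Conn

/-! ### Cyclic distance -/

/-- The cyclic distance modulo `c` of `i` and `j` is at most `k`. -/
def Near (c k : ℕ) (i j : ℤ) : Prop :=
  ∃ δ : ℤ, -(k : ℤ) ≤ δ ∧ δ ≤ k ∧ (c : ℤ) ∣ j - i - δ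

theorem Near.trans {c k l : ℕ} {i j t : ℤ} (h : Near c k i j) (h' : Near c l j t) :
    Near c (k + l) i t := by
  obtain ⟨δ, h1, h2, h3⟩ := h
  obtain ⟨δ', h1', h2', h3'⟩ := h'
  refine ⟨δ + δ', by push_cast; omega, by push_cast; omega, ?_⟩
  have := dvd_add h3 h3'
  rwa [show j - i - δ + (t - j - δ') = t - i - (δ + δ') by ring] at this

theorem near_iff_of_window {c k : ℕ} {i j : ℤ} (h₁ : -(c : ℤ) < j - i) (h₂ : j - i < c)
    (hk : k < c) : Near c k i j ↔
      (-(k : ℤ) ≤ j - i ∧ j - i ≤ k) ∨ (c : ℤ) - k ≤ j - i ∨ j - i ≤ (k : ℤ) - c := by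
  constructor
  · rintro ⟨δ, h3, h4, h5⟩
    rw [dvd_iff_of_lt_two_mul (by omega) (by omega)] at h5
    omega
  · rintro (h | h | h)
    · exact ⟨j - i, h.1, h.2, by simp⟩
    · exact ⟨j - i - c, by omega, by omega, by simp⟩
    · exact ⟨j - i + c, by omega, by omega, by simp⟩

/-! ### Neighbours of vertices that are not major -/

/-- A non-major vertex is either a vertex of the hole, where its two neighbours surround it, or has
all neighbours in a three-vertex path of the hole. Both cases get the same description, centred at
`t`. -/
theorem HoleSeq.exists_of_not_isMajor {c : ℕ} {z : ℤ → V} (hz : HoleSeq G c z) {v : V}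
    (hv : ¬ IsMajor G (Set.range z) v) :
    ∃ t : ℤ, ∀ q, G.Adj v (z q) → z q = z (t - 1) ∨ z q = z t ∨ z q = z (t + 1) := by
  have hnb : ∀ t q, G.Adj (z t) (z q) → z q = z (t - 1) ∨ z q = z (t + 1) := by
    intro t q h
    rcases (hz.adj_iff t q).1 h with h | h
    · right
      rw [hz.eq_iff, ← dvd_neg]
      ring_nf at h ⊢
      exact h
    · left
      rw [hz.eq_iff, ← dvd_neg]
      ring_nf at h ⊢
      exact h
  by_cases hvC : v ∈ Set.range z
  · obtain ⟨t, rfl⟩ := hvC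
    refine ⟨t, fun q hq => ?_⟩
    rcases hnb t q hq with h | h
    · exact Or.inl h
    · exact Or.inr (Or.inr h)
  · simp only [IsMajor, not_and, not_not] at hv
    obtain ⟨a, b, p, ⟨-, hpC⟩, hlen, hall⟩ := hv hvC
    obtain ⟨t, ht⟩ := hpC _ (p.getVert_mem_support 1)
    have h01 := p.adj_getVert_succ (i := 0) (by omega)
    have h12 := p.adj_getVert_succ (i := 1) (by omega)
    refine ⟨t, fun q hq => ?_⟩
    have hq' := hall _ ⟨q, rfl⟩ hq
    rw [SimpleGraph.Walk.mem_support_iff_exists_getVert] at hq'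
    obtain ⟨i, hi, hil⟩ := hq'
    have : i = 0 ∨ i = 1 ∨ i = 2 := by omega
    rcases this with rfl | rfl | rfl
    · rw [hi, zero_add, ← ht] at h01
      rcases hnb t q h01.symm with h | h
      · exact Or.inl h
      · exact Or.inr (Or.inr h)
    · rw [ht, hi]
      exact Or.inr (Or.inl rfl)
    · rw [hi, ← ht] at h12
      rcases hnb t q h12 with h | h
      · exact Or.inl h
      · exact Or.inr (Or.inr h)

theorem HoleSeq.not_isMajor_of_forall {c : ℕ} {z : ℤ → V} (hz : HoleSeq G c z) {v : V} (t : ℤ)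
    (h : ∀ q, G.Adj v (z q) → z q = z (t - 1) ∨ z q = z t ∨ z q = z (t + 1)) :
    ¬ IsMajor G (Set.range z) v := by
  rintro ⟨-, hv⟩
  have hc := hz.four_le
  have hseq : IsInducedSeq G (fun i : ℕ => z (t - 1 + i)) 2 := by
    intro i j hij hj
    simp only [ne_eq]
    rw [hz.eq_iff_of_window (by omega) (by omega), hz.adj_iff_of_window (by omega) (by omega)]
    omega
  obtain ⟨p, hp, hl, hs, -⟩ := hseq.exists_path rfl rfl
  refine hv ⟨_, _, p, ⟨hp.1, ?_⟩, hl, ?_⟩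
  · intro w hw
    obtain ⟨i, -, rfl⟩ := (hs w).1 hw
    exact ⟨_, rfl⟩
  · rintro _ ⟨q, rfl⟩ hq
    rw [hs]
    rcases h q hq with h | h | h
    · exact ⟨0, by omega, by simpa using h⟩
    · exact ⟨1, by omega, by simpa using h⟩
    · exact ⟨2, by omega, by rw [h]; congr 1; push_cast; ring⟩

theorem not_isMajor_range {z : ℤ → V} (i : ℤ) :
    ¬ IsMajor G (Set.range z) (z i) := fun h => h.1 ⟨i, rfl⟩

/-- The neighbours of a vertex that is not major lie in an interval of length at most two. -/
theorem HoleSeq.exists_interval {c : ℕ} {z : ℤ → V} (hz : HoleSeq G c z) {v : V}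
    (hv : ¬ IsMajor G (Set.range z) v) {q₀ : ℤ} (h₀ : G.Adj v (z q₀)) :
    ∃ lo hi : ℤ, lo ≤ q₀ ∧ q₀ ≤ hi ∧ hi ≤ lo + 2 ∧ G.Adj v (z lo) ∧ G.Adj v (z hi) ∧
      ∀ q, q₀ - c + 3 ≤ q → q ≤ q₀ + c - 3 → G.Adj v (z q) → lo ≤ q ∧ q ≤ hi := by
  obtain ⟨t, ht⟩ := hz.exists_of_not_isMajor hv
  have hc := hz.four_le
  -- `T` is the representative of the centre `t` modulo `c` that lies within one of `q₀`. Then `q`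
  -- and `T` differ by at most `c - 2` in the window considered, so congruences become equalities.
  obtain ⟨T, hT1, hT2, hT⟩ : ∃ T : ℤ, T - 1 ≤ q₀ ∧ q₀ ≤ T + 1 ∧ (c : ℤ) ∣ T - t := by
    rcases ht q₀ h₀ with h | h | h <;> rw [hz.eq_iff, ← dvd_neg] at h
    · exact ⟨q₀ + 1, by omega, by omega, by ring_nf at h ⊢; exact h⟩
    · exact ⟨q₀, by omega, by omega, by ring_nf at h ⊢; exact h⟩
    · exact ⟨q₀ - 1, by omega, by omega, by ring_nf at h ⊢; exact h⟩
  have key : ∀ q, q₀ - c + 3 ≤ q → q ≤ q₀ + c - 3 → G.Adj v (z q) →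
      q = T - 1 ∨ q = T ∨ q = T + 1 := by
    intro q h1 h2 h3
    have e : ∀ s, z q = z (t + s) → (c : ℤ) ∣ q - (T + s) := by
      intro s h
      rw [hz.eq_iff] at h
      have := dvd_add h hT
      rw [← dvd_neg] at this
      ring_nf at this ⊢
      exact this
    rcases ht q h3 with h | h | h
    · have := e (-1) h
      rw [dvd_iff_of_small (by omega) (by omega)] at this
      omega
    · have := e 0 (by simpa using h)
      rw [dvd_iff_of_small (by omega) (by omega)] at this
      omega
    · have := e 1 h
      rw [dvd_iff_of_small (by omega) (by omega)] at this
      omega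
  have h₀' := key q₀ (by omega) (by omega) h₀
  have hlo : ∃ lo, T - 1 ≤ lo ∧ lo ≤ q₀ ∧ G.Adj v (z lo) ∧
      ∀ q, T - 1 ≤ q → G.Adj v (z q) → lo ≤ q := by
    by_cases h1 : G.Adj v (z (T - 1))
    · exact ⟨T - 1, by omega, by omega, h1, fun q hq _ => hq⟩
    · by_cases h2 : G.Adj v (z T)
      · refine ⟨T, by omega, ?_, h2, fun q hq h => ?_⟩
        · rcases h₀' with rfl | rfl | rfl
          · exact absurd h₀ h1
          · omega
          · omega
        · by_contra hlt
          rw [show q = T - 1 by omega] at h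
          exact h1 h
      · refine ⟨T + 1, by omega, ?_, ?_, fun q hq h => ?_⟩
        · rcases h₀' with rfl | rfl | rfl
          · exact absurd h₀ h1
          · exact absurd h₀ h2
          · omega
        · rcases h₀' with rfl | rfl | rfl
          · exact absurd h₀ h1
          · exact absurd h₀ h2
          · exact h₀
        · by_contra hlt
          have : q = T - 1 ∨ q = T := by omega
          rcases this with rfl | rfl
          · exact h1 h
          · exact h2 h
  have hhi : ∃ hi, hi ≤ T + 1 ∧ q₀ ≤ hi ∧ G.Adj v (z hi) ∧
      ∀ q, q ≤ T + 1 → G.Adj v (z q) → q ≤ hi := by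
    by_cases h1 : G.Adj v (z (T + 1))
    · exact ⟨T + 1, by omega, by omega, h1, fun q hq _ => hq⟩
    · by_cases h2 : G.Adj v (z T)
      · refine ⟨T, by omega, ?_, h2, fun q hq h => ?_⟩
        · rcases h₀' with rfl | rfl | rfl
          · omega
          · omega
          · exact absurd h₀ h1
        · by_contra hlt
          rw [show q = T + 1 by omega] at h
          exact h1 h
      · refine ⟨T - 1, by omega, ?_, ?_, fun q hq h => ?_⟩
        · rcases h₀' with rfl | rfl | rfl
          · omega
          · exact absurd h₀ h2
          · exact absurd h₀ h1
        · rcases h₀' with rfl | rfl | rfl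
          · exact h₀
          · exact absurd h₀ h2
          · exact absurd h₀ h1
        · by_contra hlt
          have : q = T + 1 ∨ q = T ∨ q < T - 1 := by omega
          rcases this with rfl | rfl | h3
          · exact h1 h
          · exact h2 h
          · omega
  obtain ⟨lo, l1, l2, l3, l4⟩ := hlo
  obtain ⟨hi, u1, u2, u3, u4⟩ := hhi
  refine ⟨lo, hi, l2, u2, by omega, l3, u3, fun q h1 h2 h3 => ?_⟩
  have := key q h1 h2 h3
  exact ⟨l4 q (by omega) h3, u4 q (by omega) h3⟩

/-! ### Shortest long odd holes in candidates -/

/-- `z` runs around a shortest long odd hole `C` of length `c` of a candidate. -/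
structure IsShortestSeq (G : SimpleGraph V) (ℓ c : ℕ) (C : Set V) (z : ℤ → V) : Prop where
  hole : HoleSeq G c z
  range_eq : Set.range z = C
  five_le : 5 ≤ ℓ
  large : 2 * ℓ + 3 ≤ c
  odd : c % 2 = 1
  minimal : ∀ (M : ℕ) (w : ℤ → V), HoleSeq G M w → ℓ ≤ M → M < c → M % 2 = 0
  no_pyramid : ¬ HasLongPyramid G ℓ
  no_jewel : ¬ HasLongJewel G ℓ (ℓ + 2)

namespace IsShortestSeq

variable {ℓ c : ℕ} {C : Set V} {z : ℤ → V}

theorem shift (h : IsShortestSeq G ℓ c C z) (s : ℤ) :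
    IsShortestSeq G ℓ c C (fun i => z (i + s)) where
  hole := h.hole.shift s
  range_eq := by
    rw [← h.range_eq]
    exact (Equiv.addRight s).surjective.range_comp z
  five_le := h.five_le
  large := h.large
  odd := h.odd
  minimal := h.minimal
  no_pyramid := h.no_pyramid
  no_jewel := h.no_jewel

theorem reflect (h : IsShortestSeq G ℓ c C z) : IsShortestSeq G ℓ c C (fun i => z (-i)) where
  hole := h.hole.reflect
  range_eq := by
    rw [← h.range_eq]
    exact (Equiv.neg ℤ).surjective.range_comp z
  five_le := h.five_le
  large := h.large
  odd := h.odd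
  minimal := h.minimal
  no_pyramid := h.no_pyramid
  no_jewel := h.no_jewel

theorem not_isMajor (h : IsShortestSeq G ℓ c C z) (i : ℤ) : ¬ IsMajor G C (z i) := by
  rw [← h.range_eq]
  exact not_isMajor_range i

end IsShortestSeq

theorem IsShortestLongOddHole.exists_seq {ℓ : ℕ} (hℓ : 5 ≤ ℓ) (hG : IsCandidate G ℓ) {C : Set V}
    (hC : IsShortestLongOddHole G ℓ C) : ∃ (c : ℕ) (z : ℤ → V), IsShortestSeq G ℓ c C z := by
  obtain ⟨c, z, hz, rfl⟩ := hC.1.1.exists_holeSeq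
  have hcard := hz.isHole.2
  have hodd : c % 2 = 1 := by
    have := hC.1.2.2
    rw [hcard] at this
    exact Nat.odd_iff.1 this
  refine ⟨c, z, hz, rfl, hℓ, ?_, hodd, ?_, hG.1, hG.2.1⟩
  · by_contra hlt
    have : c = 2 * ℓ + 2 ∨ c ≤ 2 * ℓ + 1 := by omega
    exact hG.2.2 ⟨_, hC.1, by omega⟩
  · intro M w hw h1 h2
    by_contra hpar
    have := hC.2 (Set.range w) ⟨hw.isHole.1, by rw [hw.isHole.2]; exact h1,
      by rw [hw.isHole.2]; exact Nat.odd_iff.2 (by omega)⟩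
    rw [hcard, hw.isHole.2] at this
    omega

end LongOddHole

/-! ### Shortcuts of a shortest long odd hole, and the even hole that they create. -/

namespace LongOddHole

variable {V : Type*} {G : SimpleGraph V}

/-- Form of `IsEar` for an ear attached at positions `t₁` and `t₂` of the hole. -/
theorem isEar_of_offset {N t₁ t₂ r : ℕ} {y : ℤ → V} (hy : HoleSeq G N y) {q : ℕ → V}
    {α β : Prop} (ht : t₁ < t₂) (ht₂ : t₂ < N)
    (path : ∀ i j, 1 ≤ i → i < j → j ≤ r → q i ≠ q j ∧ (G.Adj (q i) (q j) ↔ j = i + 1))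
    (ne : ∀ i, 1 ≤ i → i ≤ r → ∀ t : ℤ, q i ≠ y t)
    (adj : ∀ i, 1 ≤ i → i ≤ r → ∀ s : ℕ, s < N → (G.Adj (q i) (y s) ↔
      (i = 1 ∧ s = t₁) ∨ (i = r ∧ s = t₂) ∨ (i = 1 ∧ s = t₁ + 1 ∧ α) ∨
        (i = r ∧ s + 1 = t₂ ∧ β))) :
    IsEar G N (fun t => y (t + t₁)) q (t₂ - t₁) r α β where
  path := path
  ne i hi hir t := ne i hi hir _
  adj i hi hir t ht0 htN := by
    rcases lt_or_ge (t + t₁) N with h | h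
    · have e : y (t + t₁) = y (((t + t₁).toNat : ℕ) : ℤ) := by
        congr 1
        omega
      rw [e, adj i hi hir _ (by omega)]
      constructor
      · rintro (⟨h1, h2⟩ | ⟨h1, h2⟩ | ⟨h1, h2, h3⟩ | ⟨h1, h2, h3⟩)
        · exact Or.inl ⟨h1, by omega⟩
        · exact Or.inr (Or.inl ⟨h1, by omega⟩)
        · exact Or.inr (Or.inr (Or.inl ⟨h1, by omega, h3⟩))
        · exact Or.inr (Or.inr (Or.inr ⟨h1, by omega, h3⟩))
      · rintro (⟨h1, h2⟩ | ⟨h1, h2⟩ | ⟨h1, h2, h3⟩ | ⟨h1, h2, h3⟩)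
        · exact Or.inl ⟨h1, by omega⟩
        · exact Or.inr (Or.inl ⟨h1, by omega⟩)
        · exact Or.inr (Or.inr (Or.inl ⟨h1, by omega, h3⟩))
        · exact Or.inr (Or.inr (Or.inr ⟨h1, by omega, h3⟩))
    · have e : y (t + t₁) = y (((t + t₁ - N).toNat : ℕ) : ℤ) := by
        rw [← hy.sub_period]
        congr 1
        omega
      rw [e, adj i hi hir _ (by omega)]
      constructor
      · rintro (⟨h1, h2⟩ | ⟨h1, h2⟩ | ⟨h1, h2, h3⟩ | ⟨h1, h2, h3⟩) <;> omega
      · rintro (⟨h1, h2⟩ | ⟨h1, h2⟩ | ⟨h1, h2, h3⟩ | ⟨h1, h2, h3⟩) <;> omega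

/-- Form of `HoleSeq.hasLongJewel` for a detour between positions `t₁` and `t₂` of the hole. -/
theorem HoleSeq.hasLongJewel_of_offset {N t₁ t₂ r ℓ : ℕ} {y : ℤ → V} (hy : HoleSeq G N y)
    (q : ℕ → V) (ht : t₁ + 2 ≤ t₂) (hr : 1 ≤ r) (ht₂ : t₂ < N) (hmN : t₂ - t₁ + ℓ ≤ N)
    (hℓ : 2 ≤ ℓ)
    (hq : ∀ i j, 1 ≤ i → i < j → j ≤ r → q i ≠ q j ∧ (G.Adj (q i) (q j) ↔ j = i + 1))
    (ne : ∀ i, 1 ≤ i → i ≤ r → ∀ t : ℤ, q i ≠ y t)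
    (adj : ∀ i, 1 ≤ i → i ≤ r → ∀ s : ℕ, s < N → s ≤ t₁ ∨ t₂ ≤ s → (G.Adj (q i) (y s) ↔
      (i = 1 ∧ s = t₁) ∨ (i = r ∧ s = t₂)))
    (hpar : (t₂ - t₁ + r) % 2 = 0) (hmℓ : t₂ - t₁ ≤ ℓ + 1) (hrℓ : r ≤ ℓ) :
    HasLongJewel G ℓ (ℓ + 2) := by
  refine (hy.shift t₁).hasLongJewel q (m := t₂ - t₁) (by omega) hr (by omega) hℓ hq ?_ ?_ ?_ ?_
    hpar hmℓ hrℓ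
  · intro i hi hir
    have := adj i hi hir t₁ (by omega) (by omega)
    simp only [zero_add]
    rw [this]
    omega
  · intro i hi hir
    have := adj i hi hir t₂ (by omega) (by omega)
    rw [show (((t₂ - t₁ : ℕ) : ℤ) + t₁) = t₂ by omega, this]
    omega
  · exact fun i hi hir t _ _ => ne i hi hir _
  · intro i hi hir t h1 h2
    rcases lt_or_ge (t + t₁) N with h | h
    · have e : y (t + t₁) = y (((t + t₁).toNat : ℕ) : ℤ) := by
        congr 1
        omega
      rw [e, adj i hi hir _ (by omega) (by omega)]
      omega
    · have e : y (t + t₁) = y (((t + t₁ - N).toNat : ℕ) : ℤ) := by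
        rw [← hy.sub_period]
        congr 1
        omega
      rw [e, adj i hi hir _ (by omega) (by omega)]
      omega

/-- A path `P` between the vertices `z 0` and `z b` of a shortest long odd hole `z`, whose inner
vertices are not in the hole, and which is shorter than the path `z 0, …, z b`. The intervals
`[lo₁, hi₁]` and `[lo₂, hi₂]` contain the neighbours of its second and of its last but one
vertex. -/
structure IsShortcut (G : SimpleGraph V) (ℓ c : ℕ) (C : Set V) (z : ℤ → V) (P : ℕ → V) (m : ℕ)
    (b lo₁ hi₁ lo₂ hi₂ : ℤ) : Prop where
  ctx : IsShortestSeq G ℓ c C z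
  start : P 0 = z 0
  finish : P m = z b
  induced : IsInducedSeq G P m
  not_mem : ∀ i, 0 < i → i < m → ∀ q, P i ≠ z q
  three_le : 3 ≤ m
  length_le : 2 * m + 3 ≤ c
  lt_b : (m : ℤ) < b
  b_le : 2 * b ≤ c + 1
  middle : ∀ i, 1 < i → i + 1 < m → ∀ q, b < q → q < c → ¬ G.Adj (P i) (z q)
  lo₁_le : lo₁ ≤ 0
  le_hi₁ : 0 ≤ hi₁
  width₁ : hi₁ ≤ lo₁ + 2
  adj_lo₁ : G.Adj (P 1) (z lo₁)
  adj_hi₁ : G.Adj (P 1) (z hi₁)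
  nbr₁ : ∀ q, 0 - (c : ℤ) + 3 ≤ q → q ≤ 0 + c - 3 → G.Adj (P 1) (z q) → lo₁ ≤ q ∧ q ≤ hi₁
  lo₂_le : lo₂ ≤ b
  le_hi₂ : b ≤ hi₂
  width₂ : hi₂ ≤ lo₂ + 2
  adj_lo₂ : G.Adj (P (m - 1)) (z lo₂)
  adj_hi₂ : G.Adj (P (m - 1)) (z hi₂)
  nbr₂ : ∀ q, b - (c : ℤ) + 3 ≤ q → q ≤ b + c - 3 → G.Adj (P (m - 1)) (z q) → lo₂ ≤ q ∧ q ≤ hi₂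

namespace IsShortcut

variable {ℓ c m : ℕ} {C : Set V} {z : ℤ → V} {P : ℕ → V} {b lo₁ hi₁ lo₂ hi₂ : ℤ}

/-- The field `middle` concerns the open side only. The ends `z 0` and `z b` are excluded because
they are the ends of the induced path `P`, and the remaining indices by periodicity. -/
theorem not_adj_middle (h : IsShortcut G ℓ c C z P m b lo₁ hi₁ lo₂ hi₂) {i : ℕ} (hi : 1 < i)
    (him : i + 1 < m) {q : ℤ} (h1 : b - c ≤ q) (h2 : q ≤ c)
    (h3 : q ≤ 0 ∨ b ≤ q) : ¬ G.Adj (P i) (z q) := by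
  have h0 : ¬ G.Adj (P i) (z 0) := by
    rw [← h.start, G.adj_comm, (h.induced 0 i (by omega) (by omega)).2]
    omega
  have hb : ¬ G.Adj (P i) (z b) := by
    rw [← h.finish, (h.induced i m (by omega) (by omega)).2]
    omega
  have hbc := h.lt_b
  rcases h3 with h3 | h3
  · rw [← h.ctx.hole.add_period]
    rcases eq_or_lt_of_le h3 with rfl | h4
    · rwa [h.ctx.hole.add_period]
    · rcases eq_or_lt_of_le h1 with rfl | h5
      · simpa using hb
      · exact h.middle i hi him _ (by omega) (by omega)
  · rcases eq_or_lt_of_le h3 with rfl | h4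
    · exact hb
    · rcases eq_or_lt_of_le h2 with rfl | h5
      · rw [← h.ctx.hole.sub_period]
        simpa using h0
      · exact h.middle i hi him _ (by omega) (by omega)

/-- The hole formed by the shortcut and the other side of the given hole. -/
theorem exists_hole (h : IsShortcut G ℓ c C z P m b lo₁ hi₁ lo₂ hi₂) :
    ∃ (N E : ℕ) (y : ℤ → V), (E : ℤ) = hi₂ - lo₁ ∧ N + E = m + c ∧ HoleSeq G N y ∧ y 0 = z lo₁ ∧
      (∀ i : ℕ, 0 < i → i < m → y i = P i) ∧
      (∀ i : ℕ, m ≤ i → i < N → y i = z (hi₂ + i - m)) ∧ (E + m) % 2 = 1 := by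
  have h1 := h.three_le
  have h2 := h.length_le
  have h3 := h.lt_b
  have h4 := h.b_le
  have h5 := h.lo₁_le
  have h6 := h.le_hi₁
  have h7 := h.width₁
  have h8 := h.lo₂_le
  have h9 := h.le_hi₂
  have h10 := h.width₂
  have h11 := h.ctx.five_le
  have h12 := h.ctx.large
  have h13 := h.ctx.odd
  have hz := h.ctx.hole
  obtain ⟨E, hE⟩ : ∃ E : ℕ, (E : ℤ) = hi₂ - lo₁ := ⟨(hi₂ - lo₁).toNat, by omega⟩
  obtain ⟨N, hN⟩ : ∃ N : ℕ, N + E = m + c := ⟨m + c - E, by omega⟩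
  -- The hole uses the outermost neighbours: it runs `z lo₁, P 1, …, P (m - 1), z hi₂` and returns
  -- along the hole to `z (lo₁ + c)`. Taking the outermost ones leaves no chords from `P 1` and `P
  -- (m - 1)`.
  let f : ℕ → V := fun i => if i = 0 then z lo₁ else if i < m then P i else z (hi₂ + i - m)
  have f0 : f 0 = z lo₁ := rfl
  have f1 : ∀ i : ℕ, 0 < i → i < m → f i = P i := by
    intro i hi him
    simp only [f, show i ≠ 0 by omega, if_false, him, if_true]
  have f2 : ∀ i : ℕ, m ≤ i → f i = z (hi₂ + i - m) := by
    intro i him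
    simp only [f, show i ≠ 0 by omega, if_false, show ¬ (i < m) by omega]
  have hP : ∀ i, 0 < i → i < m → ∀ q : ℤ, hi₂ ≤ q → q ≤ lo₁ + c →
      (G.Adj (P i) (z q) ↔ (i = 1 ∧ q = lo₁ + c) ∨ (i + 1 = m ∧ q = hi₂)) := by
    intro i hi him q hq1 hq2
    have c1 : i = 1 ∨ i + 1 = m ∨ (1 < i ∧ i + 1 < m) := by omega
    rcases c1 with rfl | hm | ⟨c1, c2⟩
    · constructor
      · intro hadj
        rcases le_or_gt q (0 + c - 3) with h14 | h14
        · have := h.nbr₁ q (by omega) h14 hadj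
          omega
        · rw [← hz.sub_period] at hadj
          have := h.nbr₁ _ (by omega) (by omega) hadj
          omega
      · rintro (⟨-, rfl⟩ | h14)
        · rw [hz.add_period]
          exact h.adj_lo₁
        · omega
    · have hm' : i = m - 1 := by omega
      subst hm'
      constructor
      · intro hadj
        have := h.nbr₂ q (by omega) (by omega) hadj
        omega
      · rintro (h14 | ⟨-, rfl⟩)
        · omega
        · exact h.adj_hi₂
    · constructor
      · intro hadj
        exact absurd hadj (h.not_adj_middle c1 c2 (by omega) (by omega) (by omega))
      · omega
  have hhole : HoleSeq G N (fun i => f (i % N).toNat) := by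
    refine HoleSeq.ofWindow (by omega) f ?_ ?_
    · intro i j hij hj
      rcases Nat.eq_zero_or_pos i with rfl | hi
      · rw [f0]
        rcases Nat.lt_or_ge j m with hjm | hjm
        · rw [f1 j hij hjm]
          exact (h.not_mem j hij hjm _).symm
        · rw [f2 j hjm, ne_eq, hz.eq_iff_of_window (by omega) (by omega)]
          omega
      · rcases Nat.lt_or_ge i m with him | him
        · rw [f1 i hi him]
          rcases Nat.lt_or_ge j m with hjm | hjm
          · rw [f1 j (by omega) hjm]
            exact (h.induced i j hij (by omega)).1
          · rw [f2 j hjm]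
            exact h.not_mem i hi him _
        · rw [f2 i him, f2 j (by omega), ne_eq, hz.eq_iff_of_window (by omega) (by omega)]
          omega
    · intro i j hij hj
      rcases Nat.eq_zero_or_pos i with rfl | hi
      · rw [f0]
        rcases Nat.lt_or_ge j m with hjm | hjm
        · rw [f1 j hij hjm, ← hz.add_period, G.adj_comm, hP j hij hjm _ (by omega) (by omega)]
          omega
        · rw [f2 j hjm, hz.adj_iff_of_window (by omega) (by omega)]
          omega
      · rcases Nat.lt_or_ge i m with him | him
        · rw [f1 i hi him]
          rcases Nat.lt_or_ge j m with hjm | hjm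
          · rw [f1 j (by omega) hjm, (h.induced i j hij (by omega)).2]
            omega
          · rw [f2 j hjm, hP i hi him _ (by omega) (by omega)]
            omega
        · rw [f2 i him, f2 j (by omega), hz.adj_iff_of_window (by omega) (by omega)]
          omega
  have hval : ∀ i : ℕ, i < N → ((i : ℤ) % (N : ℤ)).toNat = i := by
    intro i hi
    rw [Int.emod_eq_of_lt (by omega) (by omega)]
    simp
  refine ⟨N, E, _, hE, hN, hhole, ?_, ?_, ?_, ?_⟩
  · simpa using f0
  · intro i hi him
    rw [hval i (by omega), f1 i hi him]
  · intro i him hiN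
    rw [hval i hiN, f2 i him]
  -- Since `E ≥ b > m`, the new hole is shorter than the shortest long odd hole, and it has length
  -- at least `ℓ`; hence `N` is even. As `c` is odd, `E + m` is odd.
  · have := h.ctx.minimal N _ hhole (by omega) (by omega)
    omega

/-- The vertices between the two outermost attachments, on the longer side. -/
theorem side (h : IsShortcut G ℓ c C z P m b lo₁ hi₁ lo₂ hi₂) {N E : ℕ} {y : ℤ → V}
    (hE : (E : ℤ) = hi₂ - lo₁) (hN : N + E = m + c) (hy : HoleSeq G N y) (hy0 : y 0 = z lo₁)
    (hy1 : ∀ i : ℕ, 0 < i → i < m → y i = P i)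
    (hy2 : ∀ i : ℕ, m ≤ i → i < N → y i = z (hi₂ + i - m)) {a : ℕ} (ha : 0 < a) (haE : a < E) :
    (∀ t : ℤ, z (lo₁ + a) ≠ y t) ∧ ∀ s : ℕ, s < N → (G.Adj (z (lo₁ + a)) (y s) ↔
      (s = 0 ∧ a = 1) ∨ (s = m ∧ a + 1 = E) ∨ (0 < s ∧ s < m ∧ G.Adj (P s) (z (lo₁ + a)))) := by
  have h1 := h.three_le
  have h2 := h.length_le
  have h3 := h.lt_b
  have h4 := h.b_le
  have h5 := h.lo₁_le
  have h6 := h.le_hi₁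
  have h7 := h.width₁
  have h8 := h.lo₂_le
  have h9 := h.le_hi₂
  have h10 := h.width₂
  have h11 := h.ctx.five_le
  have h12 := h.ctx.large
  have h13 := h.ctx.odd
  have hz := h.ctx.hole
  constructor
  · intro t
    obtain ⟨s, hs0, hsN, hst⟩ := hy.exists_mem_window 0 t
    rw [← hst]
    obtain ⟨s, rfl⟩ := Int.eq_ofNat_of_zero_le hs0
    rcases Nat.eq_zero_or_pos s with rfl | hs
    · rw [Nat.cast_zero, hy0, ne_eq, hz.eq_iff_of_window (by omega) (by omega)]
      omega
    · rcases Nat.lt_or_ge s m with hsm | hsm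
      · rw [hy1 s hs hsm]
        exact (h.not_mem s hs hsm _).symm
      · rw [hy2 s hsm (by omega), ne_eq, hz.eq_iff_of_window (by omega) (by omega)]
        omega
  · intro s hsN
    rcases Nat.eq_zero_or_pos s with rfl | hs
    · rw [Nat.cast_zero, hy0, hz.adj_iff_of_window (by omega) (by omega)]
      omega
    · rcases Nat.lt_or_ge s m with hsm | hsm
      · rw [hy1 s hs hsm, G.adj_comm]
        constructor
        · exact fun hadj => Or.inr (Or.inr ⟨hs, hsm, hadj⟩)
        · rintro (h14 | h14 | h14)
          · omega
          · omega
          · exact h14.2.2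
      · rw [hy2 s hsm hsN, hz.adj_iff_of_window (by omega) (by omega)]
        omega

end IsShortcut

end LongOddHole

/-! ### Shortcuts do not exist: the cases without and with chords into the shorter side. -/

namespace LongOddHole

variable {V : Type*} {G : SimpleGraph V}

namespace IsShortcut

variable {ℓ c m : ℕ} {C : Set V} {z : ℤ → V} {P : ℕ → V} {b lo₁ hi₁ lo₂ hi₂ : ℤ}

theorem hole_path (h : IsShortcut G ℓ c C z P m b lo₁ hi₁ lo₂ hi₂) {E s r : ℕ}
    (hE : (E : ℤ) = hi₂ - lo₁) (hr : s + r < E) :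
    ∀ i j, 1 ≤ i → i < j → j ≤ r → z (lo₁ + (s + i : ℕ)) ≠ z (lo₁ + (s + j : ℕ)) ∧
      (G.Adj (z (lo₁ + (s + i : ℕ))) (z (lo₁ + (s + j : ℕ))) ↔ j = i + 1) := by
  intro i j hi hij hj
  have h1 := h.three_le
  have h2 := h.length_le
  have h4 := h.b_le
  have h5 := h.lo₁_le
  have h6 := h.le_hi₁
  have h7 := h.width₁
  have h8 := h.lo₂_le
  have h9 := h.le_hi₂
  have h10 := h.width₂
  have h11 := h.ctx.five_le
  have h12 := h.ctx.large
  have hz := h.ctx.hole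
  rw [ne_eq, hz.eq_iff_of_window (by push_cast; omega) (by push_cast; omega),
    hz.adj_iff_of_window (by push_cast; omega) (by push_cast; omega)]
  push_cast
  omega

/-- The inner vertices of the arc from `lo₁` to `hi₂` attach to the even hole only near its vertices
`0` and `m`. If the arc is short, it gives a jewel with the path `P`; otherwise, after trimming at
its ends, it is an ear of forbidden parity. -/
theorem false_of_no_chord (h : IsShortcut G ℓ c C z P m b lo₁ hi₁ lo₂ hi₂) (hb : 2 * b ≤ c)
    (hmid : ∀ i, 1 < i → i + 1 < m → ∀ q, 0 < q → q < b → ¬ G.Adj (P i) (z q)) : False := by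
  obtain ⟨N, E, y, hE, hN, hy, hy0, hy1, hy2, hpar⟩ := h.exists_hole
  have h1 := h.three_le
  have h2 := h.length_le
  have h3 := h.lt_b
  have h4 := h.b_le
  have h5 := h.lo₁_le
  have h6 := h.le_hi₁
  have h7 := h.width₁
  have h8 := h.lo₂_le
  have h9 := h.le_hi₂
  have h10 := h.width₂
  have h11 := h.ctx.five_le
  have h12 := h.ctx.large
  have h13 := h.ctx.odd
  have hz := h.ctx.hole
  have hside := @side _ _ _ _ _ _ _ _ _ _ _ _ _ h N E y hE hN hy hy0 hy1 hy2
  have hEl : ℓ + 2 ≤ E := by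
    by_contra hlt
    refine h.ctx.no_jewel (hy.hasLongJewel_of_offset (t₁ := 0) (t₂ := m) (r := E - 1)
      (fun i => z (lo₁ + (0 + i : ℕ))) (by omega) (by omega) (by omega) (by omega) (by omega)
      (h.hole_path hE (by omega)) ?_ ?_ (by omega) (by omega) (by omega))
    · intro i hi hir
      exact (hside (by omega) (by omega)).1
    · intro i hi hir s hsN hs
      rw [(hside (a := 0 + i) (by omega) (by omega)).2 s hsN]
      omega
  have hinner : ∀ s a : ℕ, 0 < s → s < m → 0 < a → a < E → G.Adj (P s) (z (lo₁ + a)) →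
      (s = 1 ∧ lo₁ + a ≤ hi₁) ∨ (s + 1 = m ∧ lo₂ ≤ lo₁ + a) := by
    intro s a hs hsm ha haE hadj
    have c1 : s = 1 ∨ s + 1 = m ∨ (1 < s ∧ s + 1 < m) := by omega
    rcases c1 with rfl | hm | ⟨c1, c2⟩
    · exact Or.inl ⟨rfl, (h.nbr₁ _ (by omega) (by omega) hadj).2⟩
    · have hm' : s = m - 1 := by omega
      subst hm'
      exact Or.inr ⟨hm, (h.nbr₂ _ (by omega) (by omega) hadj).1⟩
    · exfalso
      by_cases c3 : 0 < lo₁ + a ∧ lo₁ + a < b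
      · exact hmid s c1 c2 _ c3.1 c3.2 hadj
      · exact h.not_adj_middle c1 c2 (by omega) (by omega) (by omega) hadj
  -- The trimming at the first end depends on the width of `[lo₁, hi₁]`. If it is two, the vertex
  -- after `z lo₁` is dropped, and the ear starts at `z hi₁` and attaches at `P 1`. If it is one,
  -- the first vertex of the ear sees both `z lo₁` and `P 1`, which is the flag. If it is zero, the
  -- ear attaches at `z lo₁` only. The other end is treated in the same way.
  obtain ⟨s₁, hs₁, hs₁', hs₁''⟩ : ∃ s : ℕ, s ≤ 1 ∧ hi₁ - lo₁ ≤ 1 + s ∧ 2 * s ≤ hi₁ - lo₁ := by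
    rcases eq_or_lt_of_le h7 with h14 | h14
    · exact ⟨1, by omega, by omega, by omega⟩
    · exact ⟨0, by omega, by omega, by omega⟩
  obtain ⟨s₂, hs₂, hs₂', hs₂''⟩ : ∃ s : ℕ, s ≤ 1 ∧ hi₂ - lo₂ ≤ 1 + s ∧ 2 * s ≤ hi₂ - lo₂ := by
    rcases eq_or_lt_of_le h10 with h14 | h14
    · exact ⟨1, by omega, by omega, by omega⟩
    · exact ⟨0, by omega, by omega, by omega⟩
  obtain ⟨r, hr⟩ : ∃ r, r + s₁ + s₂ + 1 = E := ⟨E - 1 - s₁ - s₂, by omega⟩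
  have ear := isEar_of_offset hy (t₁ := s₁) (t₂ := m - s₂) (r := r)
    (q := fun i => z (lo₁ + (s₁ + i : ℕ))) (α := hi₁ = lo₁ + 1) (β := hi₂ = lo₂ + 1)
    (by omega) (by omega) (h.hole_path hE (by omega))
    (fun i hi hir => (hside (by omega) (by omega)).1) (by
      intro i hi hir s hsN
      rw [(hside (a := s₁ + i) (by omega) (by omega)).2 s hsN]
      constructor
      · rintro (h14 | h14 | ⟨h14, h15, h16⟩)
        · omega
        · omega
        · have := hinner s (s₁ + i) h14 h15 (by omega) (by omega) h16
          push_cast at this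
          rcases this with ⟨h17, h18⟩ | ⟨h17, h18⟩
          · rcases Nat.eq_zero_or_pos s₁ with h19 | h19
            · exact Or.inr (Or.inr (Or.inl ⟨by omega, by omega, by omega⟩))
            · exact Or.inl ⟨by omega, by omega⟩
          · rcases Nat.eq_zero_or_pos s₂ with h19 | h19
            · exact Or.inr (Or.inr (Or.inr ⟨by omega, by omega, by omega⟩))
            · exact Or.inr (Or.inl ⟨by omega, by omega⟩)
      · rintro (⟨h14, h15⟩ | ⟨h14, h15⟩ | ⟨h14, h15, h16⟩ | ⟨h14, h15, h16⟩)
        · rcases Nat.eq_zero_or_pos s₁ with h17 | h17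
          · omega
          · refine Or.inr (Or.inr ⟨by omega, by omega, ?_⟩)
            have : lo₁ + (s₁ + i : ℕ) = hi₁ := by push_cast; omega
            rw [this, show s = 1 by omega]
            exact h.adj_hi₁
        · rcases Nat.eq_zero_or_pos s₂ with h17 | h17
          · omega
          · refine Or.inr (Or.inr ⟨by omega, by omega, ?_⟩)
            have : lo₁ + (s₁ + i : ℕ) = lo₂ := by push_cast; omega
            rw [this, show s = m - 1 by omega]
            exact h.adj_lo₂
        · refine Or.inr (Or.inr ⟨by omega, by omega, ?_⟩)
          have : lo₁ + (s₁ + i : ℕ) = hi₁ := by push_cast; omega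
          rw [this, show s = 1 by omega]
          exact h.adj_hi₁
        · refine Or.inr (Or.inr ⟨by omega, by omega, ?_⟩)
          have : lo₁ + (s₁ + i : ℕ) = lo₂ := by push_cast; omega
          rw [this, show s = m - 1 by omega]
          exact h.adj_lo₂)
  -- With no flag or with two flags the resulting hole has length `m + lo₂ - hi₁`, which is at most
  -- `m + b < 2b ≤ c`.
  refine ear.false_of_parity (hy.shift s₁) h11 h.ctx.minimal h.ctx.no_pyramid (by omega)
    (by omega) (by omega) (by omega) (fun h14 => by omega) (fun h14 => ?_) (by omega) (by omega)
  by_cases h15 : hi₁ = lo₁ + 1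
  · have := h14.1 h15
    omega
  · have : hi₂ = lo₂ + 1 := by
      by_contra h16
      exact h15 (h14.2 h16)
    omega

/-- A chord from the middle of `P` into the shorter side makes both nearly parallel: the induction
hypothesis forces `b = m + 1` and allows `P s` to see only `z s` and `z (s + 1)` among `z 1, …, z
m`. A minimal section of this ladder is an ear of forbidden parity or gives a jewel. -/
theorem false_of_chord (h : IsShortcut G ℓ c C z P m b lo₁ hi₁ lo₂ hi₂)
    (hS : ∀ i ≤ m, ¬ IsMajor G C (P i))
    (ih : ∀ k < m, ∀ i j, Conn G (fun v => ¬ IsMajor G C v) k (z i) (z j) → Near c k i j)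
    {i₀ : ℕ} {a₀ : ℤ} (hi₀ : 1 < i₀) (hi₀m : i₀ + 1 < m) (ha₀ : 0 < a₀) (ha₀b : a₀ < b)
    (hadj₀ : G.Adj (P i₀) (z a₀)) : False := by
  obtain ⟨N, E, y, hE, hN, hy, hy0, hy1, hy2, hpar⟩ := h.exists_hole
  have h1 := h.three_le
  have h2 := h.length_le
  have h3 := h.lt_b
  have h4 := h.b_le
  have h5 := h.lo₁_le
  have h6 := h.le_hi₁
  have h7 := h.width₁
  have h8 := h.lo₂_le
  have h9 := h.le_hi₂
  have h10 := h.width₂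
  have h11 := h.ctx.five_le
  have h12 := h.ctx.large
  have h13 := h.ctx.odd
  have hz := h.ctx.hole
  have hside := @side _ _ _ _ _ _ _ _ _ _ _ _ _ h N E y hE hN hy hy0 hy1 hy2
  have hadj : ∀ i < m, G.Adj (P i) (P (i + 1)) :=
    fun i hi => (h.induced i (i + 1) (by omega) (by omega)).2.2 rfl
  have hz0 : G.Adj (P 1) (z 0) := by
    rw [← h.start]
    exact (hadj 0 (by omega)).symm
  have hzb : G.Adj (P (m - 1)) (z b) := by
    rw [← h.finish]
    have := hadj (m - 1) (by omega)
    rwa [show m - 1 + 1 = m by omega] at this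
  -- The walk from `z u` to `P 1`, along `P` to `P i`, and back into the hole at `z a` has length `i
  -- + 1 < m`, so the induction hypothesis applies.
  have hnear₁ : ∀ i u a, 1 < i → i + 1 < m → G.Adj (P 1) (z u) → G.Adj (P i) (z a) →
      Near c (i + 1) u a := by
    intro i u a hi him hu ha
    refine ih _ (by omega) _ _ ?_
    have := Conn.detour (S := fun v => ¬ IsMajor G C v) hadj hS (i := 1) (j := i) (by omega)
      (by omega) (h.ctx.not_isMajor u) (h.ctx.not_isMajor a) hu ha
    rwa [show i - 1 + 2 = i + 1 by omega] at this
  have hnear₂ : ∀ i u a, 1 < i → i + 1 < m → G.Adj (P (m - 1)) (z u) → G.Adj (P i) (z a) →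
      Near c (m + 1 - i) a u := by
    intro i u a hi him hu ha
    refine ih _ (by omega) _ _ ?_
    have := Conn.detour (S := fun v => ¬ IsMajor G C v) hadj hS (i := i) (j := m - 1) (by omega)
      (by omega) (h.ctx.not_isMajor a) (h.ctx.not_isMajor u) ha hu
    rwa [show m - 1 - i + 2 = m + 1 - i by omega] at this
  -- Through the chord, `hi₂ - lo₁ ≤ (i₀ + 1) + (m + 1 - i₀) = m + 2`. This number has parity
  -- different from that of `m` and is at least `b ≥ m + 1`, so all these quantities equal `m + 1`.
  have hpos : lo₁ = 0 ∧ hi₂ = b ∧ b = m + 1 := by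
    have n1 := hnear₁ i₀ 0 a₀ hi₀ hi₀m hz0 hadj₀
    have n2 := hnear₁ i₀ lo₁ a₀ hi₀ hi₀m h.adj_lo₁ hadj₀
    have n3 := hnear₂ i₀ b a₀ hi₀ hi₀m hzb hadj₀
    have n4 := hnear₂ i₀ hi₂ a₀ hi₀ hi₀m h.adj_hi₂ hadj₀
    rw [near_iff_of_window (by omega) (by omega) (by omega)] at n1 n2 n3 n4
    omega
  obtain ⟨rfl, rfl, rfl⟩ := hpos
  have hEm : E = m + 1 := by omega
  subst hEm
  have hchord : ∀ s a : ℕ, s ≤ m → 1 ≤ a → a ≤ m → G.Adj (P s) (z a) → a = s ∨ a = s + 1 := by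
    intro s a hsm ha ham hsa
    have c1 : s = 0 ∨ s = m ∨ s = 1 ∨ s + 1 = m ∨ (1 < s ∧ s + 1 < m) := by omega
    rcases c1 with rfl | rfl | rfl | c1 | ⟨c1, c2⟩
    · rw [h.start, hz.adj_iff_of_window (by omega) (by omega)] at hsa
      omega
    · rw [h.finish, hz.adj_iff_of_window (by omega) (by omega)] at hsa
      omega
    · have := (h.nbr₁ _ (by omega) (by omega) hsa).2
      omega
    · rw [show s = m - 1 by omega] at hsa
      have := (h.nbr₂ _ (by omega) (by omega) hsa).1
      omega
    · have n1 := hnear₁ s 0 a c1 c2 hz0 hsa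
      have n3 := hnear₂ s _ a c1 c2 hzb hsa
      rw [near_iff_of_window (by omega) (by omega) (by omega)] at n1 n3
      omega
  have hside' : ∀ a : ℕ, 1 ≤ a → a ≤ m → ∀ s : ℕ, s < N →
      (G.Adj (z (0 + a)) (y s) ↔ s ≤ m ∧ G.Adj (P s) (z a)) := by
    intro a ha ham s hsN
    rw [(hside (a := a) (by omega) (by omega)).2 s hsN, zero_add]
    have c1 : s = 0 ∨ s = m ∨ (0 < s ∧ s < m) ∨ m < s := by omega
    rcases c1 with rfl | rfl | ⟨c1, c2⟩ | c1
    · rw [h.start, hz.adj_iff_of_window (by omega) (by omega)]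
      simp only [lt_irrefl, false_and, or_false, true_and]
      omega
    · rw [h.finish, hz.adj_iff_of_window (by omega) (by omega)]
      simp only [lt_irrefl, false_and, and_false, or_false, true_and]
      omega
    · constructor
      · rintro (h14 | h14 | h14)
        · omega
        · omega
        · exact ⟨by omega, h14.2.2⟩
      · exact fun h14 => Or.inr (Or.inr ⟨c1, c2, h14.2⟩)
    · constructor
      · rintro (h14 | h14 | h14) <;> omega
      · rintro ⟨h14, -⟩
        omega
  -- A section of length `d` starts with an edge from `P t` to `z (t + 1)` and ends with an edge
  -- from `P (t + d)` to `z (t + d)`. The sides `P t, …, P (t + d)` and `P t, z (t + 1), …, z (t +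
  -- d), P (t + d)` have lengths `d` and `d + 1`. The whole of `P` is a section with `d = m`; in a
  -- minimal one, the only other edges between the sides are those recorded by the two flags.
  let p : ℕ → Prop := fun d => 2 ≤ d ∧ ∃ t : ℕ, t + d ≤ m ∧ G.Adj (P t) (z (t + 1 : ℕ)) ∧
    G.Adj (P (t + d)) (z (t + d : ℕ))
  have hp : ∃ d, p d := by
    refine ⟨m, by omega, 0, by omega, ?_, ?_⟩
    · rw [h.start]
      exact hz.adj_succ 0
    · rw [zero_add, h.finish]
      exact (hz.adj_succ m).symm
  obtain ⟨d, ⟨hd2, t, htd, hA, hB⟩, hmin⟩ : ∃ d, p d ∧ ∀ d' < d, ¬ p d' := by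
    classical
    exact ⟨Nat.find hp, Nat.find_spec hp, fun d' hd' => Nat.find_min hp hd'⟩
  rcases Nat.lt_or_ge ℓ d with hdl | hdl
  · have ear := isEar_of_offset hy (t₁ := t) (t₂ := t + d) (r := d)
      (q := fun i => z (0 + (t + i : ℕ))) (α := G.Adj (P (t + 1)) (z (t + 1 : ℕ)))
      (β := G.Adj (P (t + d - 1)) (z (t + d : ℕ)))
      (by omega) (by omega) (h.hole_path hE (by omega))
      (fun i hi hir => (hside (by omega) (by omega)).1) (by
        intro i hi hir s hsN
        rw [hside' (t + i) (by omega) (by omega) s hsN]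
        constructor
        · rintro ⟨h14, h15⟩
          rcases hchord s (t + i) h14 (by omega) (by omega) h15 with h16 | h16
          · rcases eq_or_ne i d with rfl | h17
            · exact Or.inr (Or.inl ⟨rfl, h16.symm⟩)
            · rcases eq_or_ne i 1 with rfl | h18
              · subst h16
                exact Or.inr (Or.inr (Or.inl ⟨rfl, rfl, h15⟩))
              · subst h16
                exact absurd ⟨by omega, t, by omega, hA, h15⟩ (hmin i (by omega))
          · rcases eq_or_ne i 1 with rfl | h17
            · exact Or.inl ⟨rfl, by omega⟩
            · rcases eq_or_ne i d with rfl | h18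
              · refine Or.inr (Or.inr (Or.inr ⟨rfl, by omega, ?_⟩))
                rwa [show t + i - 1 = s by omega]
              · refine absurd ⟨by omega, s, ?_, ?_, ?_⟩ (hmin (t + d - s) (by omega))
                · omega
                · rwa [← h16]
                · rwa [show s + (t + d - s) = t + d by omega]
        · rintro (⟨rfl, rfl⟩ | ⟨rfl, rfl⟩ | ⟨rfl, rfl, h16⟩ | ⟨rfl, h15, h16⟩)
          · exact ⟨by omega, hA⟩
          · exact ⟨by omega, hB⟩
          · exact ⟨by omega, h16⟩
          · rw [show s = t + i - 1 by omega]
            exact ⟨by omega, h16⟩)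
    exact ear.false_of_parity (hy.shift t) h11 h.ctx.minimal h.ctx.no_pyramid (by omega)
      (by omega) (by omega) (by omega) (fun _ => by omega) (fun _ => by omega)
      (fun _ _ => by omega) (fun _ _ => by omega)
  · refine h.ctx.no_jewel (hy.hasLongJewel_of_offset (t₁ := t) (t₂ := t + d) (r := d)
      (fun i => z (0 + (t + i : ℕ))) (by omega) (by omega) (by omega) (by omega) (by omega)
      (h.hole_path hE (by omega)) ?_ ?_ (by omega) (by omega) (by omega))
    · intro i hi hir
      exact (hside (by omega) (by omega)).1
    · intro i hi hir s hsN hs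
      rw [hside' (t + i) (by omega) (by omega) s hsN]
      constructor
      · rintro ⟨h14, h15⟩
        have := hchord s (t + i) h14 (by omega) (by omega) h15
        omega
      · rintro (⟨rfl, rfl⟩ | ⟨rfl, rfl⟩)
        · exact ⟨by omega, hA⟩
        · exact ⟨by omega, hB⟩

end IsShortcut

end LongOddHole

/-! ### Walks of non-major vertices against distances in the hole. -/

namespace LongOddHole

variable {V : Type*} {G : SimpleGraph V}

namespace IsShortestSeq

variable {ℓ c m : ℕ} {C : Set V} {z : ℤ → V} {P : ℕ → V} {b : ℤ}

theorem false_of_oriented_shortcut (h : IsShortestSeq G ℓ c C z)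
    (ih : ∀ k < m, ∀ i j, Conn G (fun v => ¬ IsMajor G C v) k (z i) (z j) → Near c k i j)
    (hS : ∀ i ≤ m, ¬ IsMajor G C (P i)) (start : P 0 = z 0) (finish : P m = z b)
    (induced : IsInducedSeq G P m) (not_mem : ∀ i, 0 < i → i < m → ∀ q, P i ≠ z q) (hm : 3 ≤ m)
    (hmc : 2 * m + 3 ≤ c) (hmb : (m : ℤ) < b) (hb : 2 * b ≤ c + 1)
    (middle : ∀ i, 1 < i → i + 1 < m → ∀ q, b < q → q < c → ¬ G.Adj (P i) (z q))
    (hopt : 2 * b ≤ c ∨ ∃ i a, 1 < i ∧ i + 1 < m ∧ 0 < a ∧ a < b ∧ G.Adj (P i) (z a)) :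
    False := by
  have hadj : ∀ i < m, G.Adj (P i) (P (i + 1)) :=
    fun i hi => (induced i (i + 1) (by omega) (by omega)).2.2 rfl
  have hz0 : G.Adj (P 1) (z 0) := by
    rw [← start]
    exact (hadj 0 (by omega)).symm
  have hzb : G.Adj (P (m - 1)) (z b) := by
    rw [← finish]
    have := hadj (m - 1) (by omega)
    rwa [show m - 1 + 1 = m by omega] at this
  have hS' : ∀ i ≤ m, ¬ IsMajor G (Set.range z) (P i) := by
    rw [h.range_eq]
    exact hS
  obtain ⟨lo₁, hi₁, l1, l2, l3, l4, l5, l6⟩ := h.hole.exists_interval (hS' 1 (by omega)) hz0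
  obtain ⟨lo₂, hi₂, u1, u2, u3, u4, u5, u6⟩ :=
    h.hole.exists_interval (hS' (m - 1) (by omega)) hzb
  have hs : IsShortcut G ℓ c C z P m b lo₁ hi₁ lo₂ hi₂ :=
    ⟨h, start, finish, induced, not_mem, hm, hmc, hmb, hb, middle, l1, l2, l3, l4, l5, l6,
      u1, u2, u3, u4, u5, u6⟩
  by_cases hch : ∃ i a, 1 < i ∧ i + 1 < m ∧ 0 < a ∧ a < b ∧ G.Adj (P i) (z a)
  · obtain ⟨i, a, h1, h2, h3, h4, h5⟩ := hch
    exact hs.false_of_chord hS ih h1 h2 h3 h4 h5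
  · refine hs.false_of_no_chord (hopt.resolve_right hch) ?_
    intro i h1 h2 q h3 h4 h5
    exact hch ⟨i, q, h1, h2, h3, h4, h5⟩

/-- All structure of the shortcut comes from the minimality of `m`: a repetition, a chord or an
inner vertex in the hole would give shorter walks, to which the induction hypothesis applies. It
also excludes middle vertices with neighbours on both open sides, so after a reflection the
neighbours lie on the side from `0` to `b`. -/
theorem false_of_shortcut (h : IsShortestSeq G ℓ c C z)
    (ih : ∀ k < m, ∀ i j, Conn G (fun v => ¬ IsMajor G C v) k (z i) (z j) → Near c k i j)
    (hmc : 2 * m + 3 ≤ c) (hmb : (m : ℤ) < b) (hbm : b < c - m)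
    (hconn : Conn G (fun v => ¬ IsMajor G C v) m (z 0) (z b)) : False := by
  obtain ⟨P, start, finish, hadj, hS⟩ := hconn
  have hz := h.hole
  have hc := h.large
  have hℓ := h.five_le
  have hodd := h.odd
  have hfar : ∀ k < m, ¬ Conn G (fun v => ¬ IsMajor G C v) k (z 0) (z b) := by
    intro k hk hkc
    have := ih k hk 0 b hkc
    rw [near_iff_of_window (by omega) (by omega) (by omega)] at this
    omega
  have hfrom : ∀ i ≤ m, Conn G (fun v => ¬ IsMajor G C v) i (z 0) (P i) := by
    intro i hi
    have := Conn.of_seq (S := fun v => ¬ IsMajor G C v) hadj hS (Nat.zero_le i) hi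
    rwa [start] at this
  have hto : ∀ i ≤ m, Conn G (fun v => ¬ IsMajor G C v) (m - i) (P i) (z b) := by
    intro i hi
    have := Conn.of_seq (S := fun v => ¬ IsMajor G C v) hadj hS hi le_rfl
    rwa [finish] at this
  have hm : 3 ≤ m := by
    by_contra hlt
    have : m = 0 ∨ m = 1 ∨ m = 2 := by omega
    rcases this with rfl | rfl | rfl
    · rw [start, hz.eq_iff_of_window (by omega) (by omega)] at finish
      omega
    · have := hadj 0 (by omega)
      rw [start, zero_add, finish, hz.adj_iff_of_window (by omega) (by omega)] at this
      omega
    · have h1 := (hadj 0 (by omega)).symm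
      rw [start] at h1
      have h2 := hadj 1 (by omega)
      rw [finish] at h2
      have hS1 := hS 1 (by omega)
      rw [← h.range_eq] at hS1
      obtain ⟨lo, hi, h3, h4, h5, -, -, h6⟩ := hz.exists_interval hS1 h1
      have := h6 b (by omega) (by omega) h2
      omega
  have induced : IsInducedSeq G P m := by
    intro i j hij hj
    refine ⟨fun e => ?_, fun e => ?_, fun e => ?_⟩
    · have h1 := hfrom i (by omega)
      rw [e] at h1
      exact hfar _ (by omega) (h1.append (hto j hj))
    · by_contra hne
      exact hfar _ (by omega)
        (((hfrom i (by omega)).append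
          (Conn.single (hS i (by omega)) (hS j hj) e)).append (hto j hj))
    · rw [e]
      exact hadj i (by omega)
  have not_mem : ∀ i, 0 < i → i < m → ∀ q, P i ≠ z q := by
    intro i hi him q e
    have h1 := hfrom i (by omega)
    have h2 := hto i (by omega)
    rw [e] at h1 h2
    have h3 := (ih _ him _ _ h1).trans (ih _ (by omega) _ _ h2)
    rw [near_iff_of_window (by omega) (by omega) (by omega)] at h3
    omega
  have hz0 : G.Adj (P 1) (z 0) := by
    rw [← start]
    exact (hadj 0 (by omega)).symm
  have hzb : G.Adj (P (m - 1)) (z b) := by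
    rw [← finish]
    have := hadj (m - 1) (by omega)
    rwa [show m - 1 + 1 = m by omega] at this
  -- For a neighbour on the side from `0` to `b` the two bounds add up to `b ≤ m + 2`, so `2b ≤ 2m +
  -- 4 ≤ c + 1`; this is why the oriented version allows `2b ≤ c + 1`.
  have hnear : ∀ (i : ℕ) (q : ℤ), 1 < i → i + 1 < m → 0 < q → q < c → G.Adj (P i) (z q) →
      (q ≤ i + 1 ∨ c - i - 1 ≤ q) ∧ ((b - q ≤ m + 1 - i ∧ q - b ≤ m + 1 - i) ∨
        c + i - m - 1 ≤ b - q ∨ c + i - m - 1 ≤ q - b) := by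
    intro i q hi him hq hqc hadj'
    have h1 := Conn.detour (S := fun v => ¬ IsMajor G C v) hadj hS (i := 1) (j := i) (by omega)
      (by omega) (h.not_isMajor 0) (h.not_isMajor q) hz0 hadj'
    have h2 := Conn.detour (S := fun v => ¬ IsMajor G C v) hadj hS (i := i) (j := m - 1) (by omega)
      (by omega) (h.not_isMajor q) (h.not_isMajor b) hadj' hzb
    have n1 := ih _ (by omega) _ _ h1
    have n2 := ih _ (by omega) _ _ h2
    rw [near_iff_of_window (by omega) (by omega) (by omega)] at n1 n2
    omega
  have hside : ∀ (i : ℕ) (q : ℤ) (i' : ℕ) (q' : ℤ), 1 < i → i + 1 < m → 0 < q → q < b →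
      G.Adj (P i) (z q) →
      1 < i' → i' + 1 < m → b < q' → q' < c → G.Adj (P i') (z q') → False := by
    intro i q i' q' h1 h2 h3 h4 h5 h1' h2' h3' h4' h5'
    have n := hnear i q h1 h2 h3 (by omega) h5
    have n' := hnear i' q' h1' h2' (by omega) h4' h5'
    rcases le_total i i' with hii | hii
    · have h6 := Conn.detour (S := fun v => ¬ IsMajor G C v) hadj hS hii (by omega)
        (h.not_isMajor q) (h.not_isMajor q') h5 h5'
      have n3 := ih _ (by omega) _ _ h6
      rw [near_iff_of_window (by omega) (by omega) (by omega)] at n3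
      omega
    · have h6 := Conn.detour (S := fun v => ¬ IsMajor G C v) hadj hS hii (by omega)
        (h.not_isMajor q') (h.not_isMajor q) h5' h5
      have n3 := ih _ (by omega) _ _ h6
      rw [near_iff_of_window (by omega) (by omega) (by omega)] at n3
      omega
  have direct : (∀ i, 1 < i → i + 1 < m → ∀ q, b < q → q < c → ¬ G.Adj (P i) (z q)) →
      (2 * b ≤ c ∨ ∃ i a, 1 < i ∧ i + 1 < m ∧ 0 < a ∧ a < b ∧ G.Adj (P i) (z a)) → False := by
    intro hmid hopt
    refine h.false_of_oriented_shortcut ih hS start finish induced not_mem hm hmc hmb ?_ hmid hopt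
    rcases hopt with hopt | ⟨i, a, h1, h2, h3, h4, h5⟩
    · omega
    · have := hnear i a h1 h2 h3 (by omega) h5
      omega
  have mirror : (∀ i, 1 < i → i + 1 < m → ∀ q, 0 < q → q < b → ¬ G.Adj (P i) (z q)) →
      (c ≤ 2 * b ∨ ∃ i a, 1 < i ∧ i + 1 < m ∧ b < a ∧ a < c ∧ G.Adj (P i) (z a)) → False := by
    intro hmid hopt
    refine h.reflect.false_of_oriented_shortcut (P := P) (m := m) (b := c - b) ?_ hS ?_ ?_ induced
      (fun i h1 h2 q => not_mem i h1 h2 _) hm hmc (by omega) ?_ ?_ ?_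
    · intro k hk i j hij
      obtain ⟨δ, h1, h2, h3⟩ := ih k hk _ _ hij
      refine ⟨-δ, by omega, by omega, ?_⟩
      rw [← dvd_neg]
      ring_nf at h3 ⊢
      exact h3
    · simpa using start
    · rw [finish, ← hz.sub_period]
      congr 1
      omega
    · rcases hopt with hopt | ⟨i, a, h1, h2, h3, h4, h5⟩
      · omega
      · have := hnear i a h1 h2 (by omega) h4 h5
        omega
    · intro i h1 h2 q h3 h4 h5
      rw [← hz.add_period] at h5
      exact hmid i h1 h2 _ (by omega) (by omega) h5
    · rcases hopt with hopt | ⟨i, a, h1, h2, h3, h4, h5⟩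
      · left
        omega
      · refine Or.inr ⟨i, c - a, h1, h2, by omega, by omega, ?_⟩
        rwa [show -((c : ℤ) - a) = a - c by omega, hz.sub_period]
  by_cases hA : ∃ i a, 1 < i ∧ i + 1 < m ∧ 0 < a ∧ a < b ∧ G.Adj (P i) (z a)
  · refine direct ?_ (Or.inr hA)
    obtain ⟨i, a, h1, h2, h3, h4, h5⟩ := hA
    exact fun i' h1' h2' q' h3' h4' h5' => hside i a i' q' h1 h2 h3 h4 h5 h1' h2' h3' h4' h5'
  · have hA' : ∀ i, 1 < i → i + 1 < m → ∀ q, 0 < q → q < b → ¬ G.Adj (P i) (z q) :=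
      fun i h1 h2 q h3 h4 h5 => hA ⟨i, q, h1, h2, h3, h4, h5⟩
    by_cases hB : ∃ i a, 1 < i ∧ i + 1 < m ∧ b < a ∧ a < c ∧ G.Adj (P i) (z a)
    · exact mirror hA' (Or.inr hB)
    · rcases le_total (2 * b) c with h1 | h1
      · exact direct (fun i h1 h2 q h3 h4 h5 => hB ⟨i, q, h1, h2, h3, h4, h5⟩) (Or.inl h1)
      · exact mirror hA' (Or.inl h1)

/-- Walks without major vertices, of less than half the length of the hole, are not shorter than
the distance in the hole. -/
theorem near_of_conn (h : IsShortestSeq G ℓ c C z) (hmc : 2 * m + 3 ≤ c) {i j : ℤ}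
    (hconn : Conn G (fun v => ¬ IsMajor G C v) m (z i) (z j)) : Near c m i j := by
  induction m using Nat.strong_induction_on generalizing i j with
  | _ m ih =>
    by_contra hn
    obtain ⟨j', h1, h2, h3⟩ := h.hole.exists_mem_window i j
    rw [← h3] at hconn
    have hn' : ¬ Near c m i j' := by
      intro hnear
      refine hn (hnear.trans (k := m) (l := 0) ⟨0, by simp, by simp, ?_⟩)
      rw [sub_zero]
      exact (h.hole.eq_iff _ _).1 h3
    rw [near_iff_of_window (by omega) (by omega) (by omega)] at hn'
    -- After replacing `j` by its representative in the period that starts at `i`, and shifting `i`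
    -- to `0`, failure of nearness says exactly that `m < b < c - m`.
    refine (h.shift i).false_of_shortcut (m := m) (b := j' - i) ?_ hmc (by omega) (by omega) ?_
    · intro k hk a b hab
      obtain ⟨δ, h4, h5, h6⟩ := ih k hk (by omega) hab
      refine ⟨δ, h4, h5, ?_⟩
      ring_nf at h6 ⊢
      exact h6
    · simpa using hconn

/-- A shortest path without major vertices between two vertices of the hole has no neighbours on
the longer side of the hole. -/
theorem avoids_of_conn (h : IsShortestSeq G ℓ c C z) {d : ℕ} (hd : 2 * d + 3 ≤ c)
    (hadj : ∀ i < d, G.Adj (P i) (P (i + 1))) (hS : ∀ i ≤ d, ¬ IsMajor G C (P i)) {a : ℤ}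
    (start : P 0 = z a) (finish : P d = z (a + d)) {i : ℕ} (hi : 0 < i) (hid : i < d) {q : ℤ}
    (hq : a + d < q) (hqc : q < a + c) : P i ≠ z q ∧ ¬ G.Adj (P i) (z q) := by
  have h1 := Conn.of_seq (S := fun v => ¬ IsMajor G C v) hadj hS (Nat.zero_le i) hid.le
  have h2 := Conn.of_seq (S := fun v => ¬ IsMajor G C v) hadj hS hid.le le_rfl
  rw [start] at h1
  rw [finish] at h2
  constructor
  · intro e
    rw [e] at h1 h2
    have n1 := h.near_of_conn (by omega) h1
    have n2 := h.near_of_conn (by omega) h2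
    rw [near_iff_of_window (by omega) (by omega) (by omega)] at n1 n2
    omega
  -- An edge to `z q` gives walks to `z q` of lengths `i + 1` from one end and `d - i + 1` from the
  -- other, together `d + 2`. The way around the longer side has length `c - d ≥ d + 3`.
  · intro e
    have h3 := Conn.single (S := fun v => ¬ IsMajor G C v) (hS i hid.le) (h.not_isMajor q) e
    have n1 := h.near_of_conn (by omega) (h1.append h3)
    have n2 := h.near_of_conn (by omega) (h3.symm.append h2)
    rw [near_iff_of_window (by omega) (by omega) (by omega)] at n1 n2
    omega

end IsShortestSeq

end LongOddHole

/-! ### What a remote base says about major vertices. -/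

namespace LongOddHole

variable {V : Type*} {G : SimpleGraph V}

theorem HoleSeq.eq_of_adj {c : ℕ} {z : ℤ → V} (hz : HoleSeq G c z) {t q : ℤ}
    (h : G.Adj (z t) (z q)) : z q = z (t - 1) ∨ z q = z (t + 1) := by
  rcases (hz.adj_iff t q).1 h with h | h
  · right
    rw [hz.eq_iff, ← dvd_neg]
    ring_nf at h ⊢
    exact h
  · left
    rw [hz.eq_iff, ← dvd_neg]
    ring_nf at h ⊢
    exact h

/-- The consequences of the existence of a remote base: `z 0, …, z g` is the path of the base. -/
structure RemoteConfig (G : SimpleGraph V) (ℓ c : ℕ) (C : Set V) (z : ℤ → V) (g : ℕ) (x : V) :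
    Prop where
  ctx : IsShortestSeq G ℓ c C z
  long : 2 * ℓ ≤ g
  short : g + 3 ≤ c
  not_mem : x ∉ C
  not_adj : ∀ i : ℤ, 0 < i → i < g → ¬ G.Adj x (z i)
  major : ∀ y, IsMajor G C y → y = x ∨ (G.Adj x y ∧ ∃ i : ℕ, 0 < i ∧ i < g ∧ G.Adj y (z i))

/-- A path of the hole of positive length can be followed along a sequence around the hole. -/
theorem IsShortestSeq.exists_along {ℓ c : ℕ} {C : Set V} {z : ℤ → V}
    (h : IsShortestSeq G ℓ c C z) {d₁ d₂ : V} {D : G.Walk d₁ d₂} (hD : IsPathOf C D)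
    (hlen : 1 ≤ D.length) :
    ∃ z' : ℤ → V, IsShortestSeq G ℓ c C z' ∧ ∀ i : ℕ, i ≤ D.length → D.getVert i = z' i := by
  have hmem : ∀ i, ∃ s : ℤ, z s = D.getVert i := by
    intro i
    have := hD.2 _ (D.getVert_mem_support i)
    rwa [← h.range_eq] at this
  obtain ⟨z', h', h0, h1⟩ : ∃ z' : ℤ → V, IsShortestSeq G ℓ c C z' ∧ D.getVert 0 = z' 0 ∧
      D.getVert 1 = z' 1 := by
    obtain ⟨s, hs⟩ := hmem 0
    obtain ⟨t, ht⟩ := hmem 1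
    have hadj := D.adj_getVert_succ (i := 0) (by omega)
    rw [zero_add, ← hs, ← ht] at hadj
    rcases h.hole.eq_of_adj hadj with e | e
    · refine ⟨_, h.reflect.shift (-s), by simp [← hs], ?_⟩
      rw [← ht, e]
      congr 1
      ring
    · refine ⟨_, h.shift s, by simp [← hs], ?_⟩
      rw [← ht, e]
      congr 1
      ring
  refine ⟨z', h', ?_⟩
  have key : ∀ i : ℕ, i + 1 ≤ D.length → D.getVert i = z' i ∧ D.getVert (i + 1) = z' (i + 1) := by
    intro i
    induction i with
    | zero => exact fun _ => ⟨by simpa using h0, by simpa using h1⟩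
    | succ i ih =>
      intro hi
      obtain ⟨e1, e2⟩ := ih (by omega)
      refine ⟨by simpa using e2, ?_⟩
      have hadj := D.adj_getVert_succ (i := i + 1) (by omega)
      obtain ⟨t, ht⟩ : ∃ t, z' t = D.getVert (i + 1 + 1) := by
        have := hD.2 _ (D.getVert_mem_support (i + 1 + 1))
        rwa [← h'.range_eq] at this
      rw [e2, ← ht] at hadj
      -- The path cannot turn back, because its vertices are distinct.
      rcases h'.hole.eq_of_adj hadj with e | e
      · rw [ht, show ((i : ℤ) + 1 - 1) = i by ring, ← e1] at e
        have := hD.1.getVert_injOn (by simp; omega) (by simp; omega) e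
        omega
      · rw [← ht, e]
        push_cast
        rfl
  intro i hi
  rcases Nat.eq_zero_or_pos i with rfl | hpos
  · simpa using h0
  · have := (key (i - 1) (by omega)).2
    rw [show i - 1 + 1 = i by omega] at this
    rw [this]
    congr 1
    omega

/-- A major vertex has two neighbours in the hole. -/
theorem IsShortestSeq.exists_two_nbrs {ℓ c : ℕ} {C : Set V} {z : ℤ → V}
    (h : IsShortestSeq G ℓ c C z) {y : V} (hy : IsMajor G C y) {a : ℤ} :
    ∃ p q : ℤ, a ≤ q ∧ q < p ∧ p < a + c ∧ G.Adj y (z p) ∧ G.Adj y (z q) ∧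
      ∀ t, a ≤ t → t < a + c → G.Adj y (z t) → q ≤ t ∧ t ≤ p := by
  classical
  have hc := h.large
  rw [← h.range_eq] at hy
  have hex : ∃ t : ℕ, t < c ∧ G.Adj y (z (a + t)) := by
    by_contra hno
    push Not at hno
    refine h.hole.not_isMajor_of_forall a (fun q hq => ?_) hy
    obtain ⟨j, h1, h2, h3⟩ := h.hole.exists_mem_window a q
    refine absurd ?_ (hno (j - a).toNat (by omega))
    rwa [show a + ((j - a).toNat : ℕ) = j by omega, h3]
  have hex' : ∃ t : ℕ, t < c ∧ G.Adj y (z (a + c - 1 - t)) := by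
    obtain ⟨t, h1, h2⟩ := hex
    refine ⟨c - 1 - t, by omega, ?_⟩
    rwa [show a + c - 1 - ((c - 1 - t : ℕ) : ℤ) = a + t by omega]
  obtain ⟨q, ⟨hq1, hq2⟩, hq3⟩ : ∃ q : ℕ, (q < c ∧ G.Adj y (z (a + q))) ∧
      ∀ t < q, ¬ (t < c ∧ G.Adj y (z (a + t))) :=
    ⟨Nat.find hex, Nat.find_spec hex, fun t ht => Nat.find_min hex ht⟩
  obtain ⟨p, ⟨hp1, hp2⟩, hp3⟩ : ∃ p : ℕ, (p < c ∧ G.Adj y (z (a + c - 1 - p))) ∧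
      ∀ t < p, ¬ (t < c ∧ G.Adj y (z (a + c - 1 - t))) :=
    ⟨Nat.find hex', Nat.find_spec hex', fun t ht => Nat.find_min hex' ht⟩
  have hbd : ∀ t, a ≤ t → t < a + c → G.Adj y (z t) → a + q ≤ t ∧ t ≤ a + c - 1 - p := by
    intro t h1 h2 h3
    constructor
    · by_contra hlt
      refine hq3 (t - a).toNat (by omega) ⟨by omega, ?_⟩
      rwa [show a + ((t - a).toNat : ℕ) = t by omega]
    · by_contra hlt
      refine hp3 (a + c - 1 - t).toNat (by omega) ⟨by omega, ?_⟩
      rwa [show a + c - 1 - ((a + c - 1 - t).toNat : ℕ) = t by omega]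
  refine ⟨a + c - 1 - p, a + q, by omega, ?_, by omega, hp2, hq2, hbd⟩
  have h5 := hbd _ (by omega) (by omega) hq2
  by_contra hlt
  refine h.hole.not_isMajor_of_forall (a + q) (fun t ht => ?_) hy
  obtain ⟨j, h1, h2, h3⟩ := h.hole.exists_mem_window a t
  rw [← h3] at ht ⊢
  have := hbd j h1 h2 ht
  right; left
  congr 1
  omega

/-- Let `y` be a major vertex other than `x` with no neighbour in the interior of `D`. By remoteness
it is not adjacent to the ends either, so `D` lies strictly inside a gap of `y`, contrary to the
maximality of `D`. -/
theorem IsRemoteBase.exists_config {ℓ c : ℕ} {C : Set V} {z : ℤ → V}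
    (h : IsShortestSeq G ℓ c C z) {x d₁ d₂ : V} {D : G.Walk d₁ d₂}
    (hB : IsRemoteBase ℓ C x D) (hadj : ∀ y, IsMajor G C y → y = x ∨ G.Adj y x) :
    ∃ z', RemoteConfig G ℓ c C z' D.length x ∧ d₁ = z' 0 ∧ d₂ = z' D.length := by
  obtain ⟨⟨⟨hx, hDC, hx1, hx2, hxint⟩, hmax⟩, hlen, hrem⟩ := hB
  have hℓ := h.five_le
  obtain ⟨z, h, hz⟩ := h.exists_along hDC (by omega)
  have hd1 : d₁ = z 0 := by simpa using hz 0 (by omega)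
  have hd2 : d₂ = z D.length := by simpa using hz D.length le_rfl
  have hinj := hDC.1.getVert_injOn
  have hlt : D.length < c := by
    by_contra hge
    have h1 := hz c (by omega)
    have h2 := h.hole.add_period 0
    rw [zero_add] at h2
    rw [h2, ← hd1] at h1
    have := @hinj c (by simp; omega) 0 (by simp) (by simpa using h1)
    have := h.large
    omega
  have hxint' : ∀ i : ℤ, 0 < i → i < D.length → ¬ G.Adj x (z i) := by
    intro i h1 h2
    have h3 := hz i.toNat (by omega)
    rw [show ((i.toNat : ℕ) : ℤ) = i by omega] at h3
    refine hxint _ ⟨h3 ▸ D.getVert_mem_support _, ?_, ?_⟩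
    · rw [hd1, ne_eq, h.hole.eq_iff_of_window (by omega) (by omega)]
      omega
    · rw [hd2, ne_eq, h.hole.eq_iff_of_window (by omega) (by omega)]
      omega
  refine ⟨z, ⟨h, hlen, ?_, hx.1, hxint', ?_⟩, hd1, hd2⟩
  -- Otherwise at most three consecutive vertices of the hole lie outside the interior of `D`; they
  -- contain all neighbours of `x`, which then is not major.
  · by_contra hge
    have hx' := hx
    rw [← h.range_eq] at hx'
    refine h.hole.not_isMajor_of_forall (D.length - c + 1) (fun t ht => ?_) hx'
    obtain ⟨j, h6, h7, h8⟩ := h.hole.exists_mem_window (D.length - c) t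
    rw [← h8] at ht ⊢
    have : ¬ (0 < j ∧ j < D.length) := fun h9 => hxint' j h9.1 h9.2 ht
    have : j = D.length - c + 1 - 1 ∨ j = D.length - c + 1 ∨ j = D.length - c + 1 + 1 := by omega
    rcases this with rfl | rfl | rfl <;> simp
  · intro y hy
    rcases hadj y hy with hyx | hyx
    · exact Or.inl hyx
    · refine Or.inr ⟨hyx.symm, ?_⟩
      have hne : y ≠ x := fun e => by
        subst e
        exact G.loopless.irrefl _ hyx
      by_contra hno
      push Not at hno
      -- An end of `D` has distance zero from itself, which is less than `ℓ`.
      have hy0 : ∀ d, d = d₁ ∨ d = d₂ → d ∈ C → ¬ G.Adj y d := by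
        intro d hd hdC hyd
        have := hrem y hy hne ⟨d, hdC⟩ ⟨d, hdC⟩ hyd hd
        rw [SimpleGraph.dist_self] at this
        omega
      have hC : ∀ i, z i ∈ C := fun i => by
        rw [← h.range_eq]
        exact ⟨i, rfl⟩
      have hnear : ∀ t : ℤ, 0 ≤ t → t ≤ D.length → ¬ G.Adj y (z t) := by
        intro t h1 h2
        rcases eq_or_lt_of_le h1 with rfl | h3
        · exact hy0 _ (Or.inl hd1.symm) (hC _)
        · rcases eq_or_lt_of_le h2 with rfl | h4
          · exact hy0 _ (Or.inr hd2.symm) (hC _)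
          · have := hno t.toNat (by omega) (by omega)
            rwa [show ((t.toNat : ℕ) : ℤ) = t by omega] at this
      obtain ⟨p, q, h1, h2, h3, h4, h5, h6⟩ := h.exists_two_nbrs hy (a := 0)
      have hqD : (D.length : ℤ) < q := by
        by_contra hle
        exact hnear q h1 (by omega) h5
      -- With `q` and `p` the first and last neighbours of `y` in the period from `0`, the larger
      -- gap runs from `z (p - c) = z p` through `z 0, …, z D.length` to `z q`.
      obtain ⟨K, hK⟩ : ∃ K : ℕ, (K : ℤ) = q - p + c := ⟨(q - p + c).toNat, by omega⟩
      obtain ⟨W, hWl, hW⟩ := exists_walk_of_seq (G := G) (fun i : ℕ => z (p - c + i)) K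
        (fun i _ => by
          have := h.hole.adj_succ (p - c + i)
          push_cast
          rwa [← add_assoc])
      have hsupp : ∀ w, w ∈ W.support ↔ ∃ i ≤ K, w = z (p - c + i) := by
        intro w
        rw [SimpleGraph.Walk.mem_support_iff_exists_getVert]
        constructor
        · rintro ⟨i, rfl, hi⟩
          exact ⟨i, by omega, hW i (by omega)⟩
        · rintro ⟨i, hi, rfl⟩
          exact ⟨i, hW i hi, by omega⟩
      have hgap : IsGapOf C y W := by
        refine ⟨hy, ⟨?_, ?_⟩, ?_, ?_, ?_⟩
        · rw [← SimpleGraph.Walk.IsPath.getVert_injOn_iff]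
          intro i hi j hj hij
          have hi' : i ≤ K := hWl ▸ hi
          have hj' : j ≤ K := hWl ▸ hj
          rw [hW i hi', hW j hj', h.hole.eq_iff_of_window (by omega) (by omega)] at hij
          omega
        · intro w hw
          obtain ⟨i, -, rfl⟩ := (hsupp w).1 hw
          exact hC _
        · have := h.hole.sub_period p
          simp only [Nat.cast_zero, add_zero]
          rwa [this]
        · rwa [show p - c + K = q by omega]
        · rintro w ⟨hw1, hw2, hw3⟩ hyw
          obtain ⟨i, hi, rfl⟩ := (hsupp w).1 hw1
          have hi0 : i ≠ 0 := fun e => hw2 (by rw [e])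
          have hiK : i ≠ K := fun e => hw3 (by rw [e])
          rcases lt_or_ge (p - c + i) 0 with h7 | h7
          · rw [← h.hole.add_period] at hyw
            have := (h6 _ (by omega) (by omega) hyw).2
            omega
          · have := (h6 _ h7 (by omega) hyw).1
            omega
      have hle : D.toSubgraph ≤ W.toSubgraph := by
        constructor
        · intro w hw
          rw [SimpleGraph.Walk.mem_verts_toSubgraph,
            SimpleGraph.Walk.mem_support_iff_exists_getVert] at hw
          obtain ⟨i, rfl, hi⟩ := hw
          rw [SimpleGraph.Walk.mem_verts_toSubgraph, hsupp, hz i hi]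
          refine ⟨(i + c - p).toNat, by omega, ?_⟩
          congr 1
          omega
        · intro u w huw
          rw [← SimpleGraph.Subgraph.mem_edgeSet, SimpleGraph.Walk.mem_edges_toSubgraph,
            SimpleGraph.Walk.mk_mem_edges_iff_exists] at huw ⊢
          obtain ⟨i, hi, hiu⟩ := huw
          refine ⟨(i + c - p).toNat, by omega, ?_⟩
          rw [← hiu, hW _ (by omega), hW _ (by omega), hz i (by omega), hz (i + 1) (by omega)]
          congr 3
          · omega
          · omega
      -- Maximality would identify the two paths, but `z q` lies beyond the end of `D`.
      have heq := hmax y _ _ W hgap hle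
      have hqW : z q ∈ W.toSubgraph.verts := by
        rw [SimpleGraph.Walk.mem_verts_toSubgraph, hsupp]
        exact ⟨K, le_rfl, by congr 1; omega⟩
      rw [heq, SimpleGraph.Walk.mem_verts_toSubgraph,
        SimpleGraph.Walk.mem_support_iff_exists_getVert] at hqW
      obtain ⟨i, hi, hiD⟩ := hqW
      rw [hz i hiD, h.hole.eq_iff_of_window (by omega) (by omega)] at hi
      omega

end LongOddHole

/-! ### Shortest paths that replace the arcs of the hole. -/

namespace LongOddHole

variable {V : Type*} {G : SimpleGraph V}

/-- `u 0, …, u k` is a shortest path from `s` to `t` among those with all vertices in `A`. -/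
structure IsGeodesic (G : SimpleGraph V) (A : V → Prop) (s t : V) (k : ℕ) (u : ℕ → V) : Prop where
  start : u 0 = s
  finish : u k = t
  adj : ∀ i < k, G.Adj (u i) (u (i + 1))
  mem : ∀ i ≤ k, A (u i)
  minimal : ∀ j < k, ¬ Conn G A j s t

theorem IsGeodesic.conn {A : V → Prop} {s t : V} {k : ℕ} {u : ℕ → V}
    (h : IsGeodesic G A s t k u) {i : ℕ} (hi : i ≤ k) :
    Conn G A i s (u i) ∧ Conn G A (k - i) (u i) t := by
  have h1 := Conn.of_seq h.adj h.mem (Nat.zero_le i) hi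
  have h2 := Conn.of_seq h.adj h.mem hi le_rfl
  rw [h.start] at h1
  rw [h.finish] at h2
  exact ⟨h1, h2⟩

theorem IsGeodesic.induced {A : V → Prop} {s t : V} {k : ℕ} {u : ℕ → V}
    (h : IsGeodesic G A s t k u) : IsInducedSeq G u k := by
  intro i j hij hj
  have hi := (h.conn (i := i) (by omega)).1
  have hj' := (h.conn hj).2
  refine ⟨fun e => ?_, fun e => ?_, fun e => ?_⟩
  · rw [e] at hi
    exact h.minimal _ (by omega) (hi.append hj')
  · by_contra hne
    exact h.minimal _ (by omega)
      ((hi.append (Conn.single (h.mem i (by omega)) (h.mem j hj) e)).append hj')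
  · rw [e]
    exact h.adj i (by omega)

/-- `w` lies on a walk of length at most `k` from `s` to `t` with all vertices in `A`. -/
def Between (G : SimpleGraph V) (A : V → Prop) (s t : V) (k : ℕ) (w : V) : Prop :=
  ∃ i j, i + j ≤ k ∧ Conn G A i s w ∧ Conn G A j w t

namespace IsShortestSeq

variable {ℓ c : ℕ} {C : Set V} {z : ℤ → V} {A : V → Prop}

theorem conn_arc (h : IsShortestSeq G ℓ c C z) {a : ℤ} {d : ℕ}
    (hA : ∀ i : ℕ, i ≤ d → A (z (a + i))) : Conn G A d (z a) (z (a + d)) := by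
  refine ⟨fun i => z (a + i), by simp, rfl, fun i _ => ?_, hA⟩
  have := h.hole.adj_succ (a + i)
  push_cast
  rwa [← add_assoc]

/-- This makes arcs of the hole geodesic inside any set of non-major vertices that contains them, so
a search finds a path of exactly the same length. -/
theorem not_conn_of_lt (h : IsShortestSeq G ℓ c C z) (hA : ∀ v, A v → ¬ IsMajor G C v) {a : ℤ}
    {d : ℕ} (hd : 2 * d + 3 ≤ c) : ∀ j < d, ¬ Conn G A j (z a) (z (a + d)) := by
  intro j hj hconn
  have := h.near_of_conn (by omega) (hconn.mono hA)
  rw [near_iff_of_window (by omega) (by omega) (by omega)] at this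
  omega

/-- A walk of length at most `d` through `w` has length exactly `d`, so `w` is an inner vertex of a
path that replaces the arc. -/
theorem avoids_of_between (h : IsShortestSeq G ℓ c C z) (hA : ∀ v, A v → ¬ IsMajor G C v) {a : ℤ}
    {d : ℕ} (hd : 2 * d + 3 ≤ c) {w : V} (hw : Between G A (z a) (z (a + d)) d w)
    (h₁ : w ≠ z a) (h₂ : w ≠ z (a + d)) {q : ℤ} (hq : a + d < q) (hqc : q < a + c) :
    w ≠ z q ∧ ¬ G.Adj w (z q) := by
  obtain ⟨i, j, hij, hi, hj⟩ := hw
  have hijd : i + j = d := by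
    by_contra hne
    exact h.not_conn_of_lt hA hd _ (by omega) (hi.append hj)
  have hi0 : 0 < i := by
    rcases Nat.eq_zero_or_pos i with rfl | hpos
    · obtain ⟨P, e1, e2, -⟩ := hi
      exact absurd (e2.symm.trans e1) h₁
    · exact hpos
  have hj0 : 0 < j := by
    rcases Nat.eq_zero_or_pos j with rfl | hpos
    · obtain ⟨P, e1, e2, -⟩ := hj
      exact absurd (e1.symm.trans e2) h₂
    · exact hpos
  obtain ⟨P, p0, pi, padj, pS⟩ := hi
  obtain ⟨Q, q0, qj, qadj, qS⟩ := hj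
  have hP : (fun t => if t ≤ i then P t else Q (t - i)) i = w := by simp [pi]
  rw [← hP]
  refine h.avoids_of_conn (P := fun t => if t ≤ i then P t else Q (t - i)) hd ?_ ?_ ?_ ?_ hi0
    (by omega) hq hqc
  · intro t ht
    rcases lt_trichotomy t i with h3 | h3 | h3
    · simp only [show t ≤ i by omega, show t + 1 ≤ i by omega, if_true]
      exact padj t h3
    · subst h3
      simp only [le_refl, if_true, show ¬ (t + 1 ≤ t) by omega, if_false, pi, ← q0]
      rw [show t + 1 - t = 0 + 1 by omega]
      exact qadj 0 hj0
    · simp only [show ¬ t ≤ i by omega, show ¬ t + 1 ≤ i by omega, if_false]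
      rw [show t + 1 - i = t - i + 1 by omega]
      exact qadj _ (by omega)
  · intro t ht
    split_ifs with h3
    · exact hA _ (pS t h3)
    · exact hA _ (qS _ (by omega))
  · simpa using p0
  · simp only [show ¬ d ≤ i by omega, if_false]
    rw [show d - i = j by omega]
    exact qj

end IsShortestSeq

/-- The vertices of `A` that are allowed on the continuation of the path `u 0, …, u d` from its
last vertex: they are not equal or adjacent to other vertices of the path. -/
def Remaining (G : SimpleGraph V) (A : V → Prop) (u : ℕ → V) (d : ℕ) (v : V) : Prop :=
  A v ∧ (v = u d ∨ ∀ i < d, v ≠ u i ∧ ¬ G.Adj v (u i))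

/-- The concatenation of two sequences. -/
def joinSeq (u u' : ℕ → V) (d : ℕ) (i : ℕ) : V :=
  if i < d then u i else u' (i - d)

theorem joinSeq_induced {A : V → Prop} {s m t : V} {d e : ℕ} {u u' : ℕ → V}
    (hu : IsGeodesic G A s m d u) (hu' : IsGeodesic G (Remaining G A u d) m t e u') :
    IsInducedSeq G (joinSeq u u' d) (d + e) := by
  intro i j hij hj
  simp only [joinSeq]
  rcases Nat.lt_or_ge i d with hid | hid
  · rcases Nat.lt_or_ge j d with hjd | hjd
    · simp only [hid, hjd, if_true]
      exact hu.induced i j hij (by omega)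
    · simp only [hid, if_true, show ¬ j < d by omega, if_false]
      rcases eq_or_lt_of_le hjd with rfl | hjd'
      · rw [Nat.sub_self, hu'.start, ← hu.finish]
        exact hu.induced i d hij le_rfl
      · have h1 := (hu'.mem (j - d) (by omega)).2
        have h2 : u' (j - d) ≠ u d := by
          rw [hu.finish, ← hu'.start]
          exact (hu'.induced 0 (j - d) (by omega) (by omega)).1.symm
        obtain ⟨h3, h4⟩ := h1.resolve_left h2 i hid
        refine ⟨h3.symm, ?_⟩
        rw [G.adj_comm]
        constructor
        · exact fun e => absurd e h4
        · omega
  · simp only [show ¬ i < d by omega, show ¬ j < d by omega, if_false]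
    obtain ⟨h1, h2⟩ := hu'.induced (i - d) (j - d) (by omega) (by omega)
    refine ⟨h1, ?_⟩
    rw [h2]
    omega

namespace IsShortestSeq

variable {ℓ c d e : ℕ} {C : Set V} {z : ℤ → V} {A : V → Prop} {a : ℤ} {u u' : ℕ → V}

/-- Whichever geodesic was found for the first arc, the next arc of the hole avoids its
neighbourhood and is still available for the continuation. -/
theorem remaining_arc (h : IsShortestSeq G ℓ c C z) (hA : ∀ v, A v → ¬ IsMajor G C v)
    (hd : 2 * d + 3 ≤ c) (hde : d + e + 2 ≤ c)
    (harc : ∀ i : ℕ, i ≤ d + e → A (z (a + i))) (hd0 : 0 < d)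
    (hu : IsGeodesic G A (z a) (z (a + d)) d u) :
    ∀ i : ℕ, i ≤ e → Remaining G A u d (z (a + d + i)) := by
  intro i hi
  refine ⟨?_, ?_⟩
  · have := harc (d + i) (by omega)
    rwa [Nat.cast_add, ← add_assoc] at this
  · rcases Nat.eq_zero_or_pos i with rfl | hi0
    · left
      rw [hu.finish]
      simp
    · right
      intro j hj
      rcases Nat.eq_zero_or_pos j with rfl | hj0
      · rw [hu.start, ne_eq, h.hole.eq_iff_of_window (by omega) (by omega),
          h.hole.adj_iff_of_window (by omega) (by omega)]
        omega
      · have := h.avoids_of_conn hd hu.adj (fun i hi => hA _ (hu.mem i hi)) hu.start hu.finish hj0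
          hj (q := a + d + i) (by omega) (by omega)
        exact ⟨this.1.symm, fun e => this.2 e.symm⟩

end IsShortestSeq

namespace RemoteConfig

variable {ℓ c g : ℕ} {C : Set V} {z : ℤ → V} {x : V}

/-- The vertices allowed on the path of the base. -/
def nearSet (G : SimpleGraph V) (x d₁ d₂ : V) (v : V) : Prop :=
  v ≠ x ∧ (¬ G.Adj x v ∨ v = d₁ ∨ v = d₂)

/-- The vertices on shortest paths for the two parts of the base. -/
def geodSet (G : SimpleGraph V) (A : V → Prop) (d₁ d₂ m : V) (d e : ℕ) (w : V) : Prop :=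
  A w ∧ w ≠ d₁ ∧ w ≠ d₂ ∧ (Between G A d₁ m d w ∨ Between G A m d₂ e w)

/-- The vertices allowed on the other part of the hole. -/
def farSet (G : SimpleGraph V) (W : V → Prop) (x d₁ d₂ : V) (v : V) : Prop :=
  v = d₁ ∨ v = d₂ ∨ (v ≠ x ∧ ∀ w, W w → w ≠ v ∧ ¬ G.Adj v w)

theorem mem (h : RemoteConfig G ℓ c C z g x) (i : ℤ) : z i ∈ C := by
  rw [← h.ctx.range_eq]
  exact ⟨i, rfl⟩

theorem ne_x (h : RemoteConfig G ℓ c C z g x) (i : ℤ) : z i ≠ x := by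
  intro e
  exact h.not_mem (e ▸ h.mem i)

/-- Every major vertex is `x` or adjacent to `x`, and the two exceptions `z 0`, `z g` lie in the
hole. -/
theorem nearSet_not_major (h : RemoteConfig G ℓ c C z g x) :
    ∀ v, nearSet G x (z 0) (z g) v → ¬ IsMajor G C v := by
  rintro v ⟨h1, h2⟩ hv
  rcases h.major v hv with h3 | ⟨h3, -⟩
  · exact h1 h3
  · rcases h2 with h2 | rfl | rfl
    · exact h2 h3
    · exact h.ctx.not_isMajor _ hv
    · exact h.ctx.not_isMajor _ hv

theorem nearSet_arc (h : RemoteConfig G ℓ c C z g x) :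
    ∀ i : ℕ, i ≤ g → nearSet G x (z 0) (z g) (z (0 + i)) := by
  intro i hi
  refine ⟨h.ne_x _, ?_⟩
  rw [zero_add]
  rcases Nat.eq_zero_or_pos i with rfl | h1
  · exact Or.inr (Or.inl rfl)
  · rcases eq_or_lt_of_le hi with rfl | h2
    · exact Or.inr (Or.inr rfl)
    · exact Or.inl (h.not_adj _ (by omega) (by omega))

variable {d e : ℕ}

theorem geodSet_arc (h : RemoteConfig G ℓ c C z g x) (hg : d + e = g) {i : ℕ} (hi : 0 < i)
    (hig : i < g) : geodSet G (nearSet G x (z 0) (z g)) (z 0) (z g) (z d) d e (z i) := by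
  have hs := h.short
  have harc := h.nearSet_arc
  refine ⟨by simpa using harc i hig.le, ?_, ?_, ?_⟩
  · rw [ne_eq, h.ctx.hole.eq_iff_of_window (by omega) (by omega)]
    omega
  · rw [ne_eq, h.ctx.hole.eq_iff_of_window (by omega) (by omega)]
    omega
  · have key : ∀ s t : ℕ, s ≤ t → t ≤ g →
        Conn G (nearSet G x (z 0) (z g)) (t - s) (z s) (z t) := by
      intro s t hst ht
      have := h.ctx.conn_arc (A := nearSet G x (z 0) (z g)) (a := s) (d := t - s) (fun j hj => by
        have := harc (s + j) (by omega)
        rwa [zero_add, Nat.cast_add] at this)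
      rwa [show (s : ℤ) + (t - s : ℕ) = t by omega] at this
    rcases le_total i d with hid | hid
    · left
      exact ⟨i - 0, d - i, by omega, key 0 i (by omega) (by omega), key i d hid (by omega)⟩
    · right
      exact ⟨i - d, g - i, by omega, key d i hid (by omega), key i g (by omega) le_rfl⟩

/-- For both halves of the base path, the open arc from `z g` to `z c` belongs to the longer side,
which shortest paths avoid. -/
theorem avoids_of_geodSet (h : RemoteConfig G ℓ c C z g x) (hg : d + e = g) (hd : 2 * d + 3 ≤ c)
    (he : 2 * e + 3 ≤ c) (hd0 : 0 < d) (he0 : 0 < e) {w : V}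
    (hw : geodSet G (nearSet G x (z 0) (z g)) (z 0) (z g) (z d) d e w) {q : ℤ} (hq : g < q)
    (hqc : q < c) : w ≠ z q ∧ ¬ G.Adj w (z q) := by
  obtain ⟨-, h1, h2, h3⟩ := hw
  have hs := h.short
  by_cases hm : w = z d
  · rw [hm, ne_eq, h.ctx.hole.eq_iff_of_window (by omega) (by omega),
      h.ctx.hole.adj_iff_of_window (by omega) (by omega)]
    omega
  · rcases h3 with h3 | h3
    · refine h.ctx.avoids_of_between h.nearSet_not_major (a := 0) hd ?_ h1 ?_ (by omega) (by omega)
      · simpa using h3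
      · simpa using hm
    · have e1 : (g : ℤ) = d + e := by omega
      refine h.ctx.avoids_of_between h.nearSet_not_major (a := d) he ?_ hm ?_ (by omega) (by omega)
      · rwa [← e1]
      · rwa [← e1]

/-- A major vertex other than `x` has a neighbour in the interior of the base path, and that
interior is part of `geodSet`. -/
theorem farSet_not_major (h : RemoteConfig G ℓ c C z g x) (hg : d + e = g) :
    ∀ v, farSet G (geodSet G (nearSet G x (z 0) (z g)) (z 0) (z g) (z d) d e) x (z 0) (z g) v →
      ¬ IsMajor G C v := by
  rintro v (rfl | rfl | ⟨h1, h2⟩) hv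
  · exact h.ctx.not_isMajor _ hv
  · exact h.ctx.not_isMajor _ hv
  · rcases h.major v hv with h3 | ⟨-, i, h3, h4, h5⟩
    · exact h1 h3
    · exact (h2 _ (h.geodSet_arc hg h3 h4)).2 h5

theorem farSet_arc (h : RemoteConfig G ℓ c C z g x) (hg : d + e = g) (hd : 2 * d + 3 ≤ c)
    (he : 2 * e + 3 ≤ c) (hd0 : 0 < d) (he0 : 0 < e) :
    ∀ i : ℕ, i ≤ c - g →
      farSet G (geodSet G (nearSet G x (z 0) (z g)) (z 0) (z g) (z d) d e) x (z 0) (z g)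
        (z (g + i)) := by
  intro i hi
  have hs := h.short
  rcases Nat.eq_zero_or_pos i with rfl | h1
  · exact Or.inr (Or.inl (by simp))
  · rcases eq_or_lt_of_le hi with rfl | h2
    · left
      have := h.ctx.hole.add_period 0
      rw [← this]
      congr 1
      omega
    · refine Or.inr (Or.inr ⟨h.ne_x _, fun w hw => ?_⟩)
      obtain ⟨h3, h4⟩ := h.avoids_of_geodSet hg hd he hd0 he0 hw (q := g + i) (by omega) (by omega)
      exact ⟨h3, fun e => h4 e.symm⟩

/-- The path actually found on the base side need not be the base path, but its interior lies in the
set from which `farSet` keeps away. -/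
theorem geodSet_joinSeq {A : V → Prop} {d₁ d₂ m : V} (hg : d + e = g) (hd0 : 0 < d)
    {u u' : ℕ → V} (hu : IsGeodesic G A d₁ m d u)
    (hu' : IsGeodesic G (Remaining G A u d) m d₂ e u') {i : ℕ} (hi : 0 < i) (hig : i < g) :
    geodSet G A d₁ d₂ m d e (joinSeq u u' d i) := by
  have hind := joinSeq_induced hu hu'
  rw [hg] at hind
  have h0 : joinSeq u u' d 0 = d₁ := by simp [joinSeq, hd0, hu.start]
  have h1 : joinSeq u u' d g = d₂ := by
    simp only [joinSeq, show ¬ g < d by omega, if_false, show g - d = e by omega, hu'.finish]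
  have h2 := (hind 0 i hi hig.le).1.symm
  have h3 := (hind i g hig le_rfl).1
  rw [h0] at h2
  rw [h1] at h3
  rcases Nat.lt_or_ge i d with hid | hid
  · have hi : joinSeq u u' d i = u i := by simp [joinSeq, hid]
    rw [hi] at h2 h3 ⊢
    exact ⟨hu.mem i hid.le, h2, h3, Or.inl ⟨i, d - i, by omega, (hu.conn hid.le).1,
      (hu.conn hid.le).2⟩⟩
  · have hi : joinSeq u u' d i = u' (i - d) := by simp [joinSeq, show ¬ i < d by omega]
    rw [hi] at h2 h3 ⊢
    have h4 := hu'.conn (i := i - d) (by omega)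
    exact ⟨(hu'.mem (i - d) (by omega)).1, h2, h3, Or.inr ⟨i - d, e - (i - d), by omega,
      h4.1.mono fun v hv => hv.1, h4.2.mono fun v hv => hv.1⟩⟩

/-- Four geodesics, found one after the other, form a hole of the same length. -/
theorem closed (h : RemoteConfig G ℓ c C z g x) {U U' : ℕ → V} {W : V → Prop}
    (hU : IsInducedSeq G U g) (hU' : IsInducedSeq G U' (c - g)) (hU0 : U 0 = z 0)
    (hUg : U g = z g) (hU'0 : U' 0 = z g) (hU'g : U' (c - g) = z 0)
    (hW : ∀ i, 0 < i → i < g → W (U i))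
    (hA : ∀ i ≤ c - g, farSet G W x (z 0) (z g) (U' i)) :
    ∀ i j, i < j → j < c → joinSeq U U' g i ≠ joinSeq U U' g j ∧
      (G.Adj (joinSeq U U' g i) (joinSeq U U' g j) ↔ j = i + 1 ∨ (i = 0 ∧ j + 1 = c)) := by
  intro i j hij hj
  have hs := h.short
  have hl := h.long
  have hℓ := h.ctx.five_le
  simp only [joinSeq]
  rcases Nat.lt_or_ge i g with hig | hig
  · rcases Nat.lt_or_ge j g with hjg | hjg
    · simp only [hig, hjg, if_true]
      obtain ⟨h1, h2⟩ := hU i j hij hjg.le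
      refine ⟨h1, ?_⟩
      rw [h2]
      omega
    · simp only [hig, if_true, show ¬ j < g by omega, if_false]
      rcases eq_or_lt_of_le hjg with rfl | hjg'
      · rw [Nat.sub_self, hU'0, ← hUg]
        obtain ⟨h1, h2⟩ := hU i g hij le_rfl
        refine ⟨h1, ?_⟩
        rw [h2]
        omega
      · rcases Nat.eq_zero_or_pos i with rfl | hi0
        -- The first vertex is also the last one of the second path, which accounts for the closing
        -- edge of the cycle.
        · rw [hU0, ← hU'g]
          obtain ⟨h1, h2⟩ := hU' (j - g) (c - g) (by omega) le_rfl
          refine ⟨h1.symm, ?_⟩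
          rw [G.adj_comm, h2]
          omega
        · have h1 := (hU' (j - g) (c - g) (by omega) le_rfl).1
          have h2 := (hU' 0 (j - g) (by omega) (by omega)).1.symm
          rw [hU'g] at h1
          rw [hU'0] at h2
          -- An inner vertex of the second path is not one of the two ends, hence it has no
          -- neighbour in `W`, which contains the inner vertices of the first path.
          rcases hA (j - g) (by omega) with h3 | h3 | h3
          · exact absurd h3 h1
          · exact absurd h3 h2
          · obtain ⟨h4, h5⟩ := h3.2 _ (hW i hi0 hig)
            refine ⟨h4, ?_⟩
            rw [G.adj_comm]
            constructor
            · exact fun e => absurd e h5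
            · omega
  · simp only [show ¬ i < g by omega, show ¬ j < g by omega, if_false]
    obtain ⟨h1, h2⟩ := hU' (i - g) (j - g) (by omega) (by omega)
    refine ⟨h1, ?_⟩
    rw [h2]
    omega

end RemoteConfig

end LongOddHole

/-! ### A language of bounded loops, and its translation to the word RAM -/

namespace LoopLang

open WordRAM

/-- A store: variables and arrays. -/
structure Store (R A : Type) where
  var : R → ℕ
  arr : A → ℕ → ℕ

/-- Terms: constants, the number of vertices, variables, array entries and operations. -/
inductive Term (R A : Type) where
  | const (k : ℕ)
  | size
  | var (r : R)
  | arr (a : A) (i : Term R A)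
  | op (o : BinOp) (t₁ t₂ : Term R A)

/-- Quantifier-free formulas. -/
inductive Form (R A : Type) where
  | eq (t₁ t₂ : Term R A)
  | lt (t₁ t₂ : Term R A)
  | adj (t₁ t₂ : Term R A)
  | not (φ : Form R A)
  | and (φ ψ : Form R A)
  | or (φ ψ : Form R A)

/-- Commands. The loop runs its body for the values `0, …, n - 1` of the variable. -/
inductive Cmd (R A : Type) where
  | skip
  | set (r : R) (t : Term R A)
  | put (a : A) (i t : Term R A)
  | seq (p q : Cmd R A)
  | ite (φ : Form R A) (p q : Cmd R A)
  | forEach (r : R) (body : Cmd R A)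

variable {R A : Type} {n : ℕ}

open Classical in
/-- Change a variable. -/
noncomputable def Store.setVar (σ : Store R A) (r : R) (v : ℕ) : Store R A :=
  ⟨Function.update σ.var r v, σ.arr⟩

open Classical in
/-- Change an array entry. -/
noncomputable def Store.setArr (σ : Store R A) (a : A) (i v : ℕ) : Store R A :=
  ⟨σ.var, Function.update σ.arr a (Function.update (σ.arr a) i v)⟩

open Classical in
theorem Store.var_setVar (σ : Store R A) (r r' : R) (v : ℕ) :
    (σ.setVar r v).var r' = if r' = r then v else σ.var r' := by
  simp [Store.setVar, Function.update_apply]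

@[simp]
theorem Store.var_setVar_self (σ : Store R A) (r : R) (v : ℕ) : (σ.setVar r v).var r = v := by
  simp [Store.var_setVar]

theorem Store.var_setVar_of_ne (σ : Store R A) {r r' : R} (v : ℕ) (h : r' ≠ r) :
    (σ.setVar r v).var r' = σ.var r' := by
  simp [Store.var_setVar, h]

@[simp]
theorem Store.arr_setVar (σ : Store R A) (r : R) (v : ℕ) : (σ.setVar r v).arr = σ.arr := rfl

@[simp]
theorem Store.var_setArr (σ : Store R A) (a : A) (i v : ℕ) : (σ.setArr a i v).var = σ.var := rfl

open Classical in
theorem Store.arr_setArr (σ : Store R A) (a a' : A) (i j v : ℕ) :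
    (σ.setArr a i v).arr a' j = if a' = a ∧ j = i then v else σ.arr a' j := by
  simp only [Store.setArr, Function.update_apply]
  by_cases h : a' = a
  · subst h
    by_cases h2 : j = i <;> simp [h2]
  · simp [h]

/-- The value of a term. -/
def Term.eval (n : ℕ) (σ : Store R A) : Term R A → ℕ
  | .const k => k
  | .size => n
  | .var r => σ.var r
  | .arr a i => σ.arr a (i.eval n σ)
  | .op o t₁ t₂ => o.eval (t₁.eval n σ) (t₂.eval n σ)

/-- Adjacency of the vertices with given numbers. -/
def AdjNum (G : SimpleGraph (Fin n)) (i j : ℕ) : Prop :=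
  ∃ (hi : i < n) (hj : j < n), G.Adj ⟨i, hi⟩ ⟨j, hj⟩

@[simp]
theorem adjNum_val (G : SimpleGraph (Fin n)) (u v : Fin n) : AdjNum G u v ↔ G.Adj u v := by
  simp [AdjNum]

/-- Truth of a formula. -/
def Form.Holds (G : SimpleGraph (Fin n)) (σ : Store R A) : Form R A → Prop
  | .eq t₁ t₂ => t₁.eval n σ = t₂.eval n σ
  | .lt t₁ t₂ => t₁.eval n σ < t₂.eval n σ
  | .adj t₁ t₂ => AdjNum G (t₁.eval n σ) (t₂.eval n σ)
  | .not φ => ¬ φ.Holds G σ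
  | .and φ ψ => φ.Holds G σ ∧ ψ.Holds G σ
  | .or φ ψ => φ.Holds G σ ∨ ψ.Holds G σ

/-- The store after `k` rounds of a loop with body `f`. -/
noncomputable def rounds (f : Store R A → Store R A) (r : R) (σ : Store R A) : ℕ → Store R A
  | 0 => σ
  | k + 1 => f ((rounds f r σ k).setVar r k)

open Classical in
/-- The effect of a command. Assigned values are reduced modulo `n + 2`. -/
noncomputable def Cmd.den (G : SimpleGraph (Fin n)) : Cmd R A → Store R A → Store R A
  | .skip, σ => σ
  | .set r t, σ => σ.setVar r (t.eval n σ % (n + 2))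
  | .put a i t, σ => σ.setArr a (i.eval n σ) (t.eval n σ % (n + 2))
  | .seq p q, σ => q.den G (p.den G σ)
  | .ite φ p q, σ => if φ.Holds G σ then p.den G σ else q.den G σ
  | .forEach r p, σ => (rounds (p.den G) r σ n).setVar r n

/-- The command may change the variable. -/
def Cmd.Writes (r : R) : Cmd R A → Prop
  | .skip => False
  | .set r' _ => r = r'
  | .put _ _ _ => False
  | .seq p q => p.Writes r ∨ q.Writes r
  | .ite _ p q => p.Writes r ∨ q.Writes r
  | .forEach r' p => r = r' ∨ p.Writes r

/-- No loop changes its own variable. -/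
def Cmd.Proper : Cmd R A → Prop
  | .skip => True
  | .set _ _ => True
  | .put _ _ _ => True
  | .seq p q => p.Proper ∧ q.Proper
  | .ite _ p q => p.Proper ∧ q.Proper
  | .forEach r p => p.Proper ∧ ¬ p.Writes r

/-- The nesting depth of the loops. -/
def Cmd.depth : Cmd R A → ℕ
  | .skip => 0
  | .set _ _ => 0
  | .put _ _ _ => 0
  | .seq p q => max p.depth q.depth
  | .ite _ p q => max p.depth q.depth
  | .forEach _ p => p.depth + 1

/-- This and its analogue for arrays separate the pieces of the program: whatever a piece does not
write is carried through it. -/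
theorem Cmd.var_den (G : SimpleGraph (Fin n)) {r : R} {p : Cmd R A} (h : ¬ p.Writes r)
    (σ : Store R A) : (p.den G σ).var r = σ.var r := by
  induction p generalizing σ with
  | skip => rfl
  | set r' t => exact Store.var_setVar_of_ne _ _ h
  | put a i t => rfl
  | seq p q hp hq =>
    simp only [Cmd.Writes, not_or] at h
    simp only [Cmd.den]
    rw [hq h.2, hp h.1]
  | ite φ p q hp hq =>
    simp only [Cmd.Writes, not_or] at h
    simp only [Cmd.den]
    split_ifs
    · exact hp h.1 σ
    · exact hq h.2 σ
  | forEach r' p hp =>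
    simp only [Cmd.Writes, not_or] at h
    have key : ∀ k, (rounds (p.den G) r' σ k).var r = σ.var r := by
      intro k
      induction k with
      | zero => rfl
      | succ k ih => rw [rounds, hp h.2, Store.var_setVar_of_ne _ _ h.1, ih]
    simp only [Cmd.den]
    rw [Store.var_setVar_of_ne _ _ h.1, key]

/-! #### Translation -/

/-- The numbering of variables and arrays for the machine. -/
structure Layout (R A : Type) where
  reg : R → ℕ
  arr : A → ℕ
  reg_inj : Function.Injective reg
  arr_inj : Function.Injective arr
  arr_lt : ∀ a, arr a < 16

variable (L : Layout R A)

/-- The address of an array entry; the arrays are stored interleaved after the input. -/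
def Layout.address (a : A) (i : Expr) : Expr :=
  .op .add (.op .mul (.reg 0) (.reg 0)) (.op .add (.op .mul i (.const 16)) (.const (L.arr a)))

/-- The machine expression for a term. -/
def Term.compile : Term R A → Expr
  | .const k => .const k
  | .size => .reg 0
  | .var r => .reg (L.reg r + 1)
  | .arr a i => .load (L.address a i.compile)
  | .op o t₁ t₂ => .op o t₁.compile t₂.compile

/-- The machine expression for a formula, with value `0` or `1`. -/
def Form.compile : Form R A → Expr
  | .eq t₁ t₂ => .op .eq (t₁.compile L) (t₂.compile L)
  | .lt t₁ t₂ => .op .lt (t₁.compile L) (t₂.compile L)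
  | .adj t₁ t₂ => .op .mul (.op .mul (.op .lt (t₁.compile L) (.reg 0))
      (.op .lt (t₂.compile L) (.reg 0)))
      (.load (.op .add (.op .mul (t₁.compile L) (.reg 0)) (t₂.compile L)))
  | .not φ => .op .eq φ.compile (.const 0)
  | .and φ ψ => .op .mul φ.compile ψ.compile
  | .or φ ψ => .op .lt (.const 0) (.op .add φ.compile ψ.compile)

/-- Reduction modulo `n + 2`. -/
def reduced (e : Expr) : Expr := .op .mod e (.op .add (.reg 0) (.const 2))

/-- The machine program for a command. -/
def Cmd.compile : Cmd R A → Program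
  | .skip => .skip
  | .set r t => .assign (L.reg r + 1) (reduced (t.compile L))
  | .put a i t => .store (L.address a (i.compile L)) (reduced (t.compile L))
  | .seq p q => .seq p.compile q.compile
  | .ite φ p q => .branch (φ.compile L) p.compile q.compile
  | .forEach r p => .seq (.assign (L.reg r + 1) (.const 0))
      (.loop (.op .lt (.reg (L.reg r + 1)) (.reg 0))
        (.seq p.compile (.assign (L.reg r + 1) (.op .add (.reg (L.reg r + 1)) (.const 1)))))

/-- The configuration `s` represents the graph and the store `σ`. -/
structure Rep (G : SimpleGraph (Fin n)) (s : State) (σ : Store R A) : Prop where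
  size : s.reg 0 = n
  var : ∀ r, s.reg (L.reg r + 1) = σ.var r
  adj : ∀ i j, i < n → j < n →
    (s.mem (i * n + j) = 1 ∧ AdjNum G i j) ∨ (s.mem (i * n + j) = 0 ∧ ¬ AdjNum G i j)
  arr : ∀ a i, s.mem (n * n + (i * 16 + L.arr a)) = σ.arr a i
  reg_lt : ∀ r, s.reg r < n + 2
  mem_lt : ∀ a, s.mem a < n + 2

/-- A bound for the exponent of the word size that an expression needs. -/
def _root_.WordRAM.Expr.width : Expr → ℕ
  | .const k => k + 1
  | .reg _ => 1
  | .load a => a.width + 1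
  | .op _ e₁ e₂ => e₁.width + e₂.width + 1

theorem _root_.WordRAM.BinOp.eval_lt {X : ℕ} (hX : 2 ≤ X) (o : BinOp) {a b w w' : ℕ}
    (ha : a < X ^ w) (hb : b < X ^ w') : o.eval a b < X ^ (w + w' + 1) := by
  have h0 : 0 < X := by omega
  have h1 : X ^ w ≤ X ^ (w + w' + 1) := Nat.pow_le_pow_right h0 (by omega)
  have h2 : X ^ w' ≤ X ^ (w + w' + 1) := Nat.pow_le_pow_right h0 (by omega)
  have h3 : X ^ w ≤ X ^ (w + w') := Nat.pow_le_pow_right h0 (by omega)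
  have h4 : X ^ w' ≤ X ^ (w + w') := Nat.pow_le_pow_right h0 (by omega)
  have h5 : 2 * X ^ (w + w') ≤ X ^ (w + w' + 1) := by
    rw [pow_succ, mul_comm]
    exact Nat.mul_le_mul_left _ hX
  have h6 : 1 ≤ X ^ (w + w') := Nat.one_le_pow _ _ h0
  cases o with
  | add => simp only [BinOp.eval]; omega
  | sub => simp only [BinOp.eval]; omega
  | mul =>
    simp only [BinOp.eval]
    calc a * b < X ^ w * X ^ w' := Nat.mul_lt_mul'' ha hb
      _ = X ^ (w + w') := (pow_add _ _ _).symm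
      _ ≤ _ := by omega
  | div =>
    simp only [BinOp.eval]
    have := Nat.div_le_self a b
    omega
  | mod =>
    simp only [BinOp.eval]
    have := Nat.mod_le a b
    omega
  | lt => simp only [BinOp.eval]; split_ifs <;> omega
  | eq => simp only [BinOp.eval]; split_ifs <;> omega

/-- If registers and memory are below `X`, each node of an expression raises the power of `X` needed
by a constant. So one exponent, depending on the program only, serves for all `n`. -/
theorem _root_.WordRAM.Expr.fits {X : ℕ} (hX : 2 ≤ X) {s : State} (hr : ∀ r, s.reg r < X)
    (hm : ∀ a, s.mem a < X) (e : Expr) :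
    e.eval s < X ^ e.width ∧ ∀ b, e.width ≤ b → e.Fits (X ^ b) s := by
  have h0 : 0 < X := by omega
  have mono : ∀ {v w b : ℕ}, v < X ^ w → w ≤ b → v < X ^ b := fun h1 h2 =>
    h1.trans_le (Nat.pow_le_pow_right h0 h2)
  induction e with
  | const k =>
    have : k < X ^ (k + 1) := by
      calc k < 2 ^ k := Nat.lt_two_pow_self
        _ ≤ X ^ k := Nat.pow_le_pow_left hX k
        _ ≤ _ := Nat.pow_le_pow_right h0 (by omega)
    exact ⟨this, fun b hb => mono this hb⟩
  | reg r =>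
    have : s.reg r < X ^ 1 := by simpa using hr r
    exact ⟨this, fun b hb => mono this hb⟩
  | load a ih =>
    have : s.mem (a.eval s) < X ^ (a.width + 1) :=
      mono (w := 1) (by simpa using hm _) (by omega)
    refine ⟨this, fun b hb => ?_⟩
    simp only [Expr.width] at hb
    exact ⟨ih.2 b (by omega), mono this hb⟩
  | op o e₁ e₂ ih₁ ih₂ =>
    have := o.eval_lt hX ih₁.1 ih₂.1
    refine ⟨this, fun b hb => ?_⟩
    simp only [Expr.width] at hb
    exact ⟨ih₁.2 b (by omega), ih₂.2 b (by omega), mono this hb⟩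

variable {L} {G : SimpleGraph (Fin n)} {s : State} {σ : Store R A}

theorem Rep.fits (h : Rep L G s σ) (e : Expr) {b : ℕ} (hb : e.width ≤ b) :
    e.Fits ((n + 2) ^ b) s :=
  (e.fits (by omega) h.reg_lt h.mem_lt).2 b hb

theorem Rep.eval_address (h : Rep L G s σ) (a : A) (i : Expr) :
    (L.address a i).eval s = n * n + (i.eval s * 16 + L.arr a) := by
  simp [Layout.address, Expr.eval, BinOp.eval, h.size]

theorem Rep.eval_reduced (h : Rep L G s σ) (e : Expr) :
    (reduced e).eval s = e.eval s % (n + 2) := by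
  simp [reduced, Expr.eval, BinOp.eval, h.size]

theorem Rep.eval_term (h : Rep L G s σ) (t : Term R A) : (t.compile L).eval s = t.eval n σ := by
  induction t with
  | const k => rfl
  | size => exact h.size
  | var r => exact h.var r
  | arr a i ih =>
    simp only [Term.compile, Expr.eval, Term.eval]
    rw [h.eval_address, h.arr, ih]
  | op o t₁ t₂ ih₁ ih₂ => simp only [Term.compile, Expr.eval, Term.eval, ih₁, ih₂]

theorem Rep.eval_form (h : Rep L G s σ) (φ : Form R A) :
    ((φ.compile L).eval s = 1 ∧ φ.Holds G σ) ∨ ((φ.compile L).eval s = 0 ∧ ¬ φ.Holds G σ) := by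
  induction φ with
  | eq t₁ t₂ =>
    simp only [Form.compile, Expr.eval, Form.Holds, h.eval_term, BinOp.eval]
    split_ifs with h1 <;> simp [h1]
  | lt t₁ t₂ =>
    simp only [Form.compile, Expr.eval, Form.Holds, h.eval_term, BinOp.eval]
    split_ifs with h1 <;> simp [h1]
  | adj t₁ t₂ =>
    simp only [Form.compile, Expr.eval, Form.Holds, h.eval_term, BinOp.eval, h.size]
    by_cases h1 : t₁.eval n σ < n
    · by_cases h2 : t₂.eval n σ < n
      · rcases h.adj _ _ h1 h2 with ⟨h3, h4⟩ | ⟨h3, h4⟩ <;> simp [h1, h2, h3, h4]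
      · have : ¬ AdjNum G (t₁.eval n σ) (t₂.eval n σ) := fun ⟨_, h3, _⟩ => h2 h3
        simp [h1, h2, this]
    · have : ¬ AdjNum G (t₁.eval n σ) (t₂.eval n σ) := fun ⟨h3, _⟩ => h1 h3
      simp [h1, this]
  | not φ ih =>
    simp only [Form.compile, Expr.eval, Form.Holds, BinOp.eval]
    rcases ih with ⟨h1, h2⟩ | ⟨h1, h2⟩ <;> simp [h1, h2]
  | and φ ψ ih₁ ih₂ =>
    simp only [Form.compile, Expr.eval, Form.Holds, BinOp.eval]
    rcases ih₁ with ⟨h1, h2⟩ | ⟨h1, h2⟩ <;> rcases ih₂ with ⟨h3, h4⟩ | ⟨h3, h4⟩ <;>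
      simp [h1, h2, h3, h4]
  | or φ ψ ih₁ ih₂ =>
    simp only [Form.compile, Expr.eval, Form.Holds, BinOp.eval]
    rcases ih₁ with ⟨h1, h2⟩ | ⟨h1, h2⟩ <;> rcases ih₂ with ⟨h3, h4⟩ | ⟨h3, h4⟩ <;>
      simp [h1, h2, h3, h4]

theorem Rep.setReg (h : Rep L G s σ) (r : R) {v : ℕ} (hv : v < n + 2) :
    Rep L G (s.setReg (L.reg r + 1) v) (σ.setVar r v) where
  size := by simpa [State.setReg, Function.update_apply] using h.size
  var r' := by
    by_cases hr : r' = r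
    · simp [State.setReg, hr]
    · have : L.reg r' ≠ L.reg r := fun e => hr (L.reg_inj e)
      simp [State.setReg, Store.var_setVar, hr, this, h.var]
  adj := h.adj
  arr := h.arr
  reg_lt r' := by
    simp only [State.setReg, Function.update_apply]
    split_ifs
    · exact hv
    · exact h.reg_lt r'
  mem_lt := h.mem_lt

theorem Rep.setMem (h : Rep L G s σ) (a : A) (i : ℕ) {v : ℕ} (hv : v < n + 2) :
    Rep L G (s.setMem (n * n + (i * 16 + L.arr a)) v) (σ.setArr a i v) where
  size := h.size
  var := h.var
  adj i' j' hi hj := by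
    have : i' * n + j' ≠ n * n + (i * 16 + L.arr a) := by
      have : (i' + 1) * n ≤ n * n := Nat.mul_le_mul_right n hi
      rw [add_mul] at this
      omega
    simpa [State.setMem, Function.update_apply, this] using h.adj i' j' hi hj
  arr a' i' := by
    simp only [State.setMem, Function.update_apply, Store.arr_setArr]
    by_cases h1 : a' = a ∧ i' = i
    · simp [h1]
    · have h2 : ¬ (n * n + (i' * 16 + L.arr a') = n * n + (i * 16 + L.arr a)) := by
        intro e
        have h3 := L.arr_lt a
        have h4 := L.arr_lt a'
        exact h1 ⟨L.arr_inj (by omega), by omega⟩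
      rw [if_neg h1, if_neg h2]
      exact h.arr a' i'
  reg_lt := h.reg_lt
  mem_lt a' := by
    simp only [State.setMem, Function.update_apply]
    split_ifs
    · exact hv
    · exact h.mem_lt a'

variable (L) in
/-- The translated program simulates the command, within the time given by the nesting depth of
the loops. -/
theorem Cmd.exists_runs (p : Cmd R A) (hp : p.Proper) :
    ∃ K b₀ : ℕ, ∀ b, b₀ ≤ b → ∀ (n : ℕ) (G : SimpleGraph (Fin n)) (s : State) (σ : Store R A),
      Rep L G s σ → ∃ t s', Runs ((n + 2) ^ b) (p.compile L) s t s' ∧ Rep L G s' (p.den G σ) ∧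
        t ≤ K * (n + 1) ^ p.depth := by
  induction p with
  | skip =>
    exact ⟨1, 0, fun b _ n G s σ h => ⟨1, s, .skip s, h, by simp [Cmd.depth]⟩⟩
  | set r t =>
    refine ⟨(reduced (t.compile L)).cost + 1, (reduced (t.compile L)).width,
      fun b hb n G s σ h => ⟨_, _, .assign s _ _ (h.fits _ hb), ?_, by simp [Cmd.depth]⟩⟩
    rw [h.eval_reduced, h.eval_term]
    exact h.setReg r (Nat.mod_lt _ (by omega))
  | put a i t =>
    refine ⟨(L.address a (i.compile L)).cost + (reduced (t.compile L)).cost + 1,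
      (L.address a (i.compile L)).width + (reduced (t.compile L)).width,
      fun b hb n G s σ h => ⟨_, _, .store s _ _ (h.fits _ (by omega)) (h.fits _ (by omega)), ?_,
        by simp [Cmd.depth]⟩⟩
    rw [h.eval_reduced, h.eval_address, h.eval_term, h.eval_term]
    exact h.setMem a _ (Nat.mod_lt _ (by omega))
  | seq p q ihp ihq =>
    obtain ⟨K, b₀, h₁⟩ := ihp hp.1
    obtain ⟨K', b₁, h₂⟩ := ihq hp.2
    refine ⟨K + K', b₀ + b₁, fun b hb n G s σ h => ?_⟩
    obtain ⟨t, s', h3, h4, h5⟩ := h₁ b (by omega) n G s σ h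
    obtain ⟨t', s'', h6, h7, h8⟩ := h₂ b (by omega) n G s' _ h4
    refine ⟨_, _, .seq h3 h6, h7, ?_⟩
    rw [add_mul]
    refine add_le_add (h5.trans ?_) (h8.trans ?_) <;>
    exact Nat.mul_le_mul_left _ (Nat.pow_le_pow_right (by omega) (by simp [Cmd.depth]))
  | ite φ p q ihp ihq =>
    obtain ⟨K, b₀, h₁⟩ := ihp hp.1
    obtain ⟨K', b₁, h₂⟩ := ihq hp.2
    refine ⟨(φ.compile L).cost + 1 + K + K', (φ.compile L).width + b₀ + b₁,
      fun b hb n G s σ h => ?_⟩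
    have hone : ∀ d, 1 ≤ (n + 1) ^ d := fun d => Nat.one_le_pow _ _ (by omega)
    rcases h.eval_form φ with ⟨h3, h4⟩ | ⟨h3, h4⟩
    · obtain ⟨t, s', h5, h6, h7⟩ := h₁ b (by omega) n G s σ h
      refine ⟨_, _, .branch_true _ (h.fits _ (by omega)) (by omega) h5, ?_, ?_⟩
      · simpa [Cmd.den, h4] using h6
      · have h8 : t ≤ K * (n + 1) ^ max p.depth q.depth := h7.trans
          (Nat.mul_le_mul_left _ (Nat.pow_le_pow_right (by omega) (by simp)))
        have h9 := hone (max p.depth q.depth)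
        simp only [Cmd.depth]
        nlinarith
    · obtain ⟨t, s', h5, h6, h7⟩ := h₂ b (by omega) n G s σ h
      refine ⟨_, _, .branch_false _ (h.fits _ (by omega)) (by omega) h5, ?_, ?_⟩
      · simpa [Cmd.den, h4] using h6
      · have h8 : t ≤ K' * (n + 1) ^ max p.depth q.depth := h7.trans
          (Nat.mul_le_mul_left _ (Nat.pow_le_pow_right (by omega) (by simp)))
        have h9 := hone (max p.depth q.depth)
        simp only [Cmd.depth]
        nlinarith
  | forEach r p ih =>
    obtain ⟨K, b₀, h₁⟩ := ih hp.1
    -- One round costs four steps for the test and four for the increment besides the body; the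
    -- initial assignment costs two and the last test four. The increment is an expression of width
    -- four.
    refine ⟨K + 14, b₀ + 4, fun b hb n G s σ h => ?_⟩
    have hlt : ∀ {s σ}, Rep L G s σ → (Expr.op .lt (.reg (L.reg r + 1)) (.reg 0)).eval s =
        if σ.var r < n then 1 else 0 := by
      intro s σ h
      simp only [Expr.eval, BinOp.eval, h.size, h.var]
    -- Induction on the number `k` of rounds that remain. The store includes the loop variable,
    -- which the body leaves unchanged, so the machine's increment yields the next round of
    -- `rounds`.
    have key : ∀ k i (s : State), i + k = n →
        Rep L G s ((rounds (p.den G) r σ i).setVar r i) →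
        ∃ t s', Runs ((n + 2) ^ b) (.loop (.op .lt (.reg (L.reg r + 1)) (.reg 0))
          (.seq (p.compile L) (.assign (L.reg r + 1) (.op .add (.reg (L.reg r + 1)) (.const 1)))))
          s t s' ∧ Rep L G s' ((rounds (p.den G) r σ n).setVar r n) ∧
          t ≤ 4 + k * (K * (n + 1) ^ p.depth + 8) := by
      intro k
      induction k with
      | zero =>
        intro i s hi h
        obtain rfl : i = n := by omega
        refine ⟨_, _, .loop_false _ (h.fits _ (by simp [Expr.width]; omega)) ?_, h, ?_⟩
        · rw [hlt h]
          simp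
        · simp [Expr.cost]
      | succ k ihk =>
        intro i s hi h
        obtain ⟨t, s', h3, h4, h5⟩ := h₁ b (by omega) n G s _ h
        have h6 : (p.den G ((rounds (p.den G) r σ i).setVar r i)).var r = i := by
          rw [Cmd.var_den G hp.2]
          simp
        have h7 := h4.setReg r (v := i + 1) (by omega)
        have h8 : Rep L G (s'.setReg (L.reg r + 1) (i + 1))
            ((rounds (p.den G) r σ (i + 1)).setVar r (i + 1)) := h7
        obtain ⟨t', s'', h9, h10, h11⟩ := ihk (i + 1) _ (by omega) h8
        have h12 : (Expr.op .add (.reg (L.reg r + 1)) (.const 1)).eval s' = i + 1 := by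
          simp only [Expr.eval, BinOp.eval, h4.var, h6]
        have h13 := Runs.seq h3 (.assign _ (L.reg r + 1) _ (h4.fits
          (.op .add (.reg (L.reg r + 1)) (.const 1)) (b := b) (by simp [Expr.width]; omega)))
        rw [h12] at h13
        refine ⟨_, s'', .loop_true _ (h.fits _ (by simp [Expr.width]; omega)) ?_ h13 h9, h10, ?_⟩
        · rw [hlt h]
          simp
          omega
        · simp only [Expr.cost]
          rw [add_mul]
          omega
    have h2 := h.setReg r (v := 0) (by omega)
    obtain ⟨t, s', h3, h4, h5⟩ := key n 0 _ (by omega) h2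
    refine ⟨_, s', .seq (.assign _ _ _ (h.fits _ (by simp [Expr.width]; omega))) h3, h4, ?_⟩
    simp only [Expr.cost, Cmd.depth, pow_succ]
    have h6 : 1 ≤ (n + 1) ^ p.depth := Nat.one_le_pow _ _ (by omega)
    generalize (n + 1) ^ p.depth = Y at *
    nlinarith [Nat.zero_le (K * Y), Nat.mul_le_mul_left n h6]

end LoopLang

/-! ### Loops that search for a value, compute a set, or update an array. -/

namespace LoopLang

open WordRAM

variable {R A : Type} {n : ℕ} {G : SimpleGraph (Fin n)}

/-- The term mentions the variable. -/
def Term.ReadsVar (r : R) : Term R A → Prop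
  | .const _ => False
  | .size => False
  | .var r' => r = r'
  | .arr _ i => i.ReadsVar r
  | .op _ t₁ t₂ => t₁.ReadsVar r ∨ t₂.ReadsVar r

/-- The term mentions the array. -/
def Term.ReadsArr (a : A) : Term R A → Prop
  | .const _ => False
  | .size => False
  | .var _ => False
  | .arr a' i => a = a' ∨ i.ReadsArr a
  | .op _ t₁ t₂ => t₁.ReadsArr a ∨ t₂.ReadsArr a

/-- The formula mentions the variable. -/
def Form.ReadsVar (r : R) : Form R A → Prop
  | .eq t₁ t₂ => t₁.ReadsVar r ∨ t₂.ReadsVar r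
  | .lt t₁ t₂ => t₁.ReadsVar r ∨ t₂.ReadsVar r
  | .adj t₁ t₂ => t₁.ReadsVar r ∨ t₂.ReadsVar r
  | .not φ => φ.ReadsVar r
  | .and φ ψ => φ.ReadsVar r ∨ ψ.ReadsVar r
  | .or φ ψ => φ.ReadsVar r ∨ ψ.ReadsVar r

/-- The formula mentions the array. -/
def Form.ReadsArr (a : A) : Form R A → Prop
  | .eq t₁ t₂ => t₁.ReadsArr a ∨ t₂.ReadsArr a
  | .lt t₁ t₂ => t₁.ReadsArr a ∨ t₂.ReadsArr a
  | .adj t₁ t₂ => t₁.ReadsArr a ∨ t₂.ReadsArr a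
  | .not φ => φ.ReadsArr a
  | .and φ ψ => φ.ReadsArr a ∨ ψ.ReadsArr a
  | .or φ ψ => φ.ReadsArr a ∨ ψ.ReadsArr a

theorem Term.eval_congr {σ τ : Store R A} (t : Term R A)
    (hv : ∀ r, t.ReadsVar r → σ.var r = τ.var r) (ha : ∀ a, t.ReadsArr a → σ.arr a = τ.arr a) :
    t.eval n σ = t.eval n τ := by
  induction t with
  | const k => rfl
  | size => rfl
  | var r => exact hv r rfl
  | arr a i ih =>
    simp only [Term.eval]
    rw [ih hv fun a h => ha a (Or.inr h), ha a (Or.inl rfl)]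
  | op o t₁ t₂ ih₁ ih₂ =>
    simp only [Term.eval]
    rw [ih₁ (fun r h => hv r (Or.inl h)) fun a h => ha a (Or.inl h),
      ih₂ (fun r h => hv r (Or.inr h)) fun a h => ha a (Or.inr h)]

theorem Form.holds_congr {σ τ : Store R A} (φ : Form R A)
    (hv : ∀ r, φ.ReadsVar r → σ.var r = τ.var r) (ha : ∀ a, φ.ReadsArr a → σ.arr a = τ.arr a) :
    φ.Holds G σ ↔ φ.Holds G τ := by
  have key : ∀ t₁ t₂ : Term R A, (∀ r, t₁.ReadsVar r ∨ t₂.ReadsVar r → σ.var r = τ.var r) →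
      (∀ a, t₁.ReadsArr a ∨ t₂.ReadsArr a → σ.arr a = τ.arr a) →
      t₁.eval n σ = t₁.eval n τ ∧ t₂.eval n σ = t₂.eval n τ := fun t₁ t₂ hv ha =>
    ⟨t₁.eval_congr (fun r h => hv r (Or.inl h)) fun a h => ha a (Or.inl h),
      t₂.eval_congr (fun r h => hv r (Or.inr h)) fun a h => ha a (Or.inr h)⟩
  induction φ with
  | eq t₁ t₂ => simp only [Form.Holds, key t₁ t₂ hv ha]
  | lt t₁ t₂ => simp only [Form.Holds, key t₁ t₂ hv ha]
  | adj t₁ t₂ => simp only [Form.Holds, key t₁ t₂ hv ha]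
  | not φ ih => simp only [Form.Holds, ih hv ha]
  | and φ ψ ih₁ ih₂ =>
    simp only [Form.Holds, ih₁ (fun r h => hv r (Or.inl h)) fun a h => ha a (Or.inl h),
      ih₂ (fun r h => hv r (Or.inr h)) fun a h => ha a (Or.inr h)]
  | or φ ψ ih₁ ih₂ =>
    simp only [Form.Holds, ih₁ (fun r h => hv r (Or.inl h)) fun a h => ha a (Or.inl h),
      ih₂ (fun r h => hv r (Or.inr h)) fun a h => ha a (Or.inr h)]

/-- The command may change the array. -/
def Cmd.WritesArr (a : A) : Cmd R A → Prop
  | .skip => False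
  | .set _ _ => False
  | .put a' _ _ => a = a'
  | .seq p q => p.WritesArr a ∨ q.WritesArr a
  | .ite _ p q => p.WritesArr a ∨ q.WritesArr a
  | .forEach _ p => p.WritesArr a

theorem Store.arr_setArr_of_ne (σ : Store R A) {a a' : A} (i v : ℕ) (h : a' ≠ a) :
    (σ.setArr a i v).arr a' = σ.arr a' := by
  funext j
  simp [Store.arr_setArr, h]

theorem Cmd.arr_den (G : SimpleGraph (Fin n)) {a : A} {p : Cmd R A} (h : ¬ p.WritesArr a)
    (σ : Store R A) : (p.den G σ).arr a = σ.arr a := by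
  induction p generalizing σ with
  | skip => rfl
  | set r t => rfl
  | put a' i t => exact Store.arr_setArr_of_ne _ _ _ h
  | seq p q hp hq =>
    simp only [Cmd.WritesArr, not_or] at h
    simp only [Cmd.den]
    rw [hq h.2, hp h.1]
  | ite φ p q hp hq =>
    simp only [Cmd.WritesArr, not_or] at h
    simp only [Cmd.den]
    split_ifs
    · exact hp h.1 σ
    · exact hq h.2 σ
  | forEach r' p hp =>
    have key : ∀ k, (rounds (p.den G) r' σ k).arr a = σ.arr a := by
      intro k
      induction k with
      | zero => rfl
      | succ k ih =>
        rw [rounds, hp h]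
        exact ih
    exact key n

/-- `I k` describes the store before round `k`. The last condition is there because the loop
variable holds `n` after the loop. -/
theorem Cmd.forEach_induction {p : Cmd R A} {r : R} {σ : Store R A} (I : ℕ → Store R A → Prop)
    (h0 : I 0 σ) (hs : ∀ k < n, ∀ τ, I k τ → I (k + 1) (p.den G (τ.setVar r k)))
    (hn : ∀ τ, I n τ → I n (τ.setVar r n)) : I n ((Cmd.forEach r p).den G σ) := by
  have key : ∀ k ≤ n, I k (rounds (p.den G) r σ k) := by
    intro k
    induction k with
    | zero => exact fun _ => h0
    | succ k ih => exact fun hk => hs k hk _ (ih (by omega))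
  exact hn _ (key n le_rfl)

/-- Change a variable whenever the formula holds. -/
def Cmd.search (u : R) (φ : Form R A) (r : R) (t : Term R A) : Cmd R A :=
  .forEach u (.ite φ (.set r t) .skip)

/-- It is left open which of the suitable values is used. As neither formula nor term mentions `r`,
earlier assignments do not influence later tests, and everything can be evaluated in the original
store. -/
theorem Cmd.den_search {u r : R} {φ : Form R A} {t : Term R A} (σ : Store R A) (hu : u ≠ r)
    (hφ : ¬ φ.ReadsVar r) (ht : ¬ t.ReadsVar r) :
    (∃ j < n, φ.Holds G (σ.setVar u j) ∧
      ((Cmd.search u φ r t).den G σ).var r = t.eval n (σ.setVar u j) % (n + 2)) ∨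
    ((∀ j < n, ¬ φ.Holds G (σ.setVar u j)) ∧ ((Cmd.search u φ r t).den G σ).var r = σ.var r) := by
  have key := Cmd.forEach_induction (G := G) (p := .ite φ (.set r t) .skip) (r := u) (σ := σ)
    (fun k τ => (∀ w, w ≠ u → w ≠ r → τ.var w = σ.var w) ∧ τ.arr = σ.arr ∧
      ((∃ j < k, φ.Holds G (σ.setVar u j) ∧ τ.var r = t.eval n (σ.setVar u j) % (n + 2)) ∨
      ((∀ j < k, ¬ φ.Holds G (σ.setVar u j)) ∧ τ.var r = σ.var r))) ?_ ?_ ?_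
  · exact key.2.2
  · exact ⟨fun _ _ _ => rfl, rfl, Or.inr ⟨fun j hj => absurd hj (Nat.not_lt_zero j), rfl⟩⟩
  · intro k hk τ ⟨h1, h2, h3⟩
    have hvar : ∀ w, w ≠ r → (τ.setVar u k).var w = (σ.setVar u k).var w := by
      intro w hw
      by_cases hwu : w = u
      · simp [hwu]
      · simp [Store.var_setVar_of_ne _ _ hwu, h1 w hwu hw]
    have hφ' : φ.Holds G (τ.setVar u k) ↔ φ.Holds G (σ.setVar u k) :=
      φ.holds_congr (fun w hw => hvar w fun e => hφ (e ▸ hw)) fun a _ => by simp [h2]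
    have ht' : t.eval n (τ.setVar u k) = t.eval n (σ.setVar u k) :=
      t.eval_congr (fun w hw => hvar w fun e => ht (e ▸ hw)) fun a _ => by simp [h2]
    simp only [Cmd.den]
    split_ifs with hc
    · refine ⟨fun w hw hwr => ?_, h2, Or.inl ⟨k, by omega, hφ'.1 hc, ?_⟩⟩
      · rw [Store.var_setVar_of_ne _ _ hwr, hvar w hwr, Store.var_setVar_of_ne _ _ hw]
      · simp [ht']
    · refine ⟨fun w hw hwr => ?_, h2, ?_⟩
      · rw [hvar w hwr, Store.var_setVar_of_ne _ _ hw]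
      · rw [Store.var_setVar_of_ne _ _ hu.symm]
        rcases h3 with ⟨j, hj, h3⟩ | ⟨h3, h4⟩
        · exact Or.inl ⟨j, by omega, h3⟩
        · refine Or.inr ⟨fun j hj => ?_, h4⟩
          rcases Nat.lt_succ_iff_lt_or_eq.1 hj with hj | rfl
          · exact h3 j hj
          · rwa [← hφ']
  · intro τ ⟨h1, h2, h3⟩
    refine ⟨fun w hw hwr => ?_, h2, ?_⟩
    · rw [Store.var_setVar_of_ne _ _ hw, h1 w hw hwr]
    · rwa [Store.var_setVar_of_ne _ _ hu.symm]

/-- Record in an array for which values of `v` there is a value of `u` that satisfies the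
formula. -/
def Cmd.mark (a : A) (v u : R) (φ : Form R A) : Cmd R A :=
  .forEach v (.seq (.put a (.var v) (.const 0)) (.forEach u (.ite φ (.put a (.var v) (.const 1))
    .skip)))

/-- The formula does not mention the array that is being written, so each test sees the original
arrays. -/
theorem Cmd.den_mark {a : A} {v u : R} {φ : Form R A} (σ : Store R A) (hvu : v ≠ u)
    (hφ : ¬ φ.ReadsArr a) {i : ℕ} (hi : i < n) :
    ((Cmd.mark a v u φ).den G σ).arr a i ≠ 0 ↔
      ∃ j < n, φ.Holds G ((σ.setVar v i).setVar u j) := by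
  have key := Cmd.forEach_induction (G := G) (p := .seq (.put a (.var v) (.const 0))
    (.forEach u (.ite φ (.put a (.var v) (.const 1)) .skip))) (r := v) (σ := σ)
    (fun k τ => (∀ w, w ≠ u → w ≠ v → τ.var w = σ.var w) ∧ (∀ b, b ≠ a → τ.arr b = σ.arr b) ∧
      ∀ i < k, (τ.arr a i ≠ 0 ↔ ∃ j < n, φ.Holds G ((σ.setVar v i).setVar u j))) ?_ ?_ ?_
  · exact key.2.2 i hi
  · exact ⟨fun _ _ _ => rfl, fun _ _ => rfl, fun i hi => absurd hi (Nat.not_lt_zero i)⟩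
  · intro k hk τ ⟨h1, h2, h3⟩
    simp only [Cmd.den]
    have key := Cmd.forEach_induction (G := G) (p := .ite φ (.put a (.var v) (.const 1)) .skip)
      (r := u) (σ := (τ.setVar v k).setArr a k 0)
      (fun l ρ => (∀ w, w ≠ u → w ≠ v → ρ.var w = σ.var w) ∧ ρ.var v = k ∧
        (∀ b, b ≠ a → ρ.arr b = σ.arr b) ∧ (∀ i, i ≠ k → ρ.arr a i = τ.arr a i) ∧
        (ρ.arr a k ≠ 0 ↔ ∃ j < l, φ.Holds G ((σ.setVar v k).setVar u j))) ?_ ?_ ?_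
    · obtain ⟨k1, k2, k3, k4, k5⟩ := key
      simp only [Cmd.den, Term.eval, Store.var_setVar_self, Nat.zero_mod] at k1 k2 k3 k4 k5 ⊢
      refine ⟨k1, k3, fun i hi => ?_⟩
      rcases Nat.lt_succ_iff_lt_or_eq.1 hi with hi | rfl
      · rw [k4 i (by omega)]
        exact h3 i hi
      · exact k5
    · refine ⟨fun w hw hwv => ?_, by simp, fun b hb => ?_, fun i hi => ?_, ?_⟩
      · rw [Store.var_setArr, Store.var_setVar_of_ne _ _ hwv, h1 w hw hwv]
      · rw [Store.arr_setArr_of_ne _ _ _ hb, Store.arr_setVar, h2 b hb]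
      · simp [Store.arr_setArr, hi]
      · simp [Store.arr_setArr]
    · intro l hl ρ ⟨k1, k2, k3, k4, k5⟩
      have hφ' : φ.Holds G (ρ.setVar u l) ↔ φ.Holds G ((σ.setVar v k).setVar u l) := by
        refine φ.holds_congr (fun w _ => ?_) fun b hb => ?_
        · by_cases hwu : w = u
          · simp [hwu]
          · rw [Store.var_setVar_of_ne _ _ hwu, Store.var_setVar_of_ne _ _ hwu]
            by_cases hwv : w = v
            · simp [hwv, k2]
            · rw [Store.var_setVar_of_ne _ _ hwv, k1 w hwu hwv]
        · simp only [Store.arr_setVar]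
          exact k3 b fun e => hφ (e ▸ hb)
      have hv : (ρ.setVar u l).var v = k := by rw [Store.var_setVar_of_ne _ _ hvu, k2]
      have hk1 : ∀ w, w ≠ u → w ≠ v → (ρ.setVar u l).var w = σ.var w := fun w hw hwv => by
        rw [Store.var_setVar_of_ne _ _ hw, k1 w hw hwv]
      simp only [Cmd.den, Term.eval, hv]
      split_ifs with hc
      · refine ⟨hk1, hv, fun b hb => ?_, fun i hi => ?_, ?_⟩
        · rw [Store.arr_setArr_of_ne _ _ _ hb, Store.arr_setVar, k3 b hb]
        · simp [Store.arr_setArr, hi, k4]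
        · simp only [Store.arr_setArr, and_self, if_true]
          simp only [Nat.mod_eq_of_lt (show 1 < n + 2 by omega), ne_eq, one_ne_zero,
            not_false_eq_true, true_iff]
          exact ⟨l, by omega, hφ'.1 hc⟩
      · refine ⟨hk1, hv, k3, k4, ?_⟩
        rw [Store.arr_setVar, k5]
        constructor
        · rintro ⟨j, hj, h⟩
          exact ⟨j, by omega, h⟩
        · rintro ⟨j, hj, h⟩
          rcases Nat.lt_succ_iff_lt_or_eq.1 hj with hj | rfl
          · exact ⟨j, hj, h⟩
          · exact absurd (hφ'.2 h) hc
    · intro ρ ⟨k1, k2, k3, k4, k5⟩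
      refine ⟨fun w hw hwv => ?_, ?_, k3, k4, k5⟩
      · rw [Store.var_setVar_of_ne _ _ hw, k1 w hw hwv]
      · rw [Store.var_setVar_of_ne _ _ hvu, k2]
  · intro τ ⟨h1, h2, h3⟩
    refine ⟨fun w hw hwv => ?_, h2, h3⟩
    rw [Store.var_setVar_of_ne _ _ hwv, h1 w hw hwv]

end LoopLang

namespace LoopLang

open WordRAM LongOddHole

variable {R A : Type} {n : ℕ} {G : SimpleGraph (Fin n)}

/-- Change the entries of an array for which the formula holds. -/
def Cmd.update (a : A) (v : R) (φ : Form R A) (t : Term R A) : Cmd R A :=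
  .forEach v (.ite φ (.put a (.var v) t) .skip)

open Classical in
theorem Cmd.den_update {a : A} {v : R} {φ : Form R A} {t : Term R A} (σ : Store R A)
    (hφ : ¬ φ.ReadsArr a) (ht : ¬ t.ReadsArr a) {i : ℕ} (hi : i < n) :
    ((Cmd.update a v φ t).den G σ).arr a i =
      if φ.Holds G (σ.setVar v i) then t.eval n (σ.setVar v i) % (n + 2) else σ.arr a i := by
  have key := Cmd.forEach_induction (G := G) (p := .ite φ (.put a (.var v) t) .skip) (r := v)
    (σ := σ) (fun k τ => (∀ w, w ≠ v → τ.var w = σ.var w) ∧ (∀ b, b ≠ a → τ.arr b = σ.arr b) ∧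
      (∀ i, k ≤ i → τ.arr a i = σ.arr a i) ∧ ∀ i < k, τ.arr a i =
      if φ.Holds G (σ.setVar v i) then t.eval n (σ.setVar v i) % (n + 2) else σ.arr a i) ?_ ?_ ?_
  · exact key.2.2.2 i hi
  · exact ⟨fun _ _ => rfl, fun _ _ => rfl, fun _ _ => rfl,
      fun i hi => absurd hi (Nat.not_lt_zero i)⟩
  · intro k hk τ ⟨h1, h2, h3, h4⟩
    have hvar : ∀ w, (τ.setVar v k).var w = (σ.setVar v k).var w := by
      intro w
      by_cases hwv : w = v
      · simp [hwv]
      · rw [Store.var_setVar_of_ne _ _ hwv, Store.var_setVar_of_ne _ _ hwv, h1 w hwv]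
    have hφ' : φ.Holds G (τ.setVar v k) ↔ φ.Holds G (σ.setVar v k) :=
      φ.holds_congr (fun w _ => hvar w) fun b hb => h2 b fun e => hφ (e ▸ hb)
    have ht' : t.eval n (τ.setVar v k) = t.eval n (σ.setVar v k) :=
      t.eval_congr (fun w _ => hvar w) fun b hb => h2 b fun e => ht (e ▸ hb)
    have hv : ∀ w, w ≠ v → (τ.setVar v k).var w = σ.var w := fun w hw => by
      rw [Store.var_setVar_of_ne _ _ hw, h1 w hw]
    simp only [Cmd.den, Term.eval, Store.var_setVar_self]
    split_ifs with hc
    · rw [hφ'] at hc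
      refine ⟨hv, fun b hb => ?_, fun i hi => ?_, fun i hi => ?_⟩
      · rw [Store.arr_setArr_of_ne _ _ _ hb, Store.arr_setVar, h2 b hb]
      · rw [Store.arr_setArr, if_neg (by omega)]
        exact h3 i (by omega)
      · rw [Store.arr_setArr]
        rcases Nat.lt_succ_iff_lt_or_eq.1 hi with hi | rfl
        · rw [if_neg (by omega)]
          exact h4 i hi
        · rw [if_pos ⟨rfl, rfl⟩, if_pos hc, ht']
    · rw [hφ'] at hc
      refine ⟨hv, h2, fun i hi => h3 i (by omega), fun i hi => ?_⟩
      rcases Nat.lt_succ_iff_lt_or_eq.1 hi with hi | rfl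
      · exact h4 i hi
      · rw [if_neg hc]
        exact h3 i le_rfl
  · intro τ ⟨h1, h2, h3, h4⟩
    refine ⟨fun w hw => ?_, h2, h3, h4⟩
    rw [Store.var_setVar_of_ne _ _ hw, h1 w hw]

end LoopLang

/-! ### Breadth-first search within a set of vertices. -/

namespace LongOddHole

open WordRAM LoopLang

variable {n : ℕ} {G : SimpleGraph (Fin n)}

/-- The variables of the program. -/
inductive Var where
  | flag | x | d₁ | d₂ | m | m' | len | base | cur | nxt | ok | step | v | u

/-- The arrays of the program. -/
inductive Arr where
  | near | far | geod | hit | allowed | distA | distB | distC | distT | list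

theorem Conn.succ_iff {V : Type*} {G : SimpleGraph V} {A : V → Prop} {k : ℕ} {v t : V} :
    Conn G A (k + 1) v t ↔ A v ∧ ∃ u, G.Adj v u ∧ Conn G A k u t := by
  constructor
  · rintro ⟨P, h0, hk, hadj, hA⟩
    refine ⟨h0 ▸ hA 0 (by omega), P 1, h0 ▸ hadj 0 (by omega), fun i => P (i + 1), rfl, hk,
      fun i hi => hadj (i + 1) (by omega), fun i hi => hA (i + 1) (by omega)⟩
  · rintro ⟨hv, u, hadj, h⟩
    obtain ⟨P, h0, -, -, hA⟩ := id h
    have := (Conn.single hv (h0 ▸ hA 0 (by omega)) hadj).append h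
    rwa [add_comm] at this

/-- One round of breadth-first search: give the next distance to the vertices of the set given
by `mask` that have a neighbour at distance `step` and have not been reached before. -/
def bfsRound (mask dist : Arr) : Cmd Var Arr :=
  .seq
    (.mark .hit .v .u (.and
      (.and (.adj (.var .v) (.var .u)) (.eq (.arr dist (.var .u)) (.var .step)))
      (.and (.not (.eq (.arr mask (.var .v)) (.const 0)))
        (.eq (.arr dist (.var .v)) (.op .add .size (.const 1))))))
    (.update dist .v (.not (.eq (.arr .hit (.var .v)) (.const 0)))
      (.op .add (.var .step) (.const 1)))

/-- Distances to the vertex `tgt` within the set given by the array `mask`. -/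
def bfs (mask dist : Arr) (tgt : Var) : Cmd Var Arr :=
  .seq (.seq (.update dist .v (.eq .size .size) (.op .add .size (.const 1)))
      (.put dist (.var tgt) (.const 0)))
    (.forEach .step (bfsRound mask dist))

/-- After `r` rounds the values at most `r` are the true distances, and every other entry is `n +
1`, standing for infinity. New vertices are first collected in `hit`, so a round does not read
distances that it has just written. -/
theorem den_bfs {mask dist : Arr} {tgt : Var} (h₁ : mask ≠ .hit) (h₂ : mask ≠ dist)
    (h₃ : dist ≠ .hit) (h₅ : tgt ≠ .v) (σ : Store Var Arr)
    {A : Fin n → Prop} (hA : ∀ v : Fin n, σ.arr mask v ≠ 0 ↔ A v) {t : Fin n}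
    (ht : σ.var tgt = t) (hAt : A t) (v : Fin n) {k : ℕ} (hk : k ≤ n) :
    ((bfs mask dist tgt).den G σ).arr dist v ≤ k ↔ ∃ j ≤ k, Conn G A j v t := by
  have key : ∀ τ : Store Var Arr, (∀ v : Fin n, τ.arr mask v ≠ 0 ↔ A v) →
      (∀ v : Fin n, τ.arr dist v = if v = t then 0 else n + 1) → ∀ v : Fin n, ∀ k ≤ n,
      (((Cmd.forEach .step (bfsRound mask dist)).den G τ).arr dist v ≤ k ↔
        ∃ j ≤ k, Conn G A j v t) := by
    intro τ h6 h7
    refine (Cmd.forEach_induction (fun r ρ => (∀ v : Fin n, ρ.arr mask v ≠ 0 ↔ A v) ∧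
      (∀ v : Fin n, ρ.arr dist v ≤ r ∨ ρ.arr dist v = n + 1) ∧
      ∀ v : Fin n, ∀ k ≤ r, (ρ.arr dist v ≤ k ↔ ∃ j ≤ k, Conn G A j v t)) ?_ ?_ ?_).2.2
    · refine ⟨h6, fun v => ?_, fun v k hk => ?_⟩
      · rw [h7]
        split_ifs <;> simp
      · obtain rfl : k = 0 := by omega
        rw [h7]
        constructor
        · intro h
          split_ifs at h with hv
          · exact ⟨0, le_rfl, hv.symm ▸ Conn.refl hAt⟩
          · omega
        · rintro ⟨j, hj, P, h0, hj', -⟩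
          obtain rfl : j = 0 := by omega
          rw [if_pos (h0.symm.trans hj')]
    · rintro r hr ρ ⟨k1, k2, k3⟩
      simp only [bfsRound, Cmd.den]
      set ρ' := (Cmd.mark Arr.hit Var.v Var.u _).den G (ρ.setVar .step r) with hρ'
      have e1 : ρ'.arr mask = ρ.arr mask :=
        Cmd.arr_den G (by simp [Cmd.mark, Cmd.WritesArr, h₁]) _
      have e2 : ρ'.arr dist = ρ.arr dist :=
        Cmd.arr_den G (by simp [Cmd.mark, Cmd.WritesArr, h₃]) _
      have e3 : ρ'.var .step = r := by
        rw [hρ', Cmd.var_den G (by simp [Cmd.mark, Cmd.Writes])]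
        simp
      have e4 : ∀ v : Fin n, ρ'.arr .hit v ≠ 0 ↔
          (∃ u, G.Adj v u ∧ ρ.arr dist u = r) ∧ A v ∧ ρ.arr dist v = n + 1 := by
        intro v
        rw [hρ', Cmd.den_mark _ (by simp)
          (by simp [Form.ReadsArr, Term.ReadsArr, h₁.symm, h₃.symm]) v.2]
        simp only [Form.Holds, Term.eval, BinOp.eval, Store.arr_setVar, Store.var_setVar]
        rw [← k1 v]
        constructor
        · rintro ⟨j, hj, ⟨h8, h9⟩, h10, h11⟩
          refine ⟨⟨⟨j, hj⟩, ?_, ?_⟩, ?_, ?_⟩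
          · simpa using (adjNum_val G v ⟨j, hj⟩).1 (by simpa using h8)
          · simpa using h9
          · simpa using h10
          · simpa using h11
        · rintro ⟨⟨u, h8, h9⟩, h10, h11⟩
          refine ⟨u, u.2, ⟨?_, ?_⟩, ?_, ?_⟩
          · simpa using h8
          · simpa using h9
          · simpa using h10
          · simpa using h11
      have e5 : ((Cmd.update dist .v (.not (.eq (.arr .hit (.var .v)) (.const 0)))
        (.op .add (.var .step) (.const 1))).den G ρ').arr mask = ρ.arr mask := by
        rw [Cmd.arr_den G (by simp [Cmd.update, Cmd.WritesArr, h₂]), e1]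
      have e6 : ∀ v : Fin n, ((Cmd.update dist .v (.not (.eq (.arr .hit (.var .v)) (.const 0)))
        (.op .add (.var .step) (.const 1))).den G ρ').arr dist v =
          if ρ'.arr .hit v ≠ 0 then r + 1 else ρ.arr dist v := by
        intro v
        rw [Cmd.den_update _ (by simp [Form.ReadsArr, Term.ReadsArr, h₃])
          (by simp [Term.ReadsArr]) v.2]
        simp only [Form.Holds, Term.eval, BinOp.eval, Store.arr_setVar, Store.var_setVar]
        simp [e2, e3, Nat.mod_eq_of_lt (show r + 1 < n + 2 by omega)]
      refine ⟨fun v => by rw [e5, k1], fun v => ?_, fun v k hk => ?_⟩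
      · rw [e6]
        split_ifs with hc
        · exact Or.inl le_rfl
        · rcases k2 v with h | h
          · exact Or.inl (by omega)
          · exact Or.inr h
      · rw [e6]
        rcases Nat.lt_or_ge r k with hrk | hrk
        · obtain rfl : k = r + 1 := by omega
          have h8 : (∃ j ≤ r + 1, Conn G A j v t) ↔
              (∃ j ≤ r, Conn G A j v t) ∨ Conn G A (r + 1) v t := by
            constructor
            · rintro ⟨j, hj, h⟩
              rcases eq_or_lt_of_le hj with rfl | hj
              · exact Or.inr h
              · exact Or.inl ⟨j, by omega, h⟩
            · rintro (⟨j, hj, h⟩ | h)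
              · exact ⟨j, by omega, h⟩
              · exact ⟨r + 1, le_rfl, h⟩
          rw [h8, ← k3 v r le_rfl]
          by_cases h9 : ρ.arr dist v ≤ r
          · have : ¬ ρ'.arr .hit v ≠ 0 := by
              rw [e4]
              rintro ⟨-, -, h⟩
              omega
            rw [if_neg this]
            exact iff_of_true (by omega) (Or.inl h9)
          · have h10 := (k2 v).resolve_left h9
            have h11 : ρ'.arr .hit v ≠ 0 ↔ Conn G A (r + 1) v t := by
              rw [e4, Conn.succ_iff]
              constructor
              · rintro ⟨⟨u, h12, h13⟩, h14, -⟩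
                obtain ⟨j, hj, h15⟩ := (k3 u r le_rfl).1 h13.le
                refine ⟨h14, u, h12, ?_⟩
                rcases eq_or_lt_of_le hj with rfl | hj
                · exact h15
                · have := (k3 u j hj.le).2 ⟨j, le_rfl, h15⟩
                  omega
              · rintro ⟨h14, u, h12, h13⟩
                refine ⟨⟨u, h12, ?_⟩, h14, h10⟩
                have h15 := (k3 u r le_rfl).2 ⟨r, le_rfl, h13⟩
                -- If `u` were closer than `r`, then `v` would have been reached before this round.
                by_contra hne
                obtain ⟨j, hj, h16⟩ := (k3 u (r - 1) (by omega)).1 (by omega)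
                refine h9 ((k3 v r le_rfl).2 ⟨j + 1, by omega, ?_⟩)
                rw [Conn.succ_iff]
                exact ⟨h14, u, h12, h16⟩
            rw [← h11]
            split_ifs with hc
            · exact iff_of_true le_rfl (Or.inr hc)
            · exact iff_of_false (by omega) (by rintro (h | h); exacts [h9 h, hc h])
        · rw [← k3 v k hrk]
          split_ifs with hc
          · have := ((e4 v).1 hc).2.2
            omega
          · rfl
    · exact fun _ h => h
  refine key _ (fun v => ?_) (fun v => ?_) v k hk
  · rw [← hA, Cmd.arr_den G (by simp [Cmd.update, Cmd.WritesArr, h₂])]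
  · simp only [Cmd.den, Term.eval]
    rw [Cmd.var_den G (by simp [Cmd.update, Cmd.Writes, h₅]), ht, Store.arr_setArr,
      Cmd.den_update _ (by simp [Form.ReadsArr, Term.ReadsArr]) (by simp [Term.ReadsArr]) v.2]
    simp [Form.Holds, Term.eval, BinOp.eval, Fin.ext_iff]

end LongOddHole

/-! ### Following decreasing distances to list a shortest path. -/

namespace LongOddHole

open WordRAM LoopLang

variable {n : ℕ} {G : SimpleGraph (Fin n)}

/-- One step of a shortest path, appended to the list. -/
def walkStep : Cmd Var Arr :=
  .ite (.not (.eq (.arr .distT (.var .cur)) (.const 0)))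
    (.seq (.put .list (.var .len) (.var .cur))
      (.seq (.set .len (.op .add (.var .len) (.const 1)))
        (.seq (.search .u (.and (.adj (.var .cur) (.var .u))
            (.eq (.op .add (.arr .distT (.var .u)) (.const 1)) (.arr .distT (.var .cur))))
            .nxt (.var .u))
          (.set .cur (.var .nxt)))))
    .skip

theorem den_walkStep_of_eq {σ : Store Var Arr} (h : σ.arr .distT (σ.var .cur) = 0) :
    walkStep.den G σ = σ := by
  simp [walkStep, Cmd.den, Form.Holds, Term.eval, h]

theorem den_walkStep {σ : Store Var Arr} {c : Fin n} (hc : σ.var .cur = c)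
    (h : σ.arr .distT c ≠ 0) (hlen : σ.var .len < n)
    (hex : ∃ u : Fin n, G.Adj c u ∧ σ.arr .distT u + 1 = σ.arr .distT c) :
    ∃ u : Fin n, G.Adj c u ∧ σ.arr .distT u + 1 = σ.arr .distT c ∧
      (walkStep.den G σ).var .cur = u ∧ (walkStep.den G σ).var .len = σ.var .len + 1 ∧
      ∀ i, (walkStep.den G σ).arr .list i = if i = σ.var .len then (c : ℕ) else σ.arr .list i := by
  have h0 : (Form.not (.eq (.arr .distT (.var .cur)) (.const 0)) : Form Var Arr).Holds G σ := by
    simpa [Form.Holds, Term.eval, hc] using h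
  simp only [walkStep, Cmd.den, if_pos h0, Term.eval, BinOp.eval]
  rw [Nat.mod_eq_of_lt (show σ.var .cur < n + 2 by omega), Store.var_setArr,
    Nat.mod_eq_of_lt (show σ.var .len + 1 < n + 2 by omega)]
  set τ := (σ.setArr .list (σ.var .len) (σ.var .cur)).setVar .len (σ.var .len + 1) with hτ
  have e1 : τ.var .cur = c := by rw [hτ, Store.var_setVar_of_ne _ _ (by simp)]; exact hc
  have e2 : τ.arr .distT = σ.arr .distT := by
    rw [hτ, Store.arr_setVar, Store.arr_setArr_of_ne _ _ _ (by simp)]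
  have e3 : ∀ j : ℕ, (Form.and (.adj (.var .cur) (.var .u))
      (.eq (.op .add (.arr .distT (.var .u)) (.const 1)) (.arr .distT (.var .cur))) :
      Form Var Arr).Holds G (τ.setVar .u j) ↔
      AdjNum G c j ∧ σ.arr .distT j + 1 = σ.arr .distT c := by
    intro j
    simp [Form.Holds, Term.eval, BinOp.eval, Store.var_setVar_of_ne, e1, e2]
  rcases Cmd.den_search (G := G) (u := Var.u) (r := Var.nxt) (φ := (.and (.adj (.var .cur)
    (.var .u)) (.eq (.op .add (.arr .distT (.var .u)) (.const 1)) (.arr .distT (.var .cur)))))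
    (t := .var .u) τ (by simp) (by simp [Form.ReadsVar, Term.ReadsVar])
    (by simp [Term.ReadsVar]) with ⟨j, hj, h1, h2⟩ | ⟨h1, -⟩
  · rw [e3] at h1
    refine ⟨⟨j, hj⟩, (adjNum_val G c ⟨j, hj⟩).1 h1.1, h1.2, ?_, ?_, fun i => ?_⟩
    · rw [Store.var_setVar_self, h2]
      simp only [Term.eval, Store.var_setVar_self, Nat.mod_mod]
      exact Nat.mod_eq_of_lt (by omega)
    · rw [Store.var_setVar_of_ne _ _ (by simp),
        Cmd.var_den G (by simp [Cmd.search, Cmd.Writes])]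
      simp [hτ]
    · rw [Store.arr_setVar, Cmd.arr_den G (by simp [Cmd.search, Cmd.WritesArr])]
      simp [hτ, Store.arr_setArr, hc]
  · obtain ⟨u, h3, h4⟩ := hex
    exact absurd ((e3 u).2 ⟨(adjNum_val G c u).2 h3, h4⟩) (h1 u u.2)

/-- A walk along decreasing distances produces a geodesic. -/
theorem den_forEach_walkStep {σ : Store Var Arr} {B : Fin n → Prop} {s t : Fin n} {k : ℕ}
    (hs : σ.var .cur = s) (hlen : σ.var .len + k ≤ n)
    (hdist : ∀ v : Fin n, ∀ k ≤ n, σ.arr .distT v ≤ k ↔ ∃ j ≤ k, Conn G B j v t)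
    (hk : Conn G B k s t) (hmin : ∀ j < k, ¬ Conn G B j s t) :
    ∃ w, IsGeodesic G B s t k w ∧
      ((Cmd.forEach .step walkStep).den G σ).var .len = σ.var .len + k ∧
      (∀ i < k, ((Cmd.forEach .step walkStep).den G σ).arr .list (σ.var .len + i) = w i) ∧
      ∀ i < σ.var .len, ((Cmd.forEach .step walkStep).den G σ).arr .list i = σ.arr .list i := by
  have hconn : ∀ v : Fin n, ∀ l ≤ n, σ.arr .distT v = l → Conn G B l v t := by
    intro v l hl h
    obtain ⟨j, hj, h1⟩ := (hdist v l hl).1 h.le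
    have h2 : σ.arr .distT v ≤ j := (hdist v j (by omega)).2 ⟨j, le_rfl, h1⟩
    obtain rfl : j = l := by omega
    exact h1
  have hs0 : σ.arr .distT s = k := by
    have h1 := (hdist s k (by omega)).2 ⟨k, le_rfl, hk⟩
    by_contra hne
    exact hmin _ (by omega) (hconn s _ (by omega) rfl)
  -- The loop has `n` rounds but only `k` of them move; once the distance is zero, `walkStep` does
  -- nothing. Hence `min i k`.
  have key := Cmd.forEach_induction (G := G) (p := walkStep) (r := .step) (σ := σ)
    (fun i τ => τ.arr .distT = σ.arr .distT ∧ (∀ j < σ.var .len, τ.arr .list j = σ.arr .list j) ∧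
      τ.var .len = σ.var .len + min i k ∧ ∃ w : ℕ → Fin n, w 0 = s ∧ τ.var .cur = w (min i k) ∧
      (∀ j < min i k, G.Adj (w j) (w (j + 1)) ∧ τ.arr .list (σ.var .len + j) = w j) ∧
      ∀ j ≤ min i k, σ.arr .distT (w j) = k - j) ?_ ?_ ?_
  · obtain ⟨-, h2, h3, w, h4, h5, h6, h7⟩ := key
    rw [Nat.min_eq_right (by omega)] at h3 h5 h6 h7
    refine ⟨w, ⟨h4, ?_, fun i hi => (h6 i hi).1, fun i hi => ?_, hmin⟩, h3,
      fun i hi => (h6 i hi).2, h2⟩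
    · obtain ⟨P, h8, h9, -⟩ := hconn (w k) 0 (by omega) (by rw [h7 k le_rfl]; omega)
      exact h8.symm.trans h9
    · obtain ⟨P, h8, -, -, h9⟩ := hconn (w i) (k - i) (by omega) (h7 i hi)
      exact h8 ▸ h9 0 (by omega)
  · refine ⟨rfl, fun _ _ => rfl, by simp, fun _ => s, rfl, by simpa using hs,
      fun j hj => by omega, fun j hj => ?_⟩
    obtain rfl : j = 0 := by omega
    simpa using hs0
  · intro i hi τ ⟨h1, h2, h3, w, h4, h5, h6, h7⟩
    have e1 : (walkStep.den G (τ.setVar .step i)).arr .distT = σ.arr .distT := by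
      rw [Cmd.arr_den G (by simp [walkStep, Cmd.search, Cmd.WritesArr]), Store.arr_setVar, h1]
    have hcur : (τ.setVar .step i).var .cur = w (min i k) := by
      rw [Store.var_setVar_of_ne _ _ (by simp), h5]
    rcases Nat.lt_or_ge i k with hik | hik
    · rw [Nat.min_eq_left hik.le] at h3 h5 h6 h7 hcur
      have h8 := h7 i le_rfl
      have hlen' : (τ.setVar .step i).var .len = σ.var .len + i := by
        rw [Store.var_setVar_of_ne _ _ (by simp), h3]
      obtain ⟨u, k1, k2, k3, k4, k5⟩ := den_walkStep (G := G) hcur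
        (by rw [Store.arr_setVar, h1, h8]; omega) (by omega) (by
          rw [Store.arr_setVar, h1, h8]
          have h9 := hconn _ (k - i) (by omega) h8
          obtain ⟨l, hl⟩ : ∃ l, k - i = l + 1 := ⟨k - i - 1, by omega⟩
          rw [hl, Conn.succ_iff] at h9
          obtain ⟨h10, u, h11, h12⟩ := h9
          refine ⟨u, h11, ?_⟩
          have h13 := (hdist u l (by omega)).2 ⟨l, le_rfl, h12⟩
          by_contra hne
          have h14 := hconn u _ (by omega) rfl
          have h15 : Conn G B (σ.arr .distT u + 1) (w i) t := Conn.succ_iff.2 ⟨h10, u, h11, h14⟩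
          have := (hdist (w i) (σ.arr .distT u + 1) (by omega)).2 ⟨_, le_rfl, h15⟩
          omega)
      rw [Store.arr_setVar, h1, h8] at k2
      rw [Nat.min_eq_left (show i + 1 ≤ k by omega)]
      refine ⟨e1, fun j hj => ?_, ?_, fun j => if j ≤ i then w j else u, by simp [h4], ?_,
        fun j hj => ?_, fun j hj => ?_⟩
      · rw [k5, if_neg (by omega)]
        exact h2 j hj
      · rw [k4, hlen']
        omega
      · rw [k3]
        simp
      · dsimp only
        rw [k5, hlen']
        rcases Nat.lt_succ_iff_lt_or_eq.1 hj with hj | rfl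
        · rw [if_pos hj.le, if_pos (show j + 1 ≤ i by omega),
            if_neg (show ¬ σ.var .len + j = σ.var .len + i by omega)]
          exact h6 j hj
        · rw [if_pos rfl, if_pos le_rfl, if_neg (by omega)]
          exact ⟨k1, rfl⟩
      · dsimp only
        rcases Nat.le_succ_iff.1 hj with hj | rfl
        · rw [if_pos hj]
          exact h7 j hj
        · rw [if_neg (by omega)]
          omega
    · rw [Nat.min_eq_right hik] at h3 h5 h6 h7 hcur
      rw [Nat.min_eq_right (show k ≤ i + 1 by omega), den_walkStep_of_eq
        (by rw [hcur, Store.arr_setVar, h1, h7 k le_rfl]; omega)]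
      refine ⟨h1, h2, ?_, w, h4, hcur, h6, h7⟩
      rw [Store.var_setVar_of_ne _ _ (by simp), h3]
  · intro τ ⟨h1, h2, h3, w, h4, h5, h6⟩
    refine ⟨h1, h2, ?_, w, h4, ?_, h6⟩
    · rw [Store.var_setVar_of_ne _ _ (by simp), h3]
    · rw [Store.var_setVar_of_ne _ _ (by simp), h5]

/-- Append to the list a shortest path from `src` to `tgt` without its last vertex, within the set
given by `mask`, and avoiding the closed neighbourhood of the list from position `base` on. -/
def segment (mask : Arr) (src tgt : Var) : Cmd Var Arr :=
  .seq (.mark .hit .v .u (.and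
    (.and (.not (.lt (.var .u) (.var .base))) (.lt (.var .u) (.var .len)))
    (.or (.eq (.var .v) (.arr .list (.var .u))) (.adj (.var .v) (.arr .list (.var .u))))))
  (.seq (.mark .allowed .v .u (.and (.not (.eq (.arr mask (.var .v)) (.const 0)))
    (.or (.eq (.var .v) (.var src)) (.eq (.arr .hit (.var .v)) (.const 0)))))
  (.seq (bfs .allowed .distT tgt)
  (.seq (.set .cur (.var src)) (.forEach .step walkStep))))

/-- The list from position `base` on holds `w 0, …, w (p - 1)`, without the end `w p = s` from which
the new path starts. Forbidding the closed neighbourhoods of the listed vertices, except for `s`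
itself, gives exactly `Remaining G A w p`. -/
theorem den_segment {mask : Arr} {src tgt : Var} {σ : Store Var Arr} {A : Fin n → Prop}
    {s t : Fin n} {p k : ℕ} {w : ℕ → Fin n}
    (hm : mask ≠ .hit) (hm' : mask ≠ .allowed) (hs : src ≠ .v ∧ src ≠ .u ∧ src ≠ .step)
    (ht : tgt ≠ .v ∧ tgt ≠ .u)
    (hA : ∀ v : Fin n, σ.arr mask v ≠ 0 ↔ A v) (hsrc : σ.var src = s) (htgt : σ.var tgt = t)
    (hlen : σ.var .len = σ.var .base + p) (hlist : ∀ i < p, σ.arr .list (σ.var .base + i) = w i)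
    (hwp : w p = s) (hn : σ.var .len + k ≤ n) (hk : Conn G (Remaining G A w p) k s t)
    (hmin : ∀ j < k, ¬ Conn G (Remaining G A w p) j s t) :
    ∃ w', IsGeodesic G (Remaining G A w p) s t k w' ∧
      ((segment mask src tgt).den G σ).var .len = σ.var .len + k ∧
      (∀ i < k, ((segment mask src tgt).den G σ).arr .list (σ.var .len + i) = w' i) ∧
      ∀ i < σ.var .len, ((segment mask src tgt).den G σ).arr .list i = σ.arr .list i := by
  simp only [segment, Cmd.den]
  set σ₁ := (Cmd.mark Arr.hit Var.v Var.u _).den G σ with hσ₁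
  set σ₂ := (Cmd.mark Arr.allowed Var.v Var.u _).den G σ₁ with hσ₂
  set σ₃ := (bfs .allowed .distT tgt).den G σ₂ with hσ₃
  have v₁ : ∀ y, y ≠ .v → y ≠ .u → σ₁.var y = σ.var y := fun y h1 h2 =>
    Cmd.var_den G (by simp [Cmd.mark, Cmd.Writes, h1, h2]) _
  have v₂ : ∀ y, y ≠ .v → y ≠ .u → σ₂.var y = σ.var y := fun y h1 h2 => by
    rw [hσ₂, Cmd.var_den G (by simp [Cmd.mark, Cmd.Writes, h1, h2]), v₁ y h1 h2]
  have v₃ : ∀ y, y ≠ .v → y ≠ .u → y ≠ .step → σ₃.var y = σ.var y := fun y h1 h2 h3 => by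
    rw [hσ₃, Cmd.var_den G (by simp [bfs, bfsRound, Cmd.mark, Cmd.update, Cmd.Writes, h1, h2, h3]),
      v₂ y h1 h2]
  have l₃ : σ₃.arr .list = σ.arr .list := by
    rw [hσ₃, Cmd.arr_den G (by simp [bfs, bfsRound, Cmd.mark, Cmd.update, Cmd.WritesArr]), hσ₂,
      Cmd.arr_den G (by simp [Cmd.mark, Cmd.WritesArr]), hσ₁,
      Cmd.arr_den G (by simp [Cmd.mark, Cmd.WritesArr])]
  have m₁ : σ₁.arr mask = σ.arr mask := by
    rw [hσ₁, Cmd.arr_den G (by simp [Cmd.mark, Cmd.WritesArr, hm])]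
  have hit : ∀ v : Fin n, σ₁.arr .hit v ≠ 0 ↔ ∃ i < p, v = w i ∨ G.Adj v (w i) := by
    intro v
    rw [hσ₁, Cmd.den_mark _ (by simp) (by simp [Form.ReadsArr, Term.ReadsArr]) v.2]
    simp only [Form.Holds, Term.eval, Store.arr_setVar, Store.var_setVar_self,
      Store.var_setVar_of_ne _ _ (show Var.v ≠ Var.u by simp),
      Store.var_setVar_of_ne _ _ (show Var.base ≠ Var.u by simp),
      Store.var_setVar_of_ne _ _ (show Var.base ≠ Var.v by simp),
      Store.var_setVar_of_ne _ _ (show Var.len ≠ Var.u by simp),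
      Store.var_setVar_of_ne _ _ (show Var.len ≠ Var.v by simp)]
    constructor
    · rintro ⟨j, hj, ⟨h1, h2⟩, h3⟩
      refine ⟨j - σ.var .base, by omega, ?_⟩
      have := hlist (j - σ.var .base) (by omega)
      rw [Nat.add_sub_cancel' (by omega)] at this
      rw [this, adjNum_val] at h3
      simpa [Fin.ext_iff] using h3
    · rintro ⟨i, hi, h⟩
      refine ⟨σ.var .base + i, by omega, ⟨by omega, by omega⟩, ?_⟩
      rw [hlist i hi, adjNum_val]
      simpa [Fin.ext_iff] using h
  have allowed : ∀ v : Fin n, σ₂.arr .allowed v ≠ 0 ↔ Remaining G A w p v := by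
    intro v
    rw [hσ₂]
    rw [Cmd.den_mark _ (by simp) (by simp [Form.ReadsArr, Term.ReadsArr, Ne.symm hm']) v.2]
    simp only [Form.Holds, Term.eval, Store.arr_setVar, Store.var_setVar_self,
      Store.var_setVar_of_ne _ _ (show Var.v ≠ Var.u by simp), Store.var_setVar_of_ne _ _ hs.1,
      Store.var_setVar_of_ne _ _ hs.2.1, v₁ _ hs.1 hs.2.1, hsrc, m₁, Remaining, hwp]
    have h1 : (∀ i < p, v ≠ w i ∧ ¬ G.Adj v (w i)) ↔ σ₁.arr .hit v = 0 := by
      rw [← not_iff_not, ← ne_eq (σ₁.arr .hit v), hit]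
      push Not
      simp only [or_iff_not_imp_left]
    rw [h1, ← hA, Fin.ext_iff]
    exact ⟨fun ⟨_, _, h⟩ => h, fun h => ⟨v, v.2, h⟩⟩
  have hdist := den_bfs (G := G) (mask := .allowed) (dist := .distT) (by simp) (by simp) (by simp)
    ht.1 σ₂ allowed (by rw [v₂ _ ht.1 ht.2, htgt]) (by
      obtain ⟨P, h0, h1, -, h2⟩ := hk
      exact h1 ▸ h2 k le_rfl)
  have hcur : (σ₃.setVar .cur (σ₃.var src % (n + 2))).var .cur = s := by
    rw [Store.var_setVar_self, v₃ _ hs.1 hs.2.1 hs.2.2, hsrc]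
    exact Nat.mod_eq_of_lt (by omega)
  have hl : (σ₃.setVar .cur (σ₃.var src % (n + 2))).var .len = σ.var .len := by
    rw [Store.var_setVar_of_ne _ _ (by simp), v₃ _ (by simp) (by simp) (by simp)]
  have key := den_forEach_walkStep (G := G) (B := Remaining G A w p) (t := t) (k := k) hcur
    (by rw [hl]; exact hn) (fun v k hk => hdist v hk) hk hmin
  rw [hl, Store.arr_setVar, l₃] at key
  exact key

end LongOddHole

/-! ### The pieces of the program for one guess. -/

namespace LongOddHole

open WordRAM LoopLang

variable {n : ℕ} {G : SimpleGraph (Fin n)}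

theorem remaining_zero {V : Type*} {G : SimpleGraph V} (A : V → Prop) (w : ℕ → V) :
    Remaining G A w 0 = A := by
  funext v
  simp [Remaining]

/-- Append two segments to the list. -/
def phase (mask : Arr) (a b c : Var) : Cmd Var Arr :=
  .seq (.set .base (.var .len)) (.seq (segment mask a b) (segment mask b c))

/-- The variables that hold the guessed vertices. -/
def Var.IsGuess (y : Var) : Prop := y = .x ∨ y = .d₁ ∨ y = .d₂ ∨ y = .m ∨ y = .m'

theorem not_writes_segment {y : Var} (hy : y.IsGuess ∨ y = .base) (mask : Arr) (a b : Var) :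
    ¬ (segment mask a b).Writes y := by
  rcases hy with (rfl | rfl | rfl | rfl | rfl) | rfl <;>
  simp [segment, walkStep, bfs, bfsRound, Cmd.mark, Cmd.update, Cmd.search, Cmd.Writes]

theorem not_writesArr_segment {a : Arr} (ha : a = .near ∨ a = .far) (mask : Arr) (b c : Var) :
    ¬ (segment mask b c).WritesArr a := by
  rcases ha with rfl | rfl <;>
  simp [segment, walkStep, bfs, bfsRound, Cmd.mark, Cmd.update, Cmd.search, Cmd.WritesArr]

theorem Var.IsGuess.ne {y : Var} (hy : y.IsGuess) :
    y ≠ .v ∧ y ≠ .u ∧ y ≠ .step ∧ y ≠ .base ∧ y ≠ .len := by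
  rcases hy with rfl | rfl | rfl | rfl | rfl <;> simp

/-- The hypothesis `he` is required for every geodesic `u`, because the search returns an arbitrary
one. Resetting `base` confines the exclusion to this phase; the compatibility of the two phases
comes from the choice of `far`. -/
theorem den_phase {mask : Arr} (hmask : mask = .near ∨ mask = .far) {a b c : Var}
    (ha : a.IsGuess) (hb : b.IsGuess) (hc : c.IsGuess) {σ : Store Var Arr} {A : Fin n → Prop}
    {s m t : Fin n} {d e : ℕ} (hA : ∀ v : Fin n, σ.arr mask v ≠ 0 ↔ A v) (hs : σ.var a = s)
    (hm : σ.var b = m) (ht : σ.var c = t) (hn : σ.var .len + d + e ≤ n)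
    (hd : Conn G A d s m) (hmin : ∀ j < d, ¬ Conn G A j s m)
    (he : ∀ u, IsGeodesic G A s m d u → Conn G (Remaining G A u d) e m t ∧
      ∀ j < e, ¬ Conn G (Remaining G A u d) j m t) :
    ∃ u u', IsGeodesic G A s m d u ∧ IsGeodesic G (Remaining G A u d) m t e u' ∧
      ((phase mask a b c).den G σ).var .len = σ.var .len + d + e ∧
      (∀ i < d + e, ((phase mask a b c).den G σ).arr .list (σ.var .len + i) = joinSeq u u' d i) ∧
      ∀ i < σ.var .len, ((phase mask a b c).den G σ).arr .list i = σ.arr .list i := by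
  have hm1 : mask ≠ .hit := by rcases hmask with rfl | rfl <;> simp
  have hm2 : mask ≠ .allowed := by rcases hmask with rfl | rfl <;> simp
  simp only [phase, Cmd.den, Term.eval, Nat.mod_eq_of_lt (show σ.var .len < n + 2 by omega)]
  set σ₁ := σ.setVar .base (σ.var .len) with hσ₁
  set σ₂ := (segment mask a b).den G σ₁ with hσ₂
  have v₁ : ∀ y, y ≠ .base → σ₁.var y = σ.var y := fun y hy => Store.var_setVar_of_ne _ _ hy
  have b₁ : σ₁.var .base = σ.var .len := Store.var_setVar_self _ _ _
  have l₁ : σ₁.var .len = σ.var .len := v₁ _ (by simp)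
  obtain ⟨u, h1, h2, h3, h4⟩ := den_segment (G := G) (mask := mask) (src := a) (tgt := b) (σ := σ₁)
    (A := A) (s := s) (t := m) (p := 0) (k := d) (w := fun _ => s) hm1 hm2
    ⟨ha.ne.1, ha.ne.2.1, ha.ne.2.2.1⟩ ⟨hb.ne.1, hb.ne.2.1⟩ hA (by rw [v₁ _ ha.ne.2.2.2.1, hs])
    (by rw [v₁ _ hb.ne.2.2.2.1, hm]) (by rw [l₁, b₁, add_zero])
    (fun i hi => absurd hi (Nat.not_lt_zero i)) rfl (by omega)
    (by rwa [remaining_zero]) (by rwa [remaining_zero])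
  rw [remaining_zero] at h1
  rw [← hσ₂, l₁] at h2 h3 h4
  have v₂ : ∀ y, y.IsGuess → σ₂.var y = σ.var y := fun y hy => by
    rw [hσ₂, Cmd.var_den G (not_writes_segment (Or.inl hy) _ _ _), v₁ _ hy.ne.2.2.2.1]
  have b₂ : σ₂.var .base = σ.var .len := by
    rw [hσ₂, Cmd.var_den G (not_writes_segment (Or.inr rfl) _ _ _), b₁]
  obtain ⟨k1, k2⟩ := he u h1
  obtain ⟨u', h5, h6, h7, h8⟩ := den_segment (G := G) (mask := mask) (src := b) (tgt := c)
    (σ := σ₂) (A := A) (s := m) (t := t) (p := d) (k := e) (w := u) hm1 hm2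
    ⟨hb.ne.1, hb.ne.2.1, hb.ne.2.2.1⟩ ⟨hc.ne.1, hc.ne.2.1⟩
    (by rw [hσ₂, Cmd.arr_den G (not_writesArr_segment hmask _ _ _)]; exact hA)
    (by rw [v₂ _ hb, hm]) (by rw [v₂ _ hc, ht]) (by rw [h2, b₂])
    (fun i hi => by rw [b₂]; exact h3 i hi) h1.finish (by omega) k1 k2
  rw [h2] at h6 h7 h8
  refine ⟨u, u', h1, h5, h6, fun i hi => ?_, fun i hi => ?_⟩
  · simp only [joinSeq]
    split_ifs with hid
    · rw [h8 _ (by omega), h3 i hid]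
    · rw [← h7 (i - d) (by omega)]
      congr 1
      omega
  · rw [h8 i (by omega), h4 i hi]
    rfl

/-- The guessed vertices are the values of the variables. -/
structure Guess (σ : Store Var Arr) (x d₁ d₂ m m' : Fin n) : Prop where
  x : σ.var .x = x
  d₁ : σ.var .d₁ = d₁
  d₂ : σ.var .d₂ = d₂
  m : σ.var .m = m
  m' : σ.var .m' = m'

theorem Guess.den {σ : Store Var Arr} {x d₁ d₂ m m' : Fin n} (h : Guess σ x d₁ d₂ m m')
    {p : Cmd Var Arr} (hp : ∀ y : Var, y.IsGuess → ¬ p.Writes y) :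
    Guess (p.den G σ) x d₁ d₂ m m' where
  x := by rw [Cmd.var_den G (hp _ (by simp [Var.IsGuess])), h.x]
  d₁ := by rw [Cmd.var_den G (hp _ (by simp [Var.IsGuess])), h.d₁]
  d₂ := by rw [Cmd.var_den G (hp _ (by simp [Var.IsGuess])), h.d₂]
  m := by rw [Cmd.var_den G (hp _ (by simp [Var.IsGuess])), h.m]
  m' := by rw [Cmd.var_den G (hp _ (by simp [Var.IsGuess])), h.m']

/-- Compute `RemoteConfig.nearSet`. -/
def computeNear : Cmd Var Arr :=
  .mark .near .v .u (.and (.not (.eq (.var .v) (.var .x)))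
    (.or (.not (.adj (.var .x) (.var .v)))
      (.or (.eq (.var .v) (.var .d₁)) (.eq (.var .v) (.var .d₂)))))

theorem den_computeNear {σ : Store Var Arr} {x d₁ d₂ m m' : Fin n} (h : Guess σ x d₁ d₂ m m')
    (v : Fin n) :
    (computeNear.den G σ).arr .near v ≠ 0 ↔ RemoteConfig.nearSet G x d₁ d₂ v := by
  rw [computeNear, Cmd.den_mark _ (by simp) (by simp [Form.ReadsArr, Term.ReadsArr]) v.2]
  simp only [Form.Holds, Term.eval, Store.var_setVar, reduceCtorEq, if_false, if_true, h.x, h.d₁,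
    h.d₂, adjNum_val, RemoteConfig.nearSet, ne_eq, Fin.ext_iff]
  exact ⟨fun ⟨_, _, h⟩ => h, fun h => ⟨v, v.2, h⟩⟩

/-- Compute `RemoteConfig.geodSet`. -/
def computeGeod : Cmd Var Arr :=
  .seq (bfs .near .distA .d₁) (.seq (bfs .near .distB .m) (.seq (bfs .near .distC .d₂)
    (.mark .geod .v .u (.and (.not (.eq (.arr .near (.var .v)) (.const 0)))
      (.and (.not (.eq (.var .v) (.var .d₁))) (.and (.not (.eq (.var .v) (.var .d₂)))
        (.or (.not (.lt (.arr .distA (.var .m))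
            (.op .add (.arr .distA (.var .v)) (.arr .distB (.var .v)))))
          (.not (.lt (.arr .distC (.var .m))
            (.op .add (.arr .distB (.var .v)) (.arr .distC (.var .v))))))))))))

/-- Values above `n` stand for unreachable vertices, and as `k ≤ n` they fail the comparison of the
sum by themselves. -/
theorem between_iff_of_dist {A : Fin n → Prop} {f g : Fin n → ℕ} {s t : Fin n} {k : ℕ}
    (hf : ∀ v, ∀ k ≤ n, f v ≤ k ↔ ∃ j ≤ k, Conn G A j v s)
    (hg : ∀ v, ∀ k ≤ n, g v ≤ k ↔ ∃ j ≤ k, Conn G A j v t) (hk : k ≤ n) (v : Fin n) :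
    f v + g v ≤ k ↔ Between G A s t k v := by
  constructor
  · intro h
    obtain ⟨i, hi, h1⟩ := (hf v (f v) (by omega)).1 le_rfl
    obtain ⟨j, hj, h2⟩ := (hg v (g v) (by omega)).1 le_rfl
    exact ⟨i, j, by omega, h1.symm, h2⟩
  · rintro ⟨i, j, hij, h1, h2⟩
    have h3 := (hf v i (by omega)).2 ⟨i, le_rfl, h1.symm⟩
    have h4 := (hg v j (by omega)).2 ⟨j, le_rfl, h2⟩
    omega

theorem dist_eq_of_minimal {A : Fin n → Prop} {f : Fin n → ℕ} {s t : Fin n} {k : ℕ}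
    (hf : ∀ v, ∀ k ≤ n, f v ≤ k ↔ ∃ j ≤ k, Conn G A j v s) (hkn : k ≤ n) (hk : Conn G A k t s)
    (hmin : ∀ j < k, ¬ Conn G A j t s) : f t = k := by
  have h1 := (hf t k hkn).2 ⟨k, le_rfl, hk⟩
  by_contra hne
  obtain ⟨j, hj, h2⟩ := (hf t (f t) (by omega)).1 le_rfl
  exact hmin j (by omega) h2

/-- The program does not know `d` and `e`; it reads them off as the distances from `m` to `d₁` and
to `d₂`. -/
theorem den_computeGeod {σ : Store Var Arr} {x d₁ d₂ m m' : Fin n} (h : Guess σ x d₁ d₂ m m')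
    {A : Fin n → Prop} (hA : ∀ v : Fin n, σ.arr .near v ≠ 0 ↔ A v) {d e : ℕ} (hdn : d ≤ n)
    (hen : e ≤ n) (hd : Conn G A d d₁ m) (hdmin : ∀ j < d, ¬ Conn G A j d₁ m)
    (he : Conn G A e m d₂) (hemin : ∀ j < e, ¬ Conn G A j m d₂) (v : Fin n) :
    (computeGeod.den G σ).arr .geod v ≠ 0 ↔ RemoteConfig.geodSet G A d₁ d₂ m d e v := by
  have hAd : A d₁ ∧ A m := by
    obtain ⟨P, h0, h1, -, h2⟩ := hd
    exact ⟨h0 ▸ h2 0 (by omega), h1 ▸ h2 d le_rfl⟩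
  have hAe : A d₂ := by
    obtain ⟨P, h0, h1, -, h2⟩ := he
    exact h1 ▸ h2 e le_rfl
  simp only [computeGeod, Cmd.den]
  set σ₁ := (bfs .near .distA .d₁).den G σ with hσ₁
  set σ₂ := (bfs .near .distB .m).den G σ₁ with hσ₂
  set σ₃ := (bfs .near .distC .d₂).den G σ₂ with hσ₃
  have w : ∀ a b y, y.IsGuess → ¬ (bfs .near a b).Writes y := by
    rintro a b y (rfl | rfl | rfl | rfl | rfl) <;>
    simp [bfs, bfsRound, Cmd.mark, Cmd.update, Cmd.Writes]
  have n₁ : σ₁.arr .near = σ.arr .near :=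
    Cmd.arr_den G (by simp [bfs, bfsRound, Cmd.mark, Cmd.update, Cmd.WritesArr]) _
  have n₂ : σ₂.arr .near = σ.arr .near := by
    rw [hσ₂, Cmd.arr_den G (by simp [bfs, bfsRound, Cmd.mark, Cmd.update, Cmd.WritesArr]), n₁]
  have n₃ : σ₃.arr .near = σ.arr .near := by
    rw [hσ₃, Cmd.arr_den G (by simp [bfs, bfsRound, Cmd.mark, Cmd.update, Cmd.WritesArr]), n₂]
  have g₁ : Guess σ₁ x d₁ d₂ m m' := h.den (w _ _)
  have g₂ : Guess σ₂ x d₁ d₂ m m' := g₁.den (w _ _)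
  have g₃ : Guess σ₃ x d₁ d₂ m m' := g₂.den (w _ _)
  have a₃ : σ₃.arr .distA = σ₁.arr .distA := by
    rw [hσ₃, Cmd.arr_den G (by simp [bfs, bfsRound, Cmd.mark, Cmd.update, Cmd.WritesArr]), hσ₂,
      Cmd.arr_den G (by simp [bfs, bfsRound, Cmd.mark, Cmd.update, Cmd.WritesArr])]
  have b₃ : σ₃.arr .distB = σ₂.arr .distB := by
    rw [hσ₃, Cmd.arr_den G (by simp [bfs, bfsRound, Cmd.mark, Cmd.update, Cmd.WritesArr])]
  have hfA : ∀ v : Fin n, ∀ k ≤ n, σ₃.arr .distA v ≤ k ↔ ∃ j ≤ k, Conn G A j v d₁ := by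
    intro v k hk
    rw [a₃]
    exact den_bfs (by simp) (by simp) (by simp) (by simp) σ hA h.d₁ hAd.1 v hk
  have hfB : ∀ v : Fin n, ∀ k ≤ n, σ₃.arr .distB v ≤ k ↔ ∃ j ≤ k, Conn G A j v m := by
    intro v k hk
    rw [b₃]
    exact den_bfs (by simp) (by simp) (by simp) (by simp) σ₁ (by rwa [n₁]) g₁.m hAd.2 v hk
  have hfC : ∀ v : Fin n, ∀ k ≤ n, σ₃.arr .distC v ≤ k ↔ ∃ j ≤ k, Conn G A j v d₂ := by
    intro v k hk
    exact den_bfs (by simp) (by simp) (by simp) (by simp) σ₂ (by rwa [n₂]) g₂.d₂ hAe v hk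
  have hAm := dist_eq_of_minimal hfA hdn hd.symm fun j hj h => hdmin j hj h.symm
  have hCm := dist_eq_of_minimal hfC hen he hemin
  rw [Cmd.den_mark _ (by simp) (by simp [Form.ReadsArr, Term.ReadsArr]) v.2]
  simp only [Form.Holds, Term.eval, BinOp.eval, Store.var_setVar, Store.arr_setVar, reduceCtorEq,
    if_false, if_true, g₃.d₁, g₃.d₂, g₃.m, RemoteConfig.geodSet, ne_eq, Fin.ext_iff, hAm, hCm,
    not_lt, n₃]
  rw [between_iff_of_dist hfA hfB hdn, between_iff_of_dist hfB hfC hen, ← ne_eq, hA]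
  exact ⟨fun ⟨_, _, h⟩ => h, fun h => ⟨v, v.2, h⟩⟩

/-- Compute `RemoteConfig.farSet`. -/
def computeFar : Cmd Var Arr :=
  .seq (.mark .hit .v .u (.and (.not (.eq (.arr .geod (.var .u)) (.const 0)))
      (.or (.eq (.var .u) (.var .v)) (.adj (.var .v) (.var .u)))))
    (.mark .far .v .u (.or (.eq (.var .v) (.var .d₁)) (.or (.eq (.var .v) (.var .d₂))
      (.and (.not (.eq (.var .v) (.var .x))) (.eq (.arr .hit (.var .v)) (.const 0))))))

theorem den_computeFar {σ : Store Var Arr} {x d₁ d₂ m m' : Fin n} (h : Guess σ x d₁ d₂ m m')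
    {W : Fin n → Prop} (hW : ∀ v : Fin n, σ.arr .geod v ≠ 0 ↔ W v) (v : Fin n) :
    (computeFar.den G σ).arr .far v ≠ 0 ↔ RemoteConfig.farSet G W x d₁ d₂ v := by
  simp only [computeFar, Cmd.den]
  set σ₁ := (Cmd.mark Arr.hit Var.v Var.u _).den G σ with hσ₁
  have g₁ : Guess σ₁ x d₁ d₂ m m' := h.den (by
    rintro y (rfl | rfl | rfl | rfl | rfl) <;> simp [Cmd.mark, Cmd.Writes])
  have hit : σ₁.arr .hit v ≠ 0 ↔ ∃ w, W w ∧ (w = v ∨ G.Adj v w) := by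
    rw [hσ₁, Cmd.den_mark _ (by simp) (by simp [Form.ReadsArr, Term.ReadsArr]) v.2]
    simp only [Form.Holds, Term.eval, Store.var_setVar, Store.arr_setVar, reduceCtorEq, if_false,
      if_true]
    constructor
    · rintro ⟨j, hj, h1, h2⟩
      refine ⟨⟨j, hj⟩, (hW ⟨j, hj⟩).1 h1, ?_⟩
      rw [← adjNum_val G v ⟨j, hj⟩, Fin.ext_iff]
      exact h2
    · rintro ⟨w, h1, h2⟩
      refine ⟨w, w.2, (hW w).2 h1, ?_⟩
      rwa [adjNum_val, ← Fin.ext_iff]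
  rw [Cmd.den_mark _ (by simp) (by simp [Form.ReadsArr, Term.ReadsArr]) v.2]
  simp only [Form.Holds, Term.eval, Store.var_setVar, Store.arr_setVar, reduceCtorEq, if_false,
    if_true, g₁.x, g₁.d₁, g₁.d₂, RemoteConfig.farSet]
  have h1 : (∀ w, W w → w ≠ v ∧ ¬ G.Adj v w) ↔ σ₁.arr .hit v = 0 := by
    rw [← not_iff_not, ← ne_eq (σ₁.arr .hit v), hit]
    push Not
    simp only [or_iff_not_imp_left]
  rw [h1, Fin.ext_iff, Fin.ext_iff, ne_eq, Fin.ext_iff]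
  exact ⟨fun ⟨_, _, h⟩ => h, fun h => ⟨v, v.2, h⟩⟩

/-- The first `N` entries of `L` are, in order, the vertices of an odd hole of length at least
`ℓ`. -/
def IsHoleList (G : SimpleGraph (Fin n)) (ℓ : ℕ) (L : ℕ → ℕ) (N : ℕ) : Prop :=
  (N % 2 = 1 ∧ ℓ ≤ N ∧ N ≤ n) ∧ ∀ i j, i < j → j < N →
    L i ≠ L j ∧ (AdjNum G (L i) (L j) ↔ j = i + 1 ∨ (i = 0 ∧ j + 1 = N))

/-- The consecutive pairs of a cyclic list. -/
def consecutive : Form Var Arr :=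
  .or (.eq (.var .u) (.op .add (.var .v) (.const 1)))
    (.and (.eq (.var .v) (.const 0)) (.eq (.op .add (.var .u) (.const 1)) (.var .len)))

/-- Set the flag if the list is a long odd hole. -/
def check (ℓ : ℕ) : Cmd Var Arr :=
  .ite (.and (.eq (.op .mod (.var .len) (.const 2)) (.const 1))
      (.and (.not (.lt (.var .len) (.const ℓ))) (.not (.lt .size (.var .len)))))
    (.seq (.mark .hit .v .u (.and (.and (.lt (.var .v) (.var .u)) (.lt (.var .u) (.var .len)))
      (.or (.eq (.arr .list (.var .v)) (.arr .list (.var .u)))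
        (.or (.and (.adj (.arr .list (.var .v)) (.arr .list (.var .u))) (.not consecutive))
          (.and (.not (.adj (.arr .list (.var .v)) (.arr .list (.var .u)))) consecutive)))))
    (.seq (.set .ok (.const 1))
    (.seq (.search .v (.not (.eq (.arr .hit (.var .v)) (.const 0))) .ok (.const 0))
    (.ite (.eq (.var .ok) (.const 1)) (.set .flag (.const 1)) .skip))))
    .skip

-- The array `hit` records the positions `i` that violate the condition with some later `j`. The
-- bound of the length by `n` makes the loops over `0, …, n - 1` cover the whole list.
open Classical in
theorem den_check (ℓ : ℕ) (σ : Store Var Arr) :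
    ((check ℓ).den G σ).var .flag =
      if IsHoleList G ℓ (σ.arr .list) (σ.var .len) then 1 else σ.var .flag := by
  simp only [check, Cmd.den]
  have h0 : (Form.and (.eq (.op .mod (.var .len) (.const 2)) (.const 1))
      (.and (.not (.lt (.var .len) (.const ℓ))) (.not (.lt .size (.var .len)))) :
      Form Var Arr).Holds G σ ↔ σ.var .len % 2 = 1 ∧ ℓ ≤ σ.var .len ∧ σ.var .len ≤ n := by
    simp [Form.Holds, Term.eval, BinOp.eval]
  by_cases h1 : σ.var .len % 2 = 1 ∧ ℓ ≤ σ.var .len ∧ σ.var .len ≤ n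
  swap
  · rw [if_neg (h0.not.2 h1), if_neg fun h => h1 h.1]
  rw [if_pos (h0.2 h1)]
  set σ₁ := (Cmd.mark Arr.hit Var.v Var.u _).den G σ with hσ₁
  have hit : ∀ i < n, σ₁.arr .hit i ≠ 0 ↔ ∃ j, i < j ∧ j < σ.var .len ∧
      ¬ (σ.arr .list i ≠ σ.arr .list j ∧ (AdjNum G (σ.arr .list i) (σ.arr .list j) ↔
        j = i + 1 ∨ (i = 0 ∧ j + 1 = σ.var .len))) := by
    intro i hi
    rw [hσ₁, Cmd.den_mark _ (by simp) (by simp [Form.ReadsArr, Term.ReadsArr, consecutive]) hi]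
    simp only [Form.Holds, Term.eval, BinOp.eval, Store.var_setVar, Store.arr_setVar, reduceCtorEq,
      if_false, if_true, consecutive]
    constructor
    · rintro ⟨j, hj, ⟨h2, h3⟩, h4⟩
      exact ⟨j, h2, h3, by tauto⟩
    · rintro ⟨j, h2, h3, h4⟩
      exact ⟨j, by omega, ⟨h2, h3⟩, by tauto⟩
  have flag₁ : σ₁.var .flag = σ.var .flag :=
    Cmd.var_den G (by simp [Cmd.mark, Cmd.Writes]) _
  simp only [Term.eval, Form.Holds, Nat.mod_eq_of_lt (show 1 < n + 2 by omega)]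
  set τ := (Cmd.search Var.v (.not (.eq (.arr .hit (.var .v)) (.const 0))) Var.ok (.const 0)).den G
    (σ₁.setVar .ok 1) with hτ
  have hflag : τ.var .flag = σ.var .flag := by
    rw [hτ, Cmd.var_den G (by simp [Cmd.search, Cmd.Writes]), Store.var_setVar_of_ne _ _ (by simp),
      flag₁]
  have hok : τ.var .ok = 1 ↔ IsHoleList G ℓ (σ.arr .list) (σ.var .len) := by
    rcases Cmd.den_search (G := G) (u := Var.v) (r := Var.ok)
      (φ := (.not (.eq (.arr .hit (.var .v)) (.const 0)))) (t := .const 0) (σ₁.setVar .ok 1)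
      (by simp) (by simp [Form.ReadsVar, Term.ReadsVar]) (by simp [Term.ReadsVar])
      with ⟨i, hi, h2, h3⟩ | ⟨h2, h3⟩
    · rw [← hτ] at h3
      simp only [Form.Holds, Term.eval, Store.arr_setVar, Store.var_setVar_self] at h2
      obtain ⟨j, h4, h5, h6⟩ := (hit i hi).1 h2
      refine iff_of_false ?_ fun h => h6 (h.2 i j h4 h5)
      rw [h3]
      simp [Term.eval]
    · rw [← hτ] at h3
      refine iff_of_true (by rw [h3]; simp) ⟨h1, fun i j hij hj => ?_⟩
      have h4 := h2 i (by omega)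
      simp only [Form.Holds, Term.eval, Store.arr_setVar, Store.var_setVar_self, not_not] at h4
      by_contra h5
      exact (hit i (by omega)).2 ⟨j, hij, hj, h5⟩ h4
  by_cases h2 : τ.var .ok = 1
  · rw [if_pos h2, if_pos (hok.1 h2)]
    simp
  · rw [if_neg h2, if_neg (hok.not.1 h2), hflag]

end LongOddHole

/-! ### Correctness of the full search and its running time. -/

namespace LongOddHole

open WordRAM LoopLang

section

variable {V : Type*} {G : SimpleGraph V} {ℓ c : ℕ} {C : Set V} {z : ℤ → V}

/-- Two consecutive arcs of the hole are tracked by successive shortest paths. -/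
theorem IsShortestSeq.two_arcs (h : IsShortestSeq G ℓ c C z) {A : V → Prop}
    (hA : ∀ v, A v → ¬ IsMajor G C v) {a : ℤ} {d e : ℕ} (hd : 2 * d + 3 ≤ c) (he : 2 * e + 3 ≤ c)
    (hde : d + e + 2 ≤ c) (hd0 : 0 < d) (harc : ∀ i : ℕ, i ≤ d + e → A (z (a + i))) :
    Conn G A d (z a) (z (a + d)) ∧ (∀ j < d, ¬ Conn G A j (z a) (z (a + d))) ∧
      ∀ u, IsGeodesic G A (z a) (z (a + d)) d u →
        Conn G (Remaining G A u d) e (z (a + d)) (z (a + d + e)) ∧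
        ∀ j < e, ¬ Conn G (Remaining G A u d) j (z (a + d)) (z (a + d + e)) := by
  refine ⟨h.conn_arc fun i hi => harc i (by omega), h.not_conn_of_lt hA hd, fun u hu => ?_⟩
  have hR := h.remaining_arc hA hd hde harc hd0 hu
  exact ⟨h.conn_arc hR, h.not_conn_of_lt (fun v hv => hA v hv.1) he⟩

end

variable {n : ℕ} {G : SimpleGraph (Fin n)} {ℓ : ℕ}

/-- Try to find a hole for the guessed vertices. -/
def attempt (ℓ : ℕ) : Cmd Var Arr :=
  .seq computeNear (.seq computeGeod (.seq computeFar (.seq (.set .len (.const 0))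
    (.seq (phase .near .d₁ .m .d₂) (.seq (phase .far .d₂ .m' .d₁) (check ℓ))))))

theorem IsHoleList.exists_isLongOddHole {L : ℕ → ℕ} {N : ℕ} (hℓ : 5 ≤ ℓ)
    (h : IsHoleList G ℓ L N) : ∃ C : Set (Fin n), IsLongOddHole G ℓ C := by
  obtain ⟨⟨h1, h2, h3⟩, h4⟩ := h
  have hlt : ∀ i < N, L i < n := by
    intro i hi
    -- Each entry is adjacent to the next or the previous one, and `AdjNum` holds only for vertex
    -- numbers.
    rcases Nat.lt_or_ge (i + 1) N with hi' | hi'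
    · exact ((h4 i (i + 1) (by omega) hi').2.2 (Or.inl rfl)).1
    · obtain ⟨-, h5, -⟩ := (h4 (i - 1) i (by omega) hi).2.2 (Or.inl (by omega))
      exact h5
  have hn : 0 < n := by omega
  let f : ℕ → Fin n := fun i => if h : i < N then ⟨L i, hlt i h⟩ else ⟨0, hn⟩
  have hf : ∀ i < N, ((f i : Fin n) : ℕ) = L i := fun i hi => by simp [f, hi]
  obtain ⟨h5, h6⟩ := (HoleSeq.ofWindow (G := G) (N := N) (by omega) f (fun i j hij hj e =>
    (h4 i j hij hj).1 (by rw [← hf i (by omega), ← hf j hj, e])) (fun i j hij hj => by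
    rw [← adjNum_val, hf i (by omega), hf j hj]
    exact (h4 i j hij hj).2)).isHole
  exact ⟨_, h5, by omega, by rw [h6]; exact Nat.odd_iff.2 h1⟩

-- Soundness needs nothing about the paths that were computed: the flag can only be raised by a list
-- that passed the test.
open Classical in
theorem den_attempt_flag (ℓ : ℕ) (σ : Store Var Arr) :
    ∃ L N, ((attempt ℓ).den G σ).var .flag =
      if IsHoleList G ℓ L N then 1 else σ.var .flag := by
  simp only [attempt, Cmd.den]
  rw [den_check]
  refine ⟨_, _, congrArg _ ?_⟩
  rw [Cmd.var_den G (by simp [phase, segment, walkStep, bfs, bfsRound, Cmd.mark, Cmd.update, Cmd.search,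
    Cmd.Writes]), Cmd.var_den G (by simp [phase, segment, walkStep, bfs, bfsRound, Cmd.mark, Cmd.update,
    Cmd.search, Cmd.Writes]), Store.var_setVar_of_ne _ _ (by simp),
    Cmd.var_den G (by simp [computeFar, Cmd.mark, Cmd.Writes]),
    Cmd.var_den G (by simp [computeGeod, bfs, bfsRound, Cmd.update, Cmd.mark, Cmd.Writes]),
    Cmd.var_den G (by simp [computeNear, Cmd.mark, Cmd.Writes])]

theorem not_writes_phase {y : Var} (hy : y.IsGuess) (mask : Arr) (a b c : Var) :
    ¬ (phase mask a b c).Writes y := by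
  simp [phase, Cmd.Writes, hy.ne.2.2.2.1, not_writes_segment (Or.inl hy)]

theorem not_writesArr_phase {a : Arr} (ha : a = .near ∨ a = .far) (mask : Arr) (b c d : Var) :
    ¬ (phase mask b c d).WritesArr a := by
  simp [phase, Cmd.WritesArr, not_writesArr_segment ha]

/-- With the right guess, the hole is found. -/
theorem RemoteConfig.den_attempt {c g : ℕ} {C : Set (Fin n)} {z : ℤ → Fin n} {x : Fin n}
    (h : RemoteConfig G ℓ c C z g x) {σ : Store Var Arr}
    (hσ : Guess σ x (z 0) (z g) (z (g / 2 : ℕ)) (z (g + ((c - g) / 2 : ℕ)))) :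
    ((attempt ℓ).den G σ).var .flag = 1 := by
  have hℓ := h.ctx.five_le
  have hodd := h.ctx.odd
  have hlong := h.long
  have hshort := h.short
  have hcn : c ≤ n := by
    rw [← h.ctx.hole.isHole.2]
    exact (Set.ncard_le_card _).trans_eq (by simp)
  -- Both sides are cut at the middle. Since `g + 3 ≤ c` with `c` odd, and `2ℓ ≤ g`, each of the
  -- four lengths `d, e, d', e'` satisfies the bound `2d + 3 ≤ c` of the distance lemma.
  obtain ⟨d, hd⟩ : ∃ d, d = g / 2 := ⟨_, rfl⟩
  obtain ⟨e, he⟩ : ∃ e, d + e = g := ⟨g - d, by omega⟩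
  obtain ⟨d', hd'⟩ : ∃ d', d' = (c - g) / 2 := ⟨_, rfl⟩
  obtain ⟨e', he'⟩ : ∃ e', d' + e' = c - g := ⟨c - g - d', by omega⟩
  rw [← hd, ← hd'] at hσ
  set A := nearSet G x (z 0) (z g) with hA
  have hAm := h.nearSet_not_major
  have hAarc := h.nearSet_arc
  set W := geodSet G A (z 0) (z g) (z d) d e with hW
  set B := farSet G W x (z 0) (z g) with hB
  have hBm : ∀ v, B v → ¬ IsMajor G C v := h.farSet_not_major he
  have hBarc : ∀ i : ℕ, i ≤ c - g → B (z (g + i)) :=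
    h.farSet_arc he (by omega) (by omega) (by omega) (by omega)
  obtain ⟨p1, p2, p3⟩ := h.ctx.two_arcs hAm (a := 0) (d := d) (e := e) (by omega) (by omega)
    (by omega) (by omega) (by rwa [he])
  obtain ⟨q1, q2, q3⟩ := h.ctx.two_arcs hBm (a := g) (d := d') (e := e') (by omega) (by omega)
    (by omega) (by omega) (by rwa [he'])
  have e1 : (0 : ℤ) + d + e = g := by omega
  have e2 : z (g + d' + e') = z 0 := by
    have := h.ctx.hole.add_period 0
    rw [← this]
    congr 1
    omega
  rw [e1] at p3
  rw [e2] at q3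
  rw [zero_add] at p1 p2 p3
  -- The set `geod` uses distances in all of `A`, whereas the second path found is a geodesic only
  -- within `Remaining`. The distance from `m` to `d₂` in `A` is therefore determined separately.
  have hconn : Conn G A e (z d) (z g) ∧ ∀ j < e, ¬ Conn G A j (z d) (z g) := by
    have e3 : (d : ℤ) + e = g := by omega
    have h1 := h.ctx.conn_arc (A := A) (a := d) (d := e) (fun i hi => by
      have := hAarc (d + i) (by omega)
      rwa [zero_add, Nat.cast_add] at this)
    have h2 := h.ctx.not_conn_of_lt (A := A) hAm (a := d) (d := e) (by omega)
    rw [e3] at h1 h2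
    exact ⟨h1, h2⟩
  simp only [attempt, Cmd.den, Term.eval, Nat.zero_mod]
  set σ₁ := computeNear.den G σ with hσ₁
  set σ₂ := computeGeod.den G σ₁ with hσ₂
  set σ₃ := computeFar.den G σ₂ with hσ₃
  set σ₄ := σ₃.setVar .len 0 with hσ₄
  set σ₅ := (phase .near .d₁ .m .d₂).den G σ₄ with hσ₅
  set σ₆ := (phase .far .d₂ .m' .d₁).den G σ₅ with hσ₆
  have g₁ : Guess σ₁ x (z 0) (z g) (z d) (z (g + d')) := hσ.den (by
    rintro y (rfl | rfl | rfl | rfl | rfl) <;> simp [computeNear, Cmd.mark, Cmd.Writes])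
  have g₂ : Guess σ₂ x (z 0) (z g) (z d) (z (g + d')) := g₁.den (by
    rintro y (rfl | rfl | rfl | rfl | rfl) <;>
    simp [computeGeod, bfs, bfsRound, Cmd.update, Cmd.mark, Cmd.Writes])
  have g₃ : Guess σ₃ x (z 0) (z g) (z d) (z (g + d')) := g₂.den (by
    rintro y (rfl | rfl | rfl | rfl | rfl) <;> simp [computeFar, Cmd.mark, Cmd.Writes])
  have g₄ : Guess σ₄ x (z 0) (z g) (z d) (z (g + d')) := by
    constructor <;> rw [hσ₄, Store.var_setVar_of_ne _ _ (by simp)]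
    exacts [g₃.x, g₃.d₁, g₃.d₂, g₃.m, g₃.m']
  have g₅ : Guess σ₅ x (z 0) (z g) (z d) (z (g + d')) :=
    g₄.den fun y hy => not_writes_phase hy _ _ _ _
  have near₁ : ∀ v : Fin n, σ₁.arr .near v ≠ 0 ↔ A v := den_computeNear hσ
  have geod₂ : ∀ v : Fin n, σ₂.arr .geod v ≠ 0 ↔ W v :=
    den_computeGeod g₁ near₁ (by omega) (by omega) p1 p2 hconn.1 hconn.2
  have far₃ : ∀ v : Fin n, σ₃.arr .far v ≠ 0 ↔ B v := den_computeFar g₂ geod₂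
  have near₄ : ∀ v : Fin n, σ₄.arr .near v ≠ 0 ↔ A v := by
    rw [hσ₄, Store.arr_setVar, hσ₃, Cmd.arr_den G (by simp [computeFar, Cmd.mark, Cmd.WritesArr]),
      hσ₂, Cmd.arr_den G (by simp [computeGeod, bfs, bfsRound, Cmd.update, Cmd.mark, Cmd.WritesArr])]
    exact near₁
  have far₅ : ∀ v : Fin n, σ₅.arr .far v ≠ 0 ↔ B v := by
    rw [hσ₅, Cmd.arr_den G (not_writesArr_phase (Or.inr rfl) _ _ _ _)]
    exact far₃
  have len₄ : σ₄.var .len = 0 := Store.var_setVar_self _ _ _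
  obtain ⟨u, u', hu, hu', len₅, list₅, -⟩ := den_phase (G := G) (mask := .near) (Or.inl rfl)
    (a := .d₁) (b := .m) (c := .d₂) (by simp [Var.IsGuess]) (by simp [Var.IsGuess])
    (by simp [Var.IsGuess]) near₄ g₄.d₁ g₄.m g₄.d₂ (by omega) p1 p2 p3
  obtain ⟨w, w', hw, hw', len₆, list₆, list₆'⟩ := den_phase (G := G) (mask := .far) (Or.inr rfl)
    (a := .d₂) (b := .m') (c := .d₁) (by simp [Var.IsGuess]) (by simp [Var.IsGuess])
    (by simp [Var.IsGuess]) far₅ g₅.d₂ g₅.m' g₅.d₁ (by rw [← hσ₅] at len₅; omega) q1 q2 q3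
  rw [← hσ₅, len₄] at len₅ list₅
  rw [← hσ₆] at len₆ list₆ list₆'
  rw [den_check, if_pos]
  have hlist : ∀ i < c, σ₆.arr .list i = joinSeq (joinSeq u u' d) (joinSeq w w' d') g i := by
    intro i hi
    rw [joinSeq]
    split_ifs with hig
    · rw [list₆' i (by omega), ← list₅ i (by omega), zero_add]
    · rw [← list₆ (i - g) (by omega)]
      congr 1
      omega
  have hind := joinSeq_induced hu hu'
  have hind' := joinSeq_induced hw hw'
  rw [he] at hind
  rw [he'] at hind'
  have hclosed := h.closed (W := W) hind hind' (by simp [joinSeq, show 0 < d by omega, hu.start])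
    (by simp [joinSeq, show ¬ g < d by omega, show g - d = e by omega, hu'.finish])
    (by simp [joinSeq, show 0 < d' by omega, hw.start])
    (by simp [joinSeq, show ¬ c - g < d' by omega, show c - g - d' = e' by omega, hw'.finish])
    (fun i hi hig => geodSet_joinSeq he (by omega) hu hu' hi hig) (fun i hi => by
      rw [joinSeq]
      split_ifs with hid
      · exact hw.mem i hid.le
      · exact (hw'.mem _ (by omega)).1)
  have hlen : σ₆.var .len = c := by omega
  rw [hlen]
  refine ⟨⟨hodd, by omega, hcn⟩, fun i j hij hj => ?_⟩
  rw [hlist i (by omega), hlist j hj, adjNum_val, ne_eq, ← Fin.ext_iff]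
  exact hclosed i j hij hj

/-- Try all guesses. -/
def searchAll (ℓ : ℕ) : Cmd Var Arr :=
  .forEach .x (.forEach .d₁ (.forEach .d₂ (.forEach .m (.forEach .m' (attempt ℓ)))))

theorem forEach_preserves {p : Cmd Var Arr} {r : Var} {I : Store Var Arr → Prop}
    (hp : ∀ τ, I τ → I (p.den G τ)) (hr : ∀ τ k, I τ → I (τ.setVar r k)) (τ : Store Var Arr)
    (hτ : I τ) : I ((Cmd.forEach r p).den G τ) :=
  Cmd.forEach_induction (fun _ ρ => I ρ) hτ (fun _ _ ρ hρ => hp _ (hr ρ _ hρ)) fun ρ => hr ρ n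

theorem den_searchAll_sound (hℓ : 5 ≤ ℓ) {σ : Store Var Arr} (hσ : σ.var .flag = 0) :
    ((searchAll ℓ).den G σ).var .flag = 0 ∨ (((searchAll ℓ).den G σ).var .flag = 1 ∧
      ∃ C : Set (Fin n), IsLongOddHole G ℓ C) := by
  have hr : ∀ r : Var, r ≠ .flag → ∀ (τ : Store Var Arr) k,
      (τ.var .flag = 0 ∨ (τ.var .flag = 1 ∧ ∃ C : Set (Fin n), IsLongOddHole G ℓ C)) →
      ((τ.setVar r k).var .flag = 0 ∨
        ((τ.setVar r k).var .flag = 1 ∧ ∃ C : Set (Fin n), IsLongOddHole G ℓ C)) := by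
    intro r hr τ k h
    rwa [Store.var_setVar_of_ne _ _ hr.symm]
  refine forEach_preserves (forEach_preserves (forEach_preserves (forEach_preserves
    (forEach_preserves (I := fun τ => τ.var .flag = 0 ∨ (τ.var .flag = 1 ∧
      ∃ C : Set (Fin n), IsLongOddHole G ℓ C)) (fun τ hτ => ?_) (hr _ (by simp)))
    (hr _ (by simp))) (hr _ (by simp))) (hr _ (by simp))) (hr _ (by simp)) σ (Or.inl hσ)
  obtain ⟨L, N, h1⟩ := den_attempt_flag (G := G) ℓ τ
  rw [h1]
  split_ifs with hP
  · exact Or.inr ⟨rfl, hP.exists_isLongOddHole hℓ⟩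
  · exact hτ

/-- The command does not reset the flag. -/
def KeepsFlag (G : SimpleGraph (Fin n)) (p : Cmd Var Arr) : Prop :=
  ∀ τ, τ.var .flag = 1 → (p.den G τ).var .flag = 1

theorem keepsFlag_attempt : KeepsFlag G (attempt ℓ) := by
  intro τ hτ
  obtain ⟨L, N, h1⟩ := den_attempt_flag (G := G) ℓ τ
  rw [h1, hτ, ite_self]

theorem KeepsFlag.forEach {p : Cmd Var Arr} (hp : KeepsFlag G p) {r : Var} (hr : r ≠ .flag) :
    KeepsFlag G (.forEach r p) := by
  intro τ hτ
  refine forEach_preserves (I := fun τ => τ.var .flag = 1) hp (fun τ k h => ?_) τ hτ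
  rwa [Store.var_setVar_of_ne _ _ hr.symm]

/-- A loop sets the flag if its body does for the right value of the loop variable. -/
theorem flag_forEach {p : Cmd Var Arr} {r : Var} {S : Set Var} {val : Var → Fin n}
    (hp : KeepsFlag G p) (hr : r ≠ .flag) (hS : ∀ y ∈ S, y ≠ r ∧ ¬ p.Writes y)
    (hgood : ∀ τ : Store Var Arr, (∀ y ∈ insert r S, τ.var y = val y) →
      (p.den G τ).var .flag = 1) (σ : Store Var Arr) (hσ : ∀ y ∈ S, σ.var y = val y) :
    ((Cmd.forEach r p).den G σ).var .flag = 1 := by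
  refine (Cmd.forEach_induction (fun k τ => (∀ y ∈ S, τ.var y = val y) ∧
    ((val r : ℕ) < k → τ.var .flag = 1)) ⟨hσ, fun h => absurd h (Nat.not_lt_zero _)⟩ ?_ ?_).2
    (val r).2
  · intro k hk τ ⟨h1, h2⟩
    have h3 : ∀ y ∈ S, (τ.setVar r k).var y = val y := fun y hy => by
      rw [Store.var_setVar_of_ne _ _ (hS y hy).1, h1 y hy]
    refine ⟨fun y hy => by rw [Cmd.var_den G (hS y hy).2, h3 y hy], fun h => ?_⟩
    rcases Nat.lt_succ_iff_lt_or_eq.1 h with h4 | rfl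
    · refine hp _ ?_
      rw [Store.var_setVar_of_ne _ _ hr.symm, h2 h4]
    · refine hgood _ fun y hy => ?_
      rcases hy with rfl | hy
      · simp
      · exact h3 y hy
  · intro τ ⟨h1, h2⟩
    refine ⟨fun y hy => ?_, fun h => ?_⟩
    · rw [Store.var_setVar_of_ne _ _ (hS y hy).1, h1 y hy]
    · rw [Store.var_setVar_of_ne _ _ hr.symm, h2 h]

theorem not_writes_attempt {y : Var} (hy : y.IsGuess) : ¬ (attempt ℓ).Writes y := by
  have h1 := not_writes_phase hy
  rcases hy with rfl | rfl | rfl | rfl | rfl <;>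
  simp [attempt, computeNear, computeGeod, computeFar, check, bfs, bfsRound, Cmd.mark, Cmd.update,
    Cmd.search, Cmd.Writes, h1]

theorem RemoteConfig.den_searchAll {c g : ℕ} {C : Set (Fin n)} {z : ℤ → Fin n} {x : Fin n}
    (h : RemoteConfig G ℓ c C z g x) (σ : Store Var Arr) :
    ((searchAll ℓ).den G σ).var .flag = 1 := by
  let val : Var → Fin n := fun y => match y with
    | .d₁ => z 0
    | .d₂ => z g
    | .m => z (g / 2 : ℕ)
    | .m' => z (g + ((c - g) / 2 : ℕ))
    | _ => x
  have k0 := keepsFlag_attempt (G := G) (ℓ := ℓ)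
  have k1 := k0.forEach (r := .m') (by simp)
  have k2 := k1.forEach (r := .m) (by simp)
  have k3 := k2.forEach (r := .d₂) (by simp)
  have k4 := k3.forEach (r := .d₁) (by simp)
  have hw : ∀ y : Var, y.IsGuess → ¬ (attempt ℓ).Writes y := fun y => not_writes_attempt
  have hx := hw .x (by simp [Var.IsGuess])
  have h1 := hw .d₁ (by simp [Var.IsGuess])
  have h2 := hw .d₂ (by simp [Var.IsGuess])
  have h3 := hw .m (by simp [Var.IsGuess])
  -- At each level the set `S` consists of the variables already guessed correctly by the outer
  -- loops.
  refine flag_forEach (S := ∅) (val := val) k4 (by simp) (by simp) (fun τ hτ => ?_) σ (by simp)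
  refine flag_forEach (val := val) k3 (by simp) ?_ (fun τ hτ => ?_) τ hτ
  · simp [Cmd.Writes, hx]
  refine flag_forEach (val := val) k2 (by simp) ?_ (fun τ hτ => ?_) τ hτ
  · simp [Cmd.Writes, hx, h1]
  refine flag_forEach (val := val) k1 (by simp) ?_ (fun τ hτ => ?_) τ hτ
  · simp [Cmd.Writes, hx, h1, h2]
  refine flag_forEach (val := val) k0 (by simp) ?_ (fun τ hτ => ?_) τ hτ
  · simp [hx, h1, h2, h3]
  exact h.den_attempt ⟨hτ _ (by simp), hτ _ (by simp), hτ _ (by simp), hτ _ (by simp),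
    hτ _ (by simp)⟩

theorem proper_searchAll : (searchAll ℓ).Proper := by
  have hw : ∀ y : Var, y.IsGuess → ¬ (attempt ℓ).Writes y := fun y => not_writes_attempt
  have hx := hw .x (by simp [Var.IsGuess])
  have h1 := hw .d₁ (by simp [Var.IsGuess])
  have h2 := hw .d₂ (by simp [Var.IsGuess])
  have h3 := hw .m (by simp [Var.IsGuess])
  have h4 := hw .m' (by simp [Var.IsGuess])
  have h5 : (attempt ℓ).Proper := by
    simp [attempt, computeNear, computeGeod, computeFar, check, phase, segment, walkStep, bfs, bfsRound,
      Cmd.mark, Cmd.update, Cmd.search, Cmd.Proper, Cmd.Writes]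
  simp [searchAll, Cmd.Proper, Cmd.Writes, hx, h1, h2, h3, h4, h5]

/-- Five loops for the guesses, and three in breadth-first search: the rounds, and all pairs of
vertices in each round. -/
theorem depth_searchAll : (searchAll ℓ).depth = 8 := by
  simp [searchAll, attempt, computeNear, computeGeod, computeFar, check, phase, segment, walkStep,
    bfs, bfsRound, Cmd.mark, Cmd.update, Cmd.search, Cmd.depth]

/-- The machine layout of the variables and arrays. -/
def layout : Layout Var Arr where
  reg := Var.ctorIdx
  arr := Arr.ctorIdx
  reg_inj a b h := by cases a <;> cases b <;> simp_all [Var.ctorIdx]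
  arr_inj a b h := by cases a <;> cases b <;> simp_all [Arr.ctorIdx]
  arr_lt a := by cases a <;> simp [Arr.ctorIdx]

theorem rep_graphInput (G : SimpleGraph (Fin n)) :
    Rep layout G (graphInput G) ⟨fun _ => 0, fun _ _ => 0⟩ where
  size := by simp [graphInput]
  var r := by simp [graphInput]
  adj i j hi hj := by
    have : (∃ i' j' : Fin n, i * n + j = i' * n + j' ∧ G.Adj i' j') ↔ AdjNum G i j := by
      constructor
      · rintro ⟨i', j', h1, h2⟩
        have h3 : i = i' := by
          have := congrArg (· / n) h1
          simpa [Nat.add_div_of_dvd_right (Dvd.intro_left _ rfl), Nat.mul_div_cancel _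
            (show 0 < n by omega), Nat.div_eq_of_lt hj, Nat.div_eq_of_lt j'.2] using this
        subst h3
        obtain rfl : j = j' := by omega
        rwa [adjNum_val]
      · rintro ⟨h1, h2, h3⟩
        exact ⟨⟨i, h1⟩, ⟨j, h2⟩, rfl, h3⟩
    by_cases h : AdjNum G i j
    · left
      simp only [graphInput, this, h, if_true, and_self]
    · right
      simp only [graphInput, this, h, if_false, not_false_eq_true, and_self]
  arr a i := by
    simp only [graphInput]
    rw [if_neg]
    rintro ⟨i', j', h1, -⟩
    have h2 : (i' + 1) * n ≤ n * n := Nat.mul_le_mul_right n i'.2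
    rw [add_mul] at h2
    omega
  reg_lt r := by
    simp only [graphInput]
    split_ifs <;> omega
  mem_lt a := by
    simp only [graphInput]
    split_ifs <;> omega

theorem isBigO_pow (K : ℕ) :
    (fun n : ℕ => ((K * (n + 1) ^ 8 + 2 : ℕ) : ℝ)) =O[atTop] fun n : ℕ => (n : ℝ) ^ 9 := by
  refine IsBigO.of_bound (K * 2 ^ 8 + 2) ?_
  filter_upwards [eventually_ge_atTop 1] with n hn
  have h1 : K * (n + 1) ^ 8 + 2 ≤ (K * 2 ^ 8 + 2) * n ^ 9 := by
    have h2 : (n + 1) ^ 8 ≤ (2 * n) ^ 8 := Nat.pow_le_pow_left (by omega) 8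
    have h3 : n ^ 8 ≤ n ^ 9 := Nat.pow_le_pow_right hn (by omega)
    have h4 : 1 ≤ n ^ 9 := Nat.one_le_pow _ _ hn
    calc K * (n + 1) ^ 8 + 2 ≤ K * (2 ^ 8 * n ^ 9) + 2 * n ^ 9 := by
          refine add_le_add (Nat.mul_le_mul_left _ ?_) (by omega)
          rw [mul_pow] at h2
          exact h2.trans (Nat.mul_le_mul_left _ h3)
      _ = _ := by ring
  rw [Real.norm_of_nonneg (by positivity), Real.norm_of_nonneg (by positivity)]
  exact_mod_cast h1

end LongOddHole

open LongOddHole LoopLang in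
theorem theorem7p1 (ℓ : ℕ) (hℓ : 5 ≤ ℓ) :
    ∃ (prog : WordRAM.Program) (b : ℕ) (T : ℕ → ℕ),
      ((fun n : ℕ => (T n : ℝ)) =O[atTop] fun n : ℕ => (n : ℝ) ^ 9) ∧
      ∀ (n : ℕ) (G : SimpleGraph (Fin n)), LongOddHole.IsCandidate G ℓ →
        ∃ (t : ℕ) (s : WordRAM.State), t ≤ T n ∧
          WordRAM.Runs ((n + 2) ^ b) prog (WordRAM.graphInput G) t s ∧
          ((s.reg 0 = 1 ∧ ∃ C : Set (Fin n), LongOddHole.IsLongOddHole G ℓ C) ∨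
           (s.reg 0 = 0 ∧
            ¬ ∃ (C : Set (Fin n)) (x d₁ d₂ : Fin n) (D : G.Walk d₁ d₂),
                LongOddHole.IsShortestLongOddHole G ℓ C ∧
                LongOddHole.IsRemoteBase ℓ C x D ∧
                ∀ y, LongOddHole.IsMajor G C y → y = x ∨ G.Adj y x)) := by
  obtain ⟨K, b, hrun⟩ := Cmd.exists_runs layout (searchAll ℓ) proper_searchAll
  -- The final assignment, which copies the flag to register `0`, costs the additional two steps.
  refine ⟨.seq ((searchAll ℓ).compile layout) (.assign 0 (.reg (layout.reg .flag + 1))), b + 1,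
    fun n => K * (n + 1) ^ 8 + 2, isBigO_pow K, fun n G hG => ?_⟩
  obtain ⟨t, s, h1, h2, h3⟩ := hrun (b + 1) (by omega) n G _ _ (rep_graphInput G)
  rw [depth_searchAll] at h3
  refine ⟨_, _, ?_, .seq h1 (.assign s 0 _ (h2.fits _ (by simp [WordRAM.Expr.width]))), ?_⟩
  · simp only [WordRAM.Expr.cost]
    omega
  · have hreg : (s.setReg 0 ((WordRAM.Expr.reg (layout.reg .flag + 1)).eval s)).reg 0 =
        ((searchAll ℓ).den G ⟨fun _ => 0, fun _ _ => 0⟩).var .flag := by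
      simp [WordRAM.State.setReg, WordRAM.Expr.eval, h2.var]
    rw [hreg]
    rcases den_searchAll_sound (G := G) hℓ (σ := ⟨fun _ => 0, fun _ _ => 0⟩) rfl with h4 | h4
    · refine Or.inr ⟨h4, ?_⟩
      rintro ⟨C, x, d₁, d₂, D, hC, hB, hadj⟩
      -- Only the negative answer uses that the graph is a candidate: a remote base would have made
      -- the search set the flag.
      obtain ⟨c, z, hz⟩ := hC.exists_seq hℓ hG
      obtain ⟨z', hR, -⟩ := IsRemoteBase.exists_config hz hB hadj
      have := hR.den_searchAll ⟨fun _ => 0, fun _ _ => 0⟩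
      omega
    · exact Or.inl h4
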